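/- Let $U$ be a connected open coordinate domain in $\mathbb{R}^3$ with a smooth Riemannian metric $g$, and let $\xi$ be a conformal Killing vector field of $g$ with a canonical form $\xi=\widetilde\xi+\mu\eta$, i.e. there are $\sigma,\mu\in\mathbb{R}$ (with $\mu^2\le\sigma$ if $\sigma>0$) and smooth coordinates $(y^1,y^2,y^3)$ on $U$ in which $g$ is a positive smooth multiple of $\sum_A (dy^A)^2$ and $$\widetilde\xi=\tfrac12\big(\sigma+(y^1)^2-(y^2)^2-(y^3)^2\big)\partial_{y^1}+y^1y^2\,\partial_{y^2}+y^1y^3\,\partial_{y^3},\qquad \eta=y^2\partial_{y^3}-y^3\partial_{y^2}.$$ Assume that $\widetilde\xi$ and $\eta$ vanish nowhere on $U$, and put $X=|\widetilde\xi|_g/|\eta|_g$. There is a smooth vector field $\chi$ on $U$ orthogonal to $\widetilde\xi$ and $\eta$ with $|\chi|_g=|\widetilde\xi|_g^{-1}|\eta|_g^{-1}$; fix any such $\chi$. For a vector field $V$ let $\mathcal D(V)=|V|_g^{-5}\big(V\otimes V-\tfrac13|V|_g^2\,g^\sharp\big)$, and for functions $\hat f,\hat h$ of one variable put $$\widehat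 D_{\hat f}=X^4\frac{d}{dX}\Big(\frac{\hat f(X)}{X^{3/2}}\Big)\mathcal D(\widetilde\xi)-\frac1{X^2}\frac{d}{dX}\big(X^{3/2}\hat f(X)\big)\mathcal D(\eta),\qquad \widehat D_{\hat h}=\frac{\hat h(X)}{|\eta|_g^{5/2}|\widetilde\xi|_g^{5/2}}(\widetilde\xi\otimes\eta+\eta\otimes\widetilde\xi),$$ $$D_{\widetilde\xi}=\frac1{|\widetilde\xi|_g^2}(\chi\otimes\widetilde\xi+\widetilde\xi\otimes\chi),\qquad D_\eta=\frac1{|\eta|_g^2}(\chi\otimes\eta+\eta\otimes\chi).$$ A TT-tensor is a symmetric contravariant tensor $D^{AB}$ with $g_{AB}D^{AB}=0$ and $\nabla_AD^{AB}=0$; the KID equation for a vector field $\zeta$ is $\mathcal L_\zeta D+\tfrac53(\mathrm{div}_g\zeta)D=0$. Let $1\le k\le\infty$. 1. Let $D$ be a $C^k$ TT-tensor on $U$ satisfying the KID equations for $\widetilde\xi$ and for $\eta$. Then there are constants $c_1,c_2$ such that on every open $W\subseteq U$ in which the level sets of $X$ are connected (or empty) $$D=\widehat D_{\hat f}+\widehat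 D_{\hat h}+c_1D_{\widetilde\xi}+c_2D_\eta$$ for some functions $\hat f$ of class $C^{k+1}$ and $\hat h$ of class $C^k$ on $X(W)$. (If all level sets of $X$ in $U$ are connected, one may take $W=U$.) 2. Conversely, for all constants $c_1,c_2$ and all functions $\hat f$ of class $C^{k+1}$ and $\hat h$ of class $C^k$ near each point of $X(U)$, the tensor $\widehat D_{\hat f}+\widehat D_{\hat h}+c_1D_{\widetilde\xi}+c_2D_\eta$ is a $C^k$ TT-tensor on $U$ satisfying the KID equations for $\widetilde\xi$ and $\eta$. 3. The construction is conformally covariant: for every smooth $\Omega>0$ on $U$, the function $X$ is the same for $\Omega^2g$ as for $g$, the field $\Omega^{-3}\chi$ is orthogonal to $\widetilde\xi$ and $\eta$ and has the norm $|\widetilde\xi|^{-1}|\eta|^{-1}$ with respect to $\Omega^2g$, and each of the four tensors formed with $\Omega^2g$ and $\Omega^{-3}\chi$ is $\Omega^{-5}$ times the one formed with $g$ and $\chi$. -/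

import Mathlib

open scoped ContDiff

namespace ConfFlat3

noncomputable section

/-- Points of a three-dimensional coordinate domain; also component vectors of vector fields. -/
abbrev Coord : Type := Fin 3 → ℝ

/-- Component arrays of two-index tensors (the metric `g_ij`, or contravariant tensors `D^ij`). -/
abbrev Ten2 : Type := Fin 3 → Fin 3 → ℝ

/-- The partial derivative `∂_i f` at `p`. -/
def pd (i : Fin 3) (f : Coord → ℝ) (p : Coord) : ℝ := fderiv ℝ f p (Pi.single i 1)

/-- The pairing `g_p(u, v) = g_ij(p) u^i v^j`. -/
def ip (g : Coord → Ten2) (p u v : Coord) : ℝ := ∑ i, ∑ j, g p i j * u i * v j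

/-- The pointwise norm `|V|_g` of a vector field. -/
def vnorm (g : Coord → Ten2) (V : Coord → Coord) (p : Coord) : ℝ := √(ip g p (V p) (V p))

/-- `g` is a smooth Riemannian metric on `U`. -/
structure IsMetricOn (U : Set Coord) (g : Coord → Ten2) : Prop where
  smooth : ContDiffOn ℝ ∞ g U
  symm : ∀ p ∈ U, ∀ i j, g p i j = g p j i
  posDef : ∀ p ∈ U, ∀ v : Coord, v ≠ 0 → 0 < ip g p v v

/-- The inverse metric `g^ij`. -/
def ginv (g : Coord → Ten2) (p : Coord) (i j : Fin 3) : ℝ := (Matrix.of (g p))⁻¹ i j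

/-- The Christoffel symbols `Γ^i_jk` of the Levi-Civita connection of `g`. -/
def christoffel (g : Coord → Ten2) (p : Coord) (i j k : Fin 3) : ℝ :=
  (1 / 2) * ∑ l, ginv g p i l *
    (pd j (fun q => g q l k) p + pd k (fun q => g q l j) p - pd l (fun q => g q j k) p)

/-- The divergence `∇_i V^i` of a vector field. -/
def divVec (g : Coord → Ten2) (V : Coord → Coord) (p : Coord) : ℝ :=
  ∑ i, (pd i (fun q => V q i) p + ∑ k, christoffel g p i i k * V p k)

/-- The divergence `∇_i D^ij` of a contravariant two-tensor. -/
def divTen (g : Coord → Ten2) (D : Coord → Ten2) (p : Coord) (j : Fin 3) : ℝ :=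
  ∑ i, (pd i (fun q => D q i j) p + ∑ k, christoffel g p i i k * D p k j
    + ∑ k, christoffel g p j i k * D p i k)

/-- The Lie derivative `(L_V D)^ij` of a contravariant two-tensor. -/
def lieTen (V : Coord → Coord) (D : Coord → Ten2) (p : Coord) (i j : Fin 3) : ℝ :=
  ∑ k, (V p k * pd k (fun q => D q i j) p
    - D p k j * pd k (fun q => V q i) p - D p i k * pd k (fun q => V q j) p)

/-- The Lie derivative `(L_V g)_ij` of a covariant two-tensor. -/
def lieMetric (V : Coord → Coord) (g : Coord → Ten2) (p : Coord) (i j : Fin 3) : ℝ :=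
  ∑ k, (V p k * pd k (fun q => g q i j) p
    + g p k j * pd i (fun q => V q k) p + g p i k * pd j (fun q => V q k) p)

/-- `ξ` is a conformal Killing vector field of `g` on `U` (dimension three). -/
def IsCKVF (U : Set Coord) (g : Coord → Ten2) (ξ : Coord → Coord) : Prop :=
  ContDiffOn ℝ ∞ ξ U ∧
    ∀ p ∈ U, ∀ i j, lieMetric ξ g p i j = (2 / 3) * divVec g ξ p * g p i j

/-- `D` is a symmetric, trace-free and divergence-free contravariant tensor on `U`. -/
structure IsTT (U : Set Coord) (g : Coord → Ten2) (D : Coord → Ten2) : Prop where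
  symm : ∀ p ∈ U, ∀ i j, D p i j = D p j i
  traceFree : ∀ p ∈ U, ∑ i, ∑ j, g p i j * D p i j = 0
  divFree : ∀ p ∈ U, ∀ j, divTen g D p j = 0

/-- The Killing initial data equation `L_ξ D + ((n + 2) / n) (div_g ξ) D = 0` for `n = 3`. -/
def IsKID (U : Set Coord) (g : Coord → Ten2) (ξ : Coord → Coord) (D : Coord → Ten2) : Prop :=
  ∀ p ∈ U, ∀ i j, lieTen ξ D p i j + (5 / 3) * divVec g ξ p * D p i j = 0

/-- The conformal Killing field
`b + (a · y) y - (1/2) |y|² a` of Euclidean space with `a = (1, 0, 0)`, `b = (σ/2, 0, 0)`. -/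
def canonXi (σ : ℝ) (y : Coord) : Coord :=
  ![(σ + y 0 ^ 2 - y 1 ^ 2 - y 2 ^ 2) / 2, y 0 * y 1, y 0 * y 2]

/-- The axial Killing field `y¹ ∂_2 - y² ∂_1` (indices `0, 1, 2`) of Euclidean space. -/
def canonEta (y : Coord) : Coord := ![0, -(y 2), y 1]

/-- `ψ` is a set of canonical coordinates on `U`, and `ξ = ξt + μ η` is a canonical form with
parameters `σ, μ`: the metric is conformal to the Euclidean metric of the coordinates `ψ`,
and in these coordinates `ξt` and `η` are `canonXi σ` and `canonEta`. The parameters are ordered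
as the squared eigenvalues of the associated skew-symmetric endomorphism:
`μ² ≤ σ` if `σ > 0` (and `σ ≤ 0 ≤ μ²` otherwise). -/
structure IsCanonicalChart (U : Set Coord) (g : Coord → Ten2) (ξ ξt η : Coord → Coord)
    (μ σ : ℝ) (ψ : Coord → Coord) : Prop where
  smooth : ContDiffOn ℝ ∞ ψ U
  injOn : Set.InjOn ψ U
  conformal : ∃ Ω : Coord → ℝ, ContDiffOn ℝ ∞ Ω U ∧ (∀ p ∈ U, 0 < Ω p) ∧
    ∀ p ∈ U, ∀ u v : Coord,
      ip g p u v = Ω p ^ 2 * ∑ i, fderiv ℝ ψ p u i * fderiv ℝ ψ p v i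
  map_xi : ∀ p ∈ U, fderiv ℝ ψ p (ξt p) = canonXi σ (ψ p)
  map_eta : ∀ p ∈ U, fderiv ℝ ψ p (η p) = canonEta (ψ p)
  decomp : ∀ p ∈ U, ξ p = ξt p + μ • η p
  order : 0 < σ → μ ^ 2 ≤ σ

/-- `ξ = ξt + μ η` is a canonical form on `U` for some canonical coordinates. -/
def IsCanonicalForm (U : Set Coord) (g : Coord → Ten2) (ξ ξt η : Coord → Coord)
    (μ σ : ℝ) : Prop :=
  ∃ ψ : Coord → Coord, IsCanonicalChart U g ξ ξt η μ σ ψ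

/-- The quotient `|ξt|_g / |η|_g`. -/
def quotX (g : Coord → Ten2) (ξt η : Coord → Coord) (p : Coord) : ℝ :=
  vnorm g ξt p / vnorm g η p

/-- `χ` is a vector field orthogonal to `ξt` and `η`, of norm `|ξt|⁻¹ |η|⁻¹`. -/
structure IsAuxiliary (U : Set Coord) (g : Coord → Ten2) (ξt η χ : Coord → Coord) : Prop where
  smooth : ContDiffOn ℝ ∞ χ U
  orth_xi : ∀ p ∈ U, ip g p (χ p) (ξt p) = 0
  orth_eta : ∀ p ∈ U, ip g p (χ p) (η p) = 0
  norm_eq : ∀ p ∈ U, vnorm g χ p = (vnorm g ξt p)⁻¹ * (vnorm g η p)⁻¹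

/-- `𝒟(V) = |V|^(-5) (V ⊗ V - (|V|² / 3) g^♯)`. -/
def calD (g : Coord → Ten2) (V : Coord → Coord) (p : Coord) : Ten2 := fun i j =>
  (V p i * V p j - vnorm g V p ^ 2 / 3 * ginv g p i j) / vnorm g V p ^ 5

/-- `V ⊗ W + W ⊗ V`. -/
def symProd (V W : Coord → Coord) (p : Coord) : Ten2 := fun i j =>
  V p i * W p j + W p i * V p j

/-- The tensor `D̂_f`:
`X⁴ (f / X^(3/2))' 𝒟(ξt) - X⁻² (X^(3/2) f)' 𝒟(η)`, with `'` the derivative in `X`. -/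
def tensorF (g : Coord → Ten2) (ξt η : Coord → Coord) (f : ℝ → ℝ) (p : Coord) : Ten2 :=
  (quotX g ξt η p ^ 4 * deriv (fun x : ℝ => f x / x ^ (3 / 2 : ℝ)) (quotX g ξt η p)) •
      calD g ξt p
    - ((quotX g ξt η p ^ 2)⁻¹ * deriv (fun x : ℝ => x ^ (3 / 2 : ℝ) * f x) (quotX g ξt η p)) •
      calD g η p

/-- The tensor `D̂_h`: `h(X) |η|^(-5/2) |ξt|^(-5/2) (ξt ⊗ η + η ⊗ ξt)`. -/
def tensorH (g : Coord → Ten2) (ξt η : Coord → Coord) (h : ℝ → ℝ) (p : Coord) : Ten2 :=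
  (h (quotX g ξt η p) / (vnorm g η p ^ (5 / 2 : ℝ) * vnorm g ξt p ^ (5 / 2 : ℝ))) •
    symProd ξt η p

/-- The tensor `D_V = |V|⁻² (χ ⊗ V + V ⊗ χ)`, used for `V = ξt` and `V = η`. -/
def tensorV (g : Coord → Ten2) (χ V : Coord → Coord) (p : Coord) : Ten2 :=
  (vnorm g V p ^ 2)⁻¹ • symProd χ V p

/-- `D̂_f + D̂_h + c₁ D_ξt + c₂ D_η`. Constant factors of the first two
tensors are absorbed in `f` and `h`, in which these tensors are linear. -/
def combination (g : Coord → Ten2) (ξt η χ : Coord → Coord) (f h : ℝ → ℝ) (c₁ c₂ : ℝ)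
    (p : Coord) : Ten2 :=
  tensorF g ξt η f p + tensorH g ξt η h p + c₁ • tensorV g χ ξt p + c₂ • tensorV g χ η p

/-- The metric `Ω² g`. -/
def rescale (Ω : Coord → ℝ) (g : Coord → Ten2) : Coord → Ten2 := fun p i j => Ω p ^ 2 * g p i j

end

end ConfFlat3

open ConfFlat3

/-! The problem is conformally covariant, so it can be solved in Euclidean space. If `g = Ω² ψ^*δ`
in the canonical chart `ψ`, then `E = Ω⁵ ψ_* D` satisfies the flat TT and KID equations exactly when
`D` satisfies those of `g` (`divTen_push`, `lieTen_push`); the exponent is `n + 2` with `n = 3`.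

In the flat model put `P = |ξ|²`, `Q = |η|²`, and let `ν` be the field orthogonal to `ξ` and `η`
with `|ν|² = PQ`. Here `[ξ, η] = [η, ν] = 0` and `[ξ, ν] = y⁰ ν`. The KID equations therefore
prescribe the derivatives along `ξ` and `η` of all contractions of `E` with this frame, and the
divergence equation, expanded in the frame, prescribes the `ν`-derivative of `E(ν, ·)`. It follows
that `E(ν, ξ)` and `E(ν, η)` are constants, which are `c₁` and `c₂`. The functions `P^(-1/4)
Q^(-1/4) E(ν, ν)` and `P^(1/4) Q^(1/4) E(ξ, η)` are annihilated by `ξ` and `η`, hence are locally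
functions `f` and `h` of `X` wherever `dX ≠ 0`. The `ν`-derivative of the first gives `E(η, η)` in
terms of `f` and `X f'`, and the vanishing trace gives `E(ξ, ξ)`. So `E` is determined
(`expand_frame`, `flat_classification`). Since `X f'` is an algebraic expression in `E`, it is as
regular as `E`, and `f` has one derivative more.

Connected level sets turn local functions of `X` into global ones (`exists_factor`), and they also
exclude critical points of `X` (`not_critical`). Critical points lie on the sphere `|y|² = -σ`;
inversion in this sphere preserves `X` and exchanges its two sides, so level sets close to a
critical point would be disconnected.

The converse is a computation with 1-jets, one summand at a time (`flatComb_hasGrad`). Any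
admissible `χ` is `±Ω⁻³ (PQ)⁻¹ ν` in the chart, with a sign that is constant by connectedness
(`auxiliary_eq`) and is absorbed in `c₁` and `c₂`. -/

namespace ConfFlat3

noncomputable section

/-! ### Gradients of functions of three variables -/

/-- The function `F` is differentiable at `y` with partial derivatives `G`. -/
def HasGrad (F : Coord → ℝ) (G : Coord) (y : Coord) : Prop :=
  HasFDerivAt F (∑ i, G i • (ContinuousLinearMap.proj i : Coord →L[ℝ] ℝ)) y

theorem HasGrad.pd {F : Coord → ℝ} {G y : Coord} (h : HasGrad F G y) (i : Fin 3) :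
    pd i F y = G i := by
  rw [ConfFlat3.pd, HasFDerivAt.fderiv h]
  simp [Pi.single_apply]

theorem fderiv_apply_eq_sum_pd (F : Coord → ℝ) (y u : Coord) :
    fderiv ℝ F y u = ∑ i, u i * pd i F y := by
  conv_lhs => rw [pi_eq_sum_univ' u]
  simp only [map_sum, map_smul, smul_eq_mul, pd]

theorem hasGrad_pd {F : Coord → ℝ} {y : Coord} (h : DifferentiableAt ℝ F y) :
    HasGrad F (fun i => pd i F y) y := by
  refine h.hasFDerivAt.congr_fderiv (ContinuousLinearMap.ext fun u => ?_)
  rw [fderiv_apply_eq_sum_pd]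
  simp [mul_comm]

theorem HasGrad.differentiableAt {F : Coord → ℝ} {G y : Coord} (h : HasGrad F G y) :
    DifferentiableAt ℝ F y := HasFDerivAt.differentiableAt h

theorem HasGrad.fderiv_apply {F : Coord → ℝ} {G y : Coord} (h : HasGrad F G y) (u : Coord) :
    fderiv ℝ F y u = ∑ i, u i * G i := by
  rw [fderiv_apply_eq_sum_pd]
  simp [h.pd]

theorem HasGrad.congr {F : Coord → ℝ} {G G' y : Coord} (h : HasGrad F G y)
    (e : ∀ i, G i = G' i) : HasGrad F G' y := by
  rwa [← funext e]

theorem hasGrad_const (c : ℝ) (y : Coord) : HasGrad (fun _ => c) (fun _ => 0) y := by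
  refine (hasFDerivAt_const c y).congr_fderiv ?_
  simp

theorem hasGrad_coord (A : Fin 3) (y : Coord) :
    HasGrad (fun q => q A) (fun i => if i = A then 1 else 0) y := by
  refine ((ContinuousLinearMap.proj A : Coord →L[ℝ] ℝ).hasFDerivAt (x := y)).congr_fderiv ?_
  ext u
  simp

theorem HasGrad.add {F₁ F₂ : Coord → ℝ} {G₁ G₂ y : Coord} (h₁ : HasGrad F₁ G₁ y)
    (h₂ : HasGrad F₂ G₂ y) : HasGrad (fun q => F₁ q + F₂ q) (fun i => G₁ i + G₂ i) y := by
  refine (HasFDerivAt.fun_add h₁ h₂).congr_fderiv ?_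
  simp [add_smul, Finset.sum_add_distrib]

theorem HasGrad.sub {F₁ F₂ : Coord → ℝ} {G₁ G₂ y : Coord} (h₁ : HasGrad F₁ G₁ y)
    (h₂ : HasGrad F₂ G₂ y) : HasGrad (fun q => F₁ q - F₂ q) (fun i => G₁ i - G₂ i) y := by
  refine (HasFDerivAt.fun_sub h₁ h₂).congr_fderiv (ContinuousLinearMap.ext fun u => ?_)
  simp [sub_mul, Finset.sum_sub_distrib]

theorem HasGrad.mul {F₁ F₂ : Coord → ℝ} {G₁ G₂ y : Coord} (h₁ : HasGrad F₁ G₁ y)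
    (h₂ : HasGrad F₂ G₂ y) :
    HasGrad (fun q => F₁ q * F₂ q) (fun i => G₁ i * F₂ y + F₁ y * G₂ i) y := by
  refine (HasFDerivAt.fun_mul h₁ h₂).congr_fderiv ?_
  simp only [add_smul, Finset.sum_add_distrib, Finset.smul_sum, smul_smul]
  rw [add_comm]
  congr 1
  exact Finset.sum_congr rfl fun i _ => by rw [mul_comm]

theorem HasGrad.neg {F : Coord → ℝ} {G y : Coord} (h : HasGrad F G y) :
    HasGrad (fun q => -F q) (fun i => -G i) y := by
  simpa using (hasGrad_const 0 y).sub h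

theorem HasGrad.scomp {F : Coord → ℝ} {G y : Coord} {u : ℝ → ℝ} {u' : ℝ}
    (h : HasGrad F G y) (hu : HasDerivAt u u' (F y)) :
    HasGrad (fun q => u (F q)) (fun i => u' * G i) y := by
  refine (hu.comp_hasFDerivAt y h).congr_fderiv ?_
  simp [Finset.smul_sum, smul_smul]

theorem HasGrad.sum {ι : Type*} (s : Finset ι) {F : ι → Coord → ℝ} {G : ι → Coord} {y : Coord}
    (h : ∀ a ∈ s, HasGrad (F a) (G a) y) :
    HasGrad (fun q => ∑ a ∈ s, F a q) (fun i => ∑ a ∈ s, G a i) y := by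
  classical
  induction s using Finset.induction_on with
  | empty => simpa using hasGrad_const 0 y
  | insert a s ha ih =>
    simp only [Finset.sum_insert ha]
    exact (h a (by simp)).add (ih fun b hb => h b (by simp [hb]))

/-! ### The flat model -/

/-- The squared distance `|η|²` from the axis of rotation. -/
def rhoSq (y : Coord) : ℝ := y 1 ^ 2 + y 2 ^ 2

/-- The axial component of `canonXi`. -/
def axial (σ : ℝ) (y : Coord) : ℝ := (σ + y 0 ^ 2 - y 1 ^ 2 - y 2 ^ 2) / 2

/-- The Euclidean squared norm of `canonXi`. -/
def xiSq (σ : ℝ) (y : Coord) : ℝ := axial σ y ^ 2 + y 0 ^ 2 * rhoSq y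

/-- A vector field orthogonal to `canonXi` and `canonEta`, of squared norm `xiSq * rhoSq`. -/
def canonNu (σ : ℝ) (y : Coord) : Coord :=
  ![-(y 0 * rhoSq y), axial σ y * y 1, axial σ y * y 2]

/-- The Euclidean quotient of the norms of `canonXi` and `canonEta`. -/
def flatX (σ : ℝ) (y : Coord) : ℝ := √(xiSq σ y) / √(rhoSq y)

/-- The partial derivatives `∂_C ξ_A` of `canonXi`. -/
def dXi (y : Coord) : Fin 3 → Fin 3 → ℝ :=
  ![![y 0, y 1, y 2], ![-y 1, y 0, 0], ![-y 2, 0, y 0]]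

/-- The partial derivatives `∂_C η_A` of `canonEta`. -/
def dEta : Fin 3 → Fin 3 → ℝ := ![![0, 0, 0], ![0, 0, 1], ![0, -1, 0]]

/-- The partial derivatives `∂_C ν_A` of `canonNu`. -/
def dNu (σ : ℝ) (y : Coord) : Fin 3 → Fin 3 → ℝ :=
  ![![-rhoSq y, y 0 * y 1, y 0 * y 2],
    ![-(2 * y 0 * y 1), axial σ y - y 1 ^ 2, -(y 1 * y 2)],
    ![-(2 * y 0 * y 2), -(y 1 * y 2), axial σ y - y 2 ^ 2]]

/-- The gradient of `rhoSq`. -/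
def gradRho (y : Coord) : Coord := ![0, 2 * y 1, 2 * y 2]

/-- The gradient of `xiSq`. -/
def gradXiSq (σ : ℝ) (y : Coord) : Coord :=
  ![2 * axial σ y * y 0 + 2 * y 0 * rhoSq y, -(2 * axial σ y * y 1) + 2 * y 0 ^ 2 * y 1,
    -(2 * axial σ y * y 2) + 2 * y 0 ^ 2 * y 2]

theorem canonXi_eq (σ : ℝ) (y : Coord) :
    canonXi σ y = ![axial σ y, y 0 * y 1, y 0 * y 2] := rfl

theorem hasGrad_rhoSq (y : Coord) : HasGrad rhoSq (gradRho y) y := by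
  have h := ((hasGrad_coord 1 y).mul (hasGrad_coord 1 y)).add
    ((hasGrad_coord 2 y).mul (hasGrad_coord 2 y))
  have e : rhoSq = fun q : Coord => q 1 * q 1 + q 2 * q 2 := by
    funext q; simp only [rhoSq]; ring
  rw [e]
  refine h.congr fun i => ?_
  fin_cases i <;> simp [gradRho] <;> ring

theorem hasGrad_axial (σ : ℝ) (y : Coord) : HasGrad (axial σ) ![y 0, -y 1, -y 2] y := by
  have h := (((hasGrad_const σ y).add ((hasGrad_coord 0 y).mul (hasGrad_coord 0 y))).sub
    (hasGrad_rhoSq y)).mul (hasGrad_const (1 / 2) y)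
  have e : axial σ = fun q : Coord => (σ + q 0 * q 0 - rhoSq q) * (1 / 2) := by
    funext q; simp only [rhoSq, axial]; ring
  rw [e]
  refine h.congr fun i => ?_
  fin_cases i <;> simp [gradRho] <;> ring

theorem hasGrad_xiSq (σ : ℝ) (y : Coord) : HasGrad (xiSq σ) (gradXiSq σ y) y := by
  have h := ((hasGrad_axial σ y).mul (hasGrad_axial σ y)).add
    (((hasGrad_coord 0 y).mul (hasGrad_coord 0 y)).mul (hasGrad_rhoSq y))
  have e : xiSq σ = fun q : Coord => axial σ q * axial σ q + q 0 * q 0 * rhoSq q := by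
    funext q; simp only [xiSq]; ring
  rw [e]
  refine h.congr fun i => ?_
  fin_cases i <;> simp [gradRho, gradXiSq] <;> ring

theorem hasGrad_xi (σ : ℝ) (y : Coord) (A : Fin 3) :
    HasGrad (fun q => canonXi σ q A) (fun C => dXi y C A) y := by
  fin_cases A
  · refine (hasGrad_axial σ y).congr fun i => ?_
    fin_cases i <;> simp [dXi]
  · refine ((hasGrad_coord 0 y).mul (hasGrad_coord 1 y)).congr fun i => ?_
    fin_cases i <;> simp [dXi]
  · refine ((hasGrad_coord 0 y).mul (hasGrad_coord 2 y)).congr fun i => ?_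
    fin_cases i <;> simp [dXi]

theorem hasGrad_eta (y : Coord) (A : Fin 3) :
    HasGrad (fun q => canonEta q A) (fun C => dEta C A) y := by
  fin_cases A
  · refine (hasGrad_const 0 y).congr fun i => ?_
    fin_cases i <;> simp [dEta]
  · refine (hasGrad_coord 2 y).neg.congr fun i => ?_
    fin_cases i <;> simp [dEta]
  · refine (hasGrad_coord 1 y).congr fun i => ?_
    fin_cases i <;> simp [dEta]

theorem hasGrad_nu (σ : ℝ) (y : Coord) (A : Fin 3) :
    HasGrad (fun q => canonNu σ q A) (fun C => dNu σ y C A) y := by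
  fin_cases A
  · refine ((hasGrad_coord 0 y).mul (hasGrad_rhoSq y)).neg.congr fun i => ?_
    fin_cases i <;> simp [dNu, gradRho] <;> ring
  · refine ((hasGrad_axial σ y).mul (hasGrad_coord 1 y)).congr fun i => ?_
    fin_cases i <;> simp [dNu] <;> ring
  · refine ((hasGrad_axial σ y).mul (hasGrad_coord 2 y)).congr fun i => ?_
    fin_cases i <;> simp [dNu] <;> ring

/-- The scalar `u(X) P^r Q^t` with `P = |ξ|²` and `Q = |η|²`. -/
def weighted (σ : ℝ) (u : ℝ → ℝ) (r t : ℝ) (y : Coord) : ℝ :=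
  u (flatX σ y) * xiSq σ y ^ r * rhoSq y ^ t

theorem flatX_pos {σ : ℝ} {y : Coord} (hP : 0 < xiSq σ y) (hQ : 0 < rhoSq y) :
    0 < flatX σ y := by
  unfold flatX; positivity

theorem hasGrad_flatX {σ : ℝ} {y : Coord} (hP : 0 < xiSq σ y) (hQ : 0 < rhoSq y) :
    HasGrad (flatX σ) (fun C => flatX σ y / 2 *
      (gradXiSq σ y C / xiSq σ y - gradRho y C / rhoSq y)) y := by
  have hp := (hasGrad_xiSq σ y).scomp (Real.hasDerivAt_sqrt hP.ne')
  have hq := ((hasGrad_rhoSq y).scomp (Real.hasDerivAt_sqrt hQ.ne')).scomp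
    (hasDerivAt_inv (Real.sqrt_pos.2 hQ).ne')
  have h := hp.mul hq
  have e : flatX σ = fun q : Coord => √(xiSq σ q) * (√(rhoSq q))⁻¹ := by
    funext q; simp only [flatX]; rfl
  rw [e]
  refine h.congr fun C => ?_
  have h1 := Real.sq_sqrt hP.le
  have h2 := Real.sq_sqrt hQ.le
  have h3 := Real.sqrt_pos.2 hP
  have h4 := Real.sqrt_pos.2 hQ
  set p := √(xiSq σ y)
  set q := √(rhoSq y)
  rw [← h1, ← h2]
  field_simp
  ring

/-- The gradient is written in terms of `dP/P` and `dQ/Q`, since `dX = (X/2)(dP/P - dQ/Q)`. With `w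
= u' X P^r Q^t` the coefficients `w/2 + r s` and `-w/2 + t s` have the form assumed by the
`flatSolAt` lemmas, whatever `u` is. -/
theorem hasGrad_weighted {σ : ℝ} {y : Coord} (hP : 0 < xiSq σ y) (hQ : 0 < rhoSq y)
    {u : ℝ → ℝ} {u' : ℝ} (hu : HasDerivAt u u' (flatX σ y)) (r t : ℝ) :
    HasGrad (weighted σ u r t) (fun C =>
      (u' * flatX σ y * xiSq σ y ^ r * rhoSq y ^ t / 2 + r * weighted σ u r t y) *
          (gradXiSq σ y C / xiSq σ y) +
      (-(u' * flatX σ y * xiSq σ y ^ r * rhoSq y ^ t) / 2 + t * weighted σ u r t y) *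
          (gradRho y C / rhoSq y)) y := by
  have h := (((hasGrad_flatX hP hQ).scomp hu).mul ((hasGrad_xiSq σ y).scomp
    (Real.hasDerivAt_rpow_const (p := r) (Or.inl hP.ne')))).mul ((hasGrad_rhoSq y).scomp
    (Real.hasDerivAt_rpow_const (p := t) (Or.inl hQ.ne')))
  refine h.congr fun C => ?_
  simp only [weighted, Real.rpow_sub_one hP.ne', Real.rpow_sub_one hQ.ne']
  field_simp
  ring

/-- The TT and KID conditions of the flat model at the point `y`, for a tensor with value `e` and
partial derivatives `d k i j = ∂_k E^ij` at `y`. -/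
structure FlatSolAt (σ : ℝ) (y : Coord) (e : Ten2) (d : Fin 3 → Ten2) : Prop where
  symm : ∀ i j, e i j = e j i
  trace : ∑ i, e i i = 0
  div : ∀ j, ∑ i, d i i j = 0
  kidXi : ∀ i j, ∑ k, (canonXi σ y k * d k i j - e k j * dXi y k i - e i k * dXi y k j)
    + 5 * y 0 * e i j = 0
  kidEta : ∀ i j, ∑ k, (canonEta y k * d k i j - e k j * dEta k i - e i k * dEta k j) = 0

/-- All components of `E` are differentiable at `y`, with partial derivatives `d`. -/
def HasGradTen (E : Coord → Ten2) (d : Fin 3 → Ten2) (y : Coord) : Prop :=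
  ∀ i j, HasGrad (fun q => E q i j) (fun k => d k i j) y

/-- The conditions are linear in the 1-jet `(e, d)` with `d` treated as free data, so the summands
of the general solution can be verified separately. -/
theorem FlatSolAt.add {σ : ℝ} {y : Coord} {e e' : Ten2} {d d' : Fin 3 → Ten2}
    (h : FlatSolAt σ y e d) (h' : FlatSolAt σ y e' d') :
    FlatSolAt σ y (e + e') (d + d') where
  symm i j := by simp [h.symm i j, h'.symm i j]
  trace := by simp [Finset.sum_add_distrib, h.trace, h'.trace]
  div j := by simp [Finset.sum_add_distrib, h.div j, h'.div j]
  kidXi i j := by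
    have h1 := h.kidXi i j
    have h2 := h'.kidXi i j
    simp only [Fin.sum_univ_three, Pi.add_apply] at *
    linear_combination h1 + h2
  kidEta i j := by
    have h1 := h.kidEta i j
    have h2 := h'.kidEta i j
    simp only [Fin.sum_univ_three, Pi.add_apply] at *
    linear_combination h1 + h2

theorem HasGradTen.add {E E' : Coord → Ten2} {d d' : Fin 3 → Ten2} {y : Coord}
    (h : HasGradTen E d y) (h' : HasGradTen E' d' y) : HasGradTen (E + E') (d + d') y :=
  fun i j => (h i j).add (h' i j)

/-- The tensor `s (V ⊗ W + W ⊗ V)`. -/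
def scaledSym (s : Coord → ℝ) (V W : Coord → Coord) (q : Coord) : Ten2 := s q • symProd V W q

theorem hasGradTen_scaledSym {s : Coord → ℝ} {s' : Coord} {V W : Coord → Coord}
    {V' W' : Fin 3 → Fin 3 → ℝ} {y : Coord} (hs : HasGrad s s' y)
    (hV : ∀ A, HasGrad (fun q => V q A) (fun C => V' C A) y)
    (hW : ∀ A, HasGrad (fun q => W q A) (fun C => W' C A) y) :
    HasGradTen (scaledSym s V W) (fun k i j => s' k * (V y i * W y j + W y i * V y j) +
      s y * (V' k i * W y j + V y i * W' k j + (W' k i * V y j + W y i * V' k j))) y :=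
  fun i j => hs.mul (((hV i).mul (hW j)).add ((hW i).mul (hV j)))

/-! ### Brackets and derivatives along the frame `ξ, η, ν` -/

theorem bracket_xi_eta (σ : ℝ) (y : Coord) (i : Fin 3) :
    ∑ k, (canonXi σ y k * dEta k i - canonEta y k * dXi y k i) = 0 := by
  fin_cases i <;> simp [Fin.sum_univ_three, canonXi, canonEta, dEta, dXi] <;> ring

theorem bracket_eta_xi (σ : ℝ) (y : Coord) (i : Fin 3) :
    ∑ k, (canonEta y k * dXi y k i - canonXi σ y k * dEta k i) = 0 := by
  have h := bracket_xi_eta σ y i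
  simp only [Fin.sum_univ_three] at *
  linear_combination -h

/-- The conformal flow of `ξ` preserves `ξ` and `η`, hence also the direction of `ν`. The factor
follows from `|ν|² = PQ`: of the growth rate `4 y⁰` of `PQ` along `ξ`, the metric contributes `2
y⁰`, which leaves `y⁰` for `ν` itself. -/
theorem bracket_xi_nu (σ : ℝ) (y : Coord) (i : Fin 3) :
    ∑ k, (canonXi σ y k * dNu σ y k i - canonNu σ y k * dXi y k i) = y 0 * canonNu σ y i := by
  fin_cases i <;> simp [Fin.sum_univ_three, canonXi_eq, canonNu, dNu, dXi, rhoSq] <;> ring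

theorem bracket_eta_nu (σ : ℝ) (y : Coord) (i : Fin 3) :
    ∑ k, (canonEta y k * dNu σ y k i - canonNu σ y k * dEta k i) = 0 := by
  fin_cases i <;> simp [Fin.sum_univ_three, canonEta, canonNu, dNu, dEta] <;> ring

theorem xi_xiSq (σ : ℝ) (y : Coord) :
    ∑ k, canonXi σ y k * gradXiSq σ y k = 2 * y 0 * xiSq σ y := by
  simp [Fin.sum_univ_three, canonXi_eq, gradXiSq, xiSq, rhoSq]; ring

theorem xi_rhoSq (σ : ℝ) (y : Coord) :
    ∑ k, canonXi σ y k * gradRho y k = 2 * y 0 * rhoSq y := by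
  simp [Fin.sum_univ_three, canonXi_eq, gradRho, rhoSq]; ring

theorem eta_xiSq (σ : ℝ) (y : Coord) : ∑ k, canonEta y k * gradXiSq σ y k = 0 := by
  simp [Fin.sum_univ_three, canonEta, gradXiSq]; ring

theorem eta_rhoSq (y : Coord) : ∑ k, canonEta y k * gradRho y k = 0 := by
  simp [Fin.sum_univ_three, canonEta, gradRho]; ring

theorem nu_xiSq (σ : ℝ) (y : Coord) :
    ∑ k, canonNu σ y k * gradXiSq σ y k = -2 * xiSq σ y * rhoSq y := by
  simp [Fin.sum_univ_three, canonNu, gradXiSq, xiSq, rhoSq]; ring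

theorem nu_rhoSq (σ : ℝ) (y : Coord) :
    ∑ k, canonNu σ y k * gradRho y k = 2 * axial σ y * rhoSq y := by
  simp [Fin.sum_univ_three, canonNu, gradRho, rhoSq]; ring

theorem gradXiSq_eq (σ : ℝ) (y : Coord) (j : Fin 3) :
    gradXiSq σ y j = 2 * y 0 * canonXi σ y j - 2 * canonNu σ y j := by
  fin_cases j <;> simp [canonXi_eq, canonNu, gradXiSq] <;> ring

theorem xi_deriv_xi (σ : ℝ) (y : Coord) (j : Fin 3) :
    ∑ k, canonXi σ y k * dXi y k j = y 0 * canonXi σ y j + canonNu σ y j := by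
  fin_cases j <;> simp [Fin.sum_univ_three, canonXi_eq, canonNu, dXi, rhoSq] <;> ring

theorem eta_deriv_eta (y : Coord) (j : Fin 3) :
    ∑ k, canonEta y k * dEta k j = -gradRho y j / 2 := by
  fin_cases j <;> simp [Fin.sum_univ_three, canonEta, dEta, gradRho] <;> ring

theorem xi_deriv_eta (σ : ℝ) (y : Coord) (j : Fin 3) :
    ∑ k, (canonXi σ y k * dEta k j + canonEta y k * dXi y k j) = 2 * y 0 * canonEta y j := by
  fin_cases j <;> simp [Fin.sum_univ_three, canonXi_eq, canonEta, dEta, dXi] <;> ring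

theorem xi_deriv_nu (σ : ℝ) (y : Coord) (j : Fin 3) :
    ∑ k, (canonNu σ y k * dXi y k j + canonXi σ y k * dNu σ y k j) =
      3 * y 0 * canonNu σ y j - 2 * rhoSq y * canonXi σ y j := by
  fin_cases j <;> simp [Fin.sum_univ_three, canonXi_eq, canonNu, dNu, dXi, rhoSq] <;> ring

theorem eta_deriv_nu (σ : ℝ) (y : Coord) (j : Fin 3) :
    ∑ k, (canonNu σ y k * dEta k j + canonEta y k * dNu σ y k j) =
      2 * axial σ y * canonEta y j := by
  fin_cases j <;> simp [Fin.sum_univ_three, canonEta, canonNu, dNu, dEta] <;> ring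

theorem div_xi (y : Coord) : ∑ k, dXi y k k = 3 * y 0 := by
  simp [Fin.sum_univ_three, dXi]; ring

theorem div_eta : ∑ k, dEta k k = 0 := by
  simp [Fin.sum_univ_three, dEta]

theorem div_nu (σ : ℝ) (y : Coord) : ∑ k, dNu σ y k k = 2 * axial σ y - 2 * rhoSq y := by
  simp [Fin.sum_univ_three, dNu, rhoSq]; ring

theorem sum_xi_xi (σ : ℝ) (y : Coord) : ∑ k, canonXi σ y k * canonXi σ y k = xiSq σ y := by
  simp [Fin.sum_univ_three, canonXi_eq, xiSq, rhoSq]; ring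

theorem sum_eta_eta (y : Coord) : ∑ k, canonEta y k * canonEta y k = rhoSq y := by
  simp [Fin.sum_univ_three, canonEta, rhoSq]; ring

theorem sum_nu_nu (σ : ℝ) (y : Coord) :
    ∑ k, canonNu σ y k * canonNu σ y k = xiSq σ y * rhoSq y := by
  simp [Fin.sum_univ_three, canonNu, xiSq, rhoSq]; ring

theorem sum_xi_eta (σ : ℝ) (y : Coord) : ∑ k, canonXi σ y k * canonEta y k = 0 := by
  simp [Fin.sum_univ_three, canonXi_eq, canonEta]; ring

theorem sum_nu_xi (σ : ℝ) (y : Coord) : ∑ k, canonNu σ y k * canonXi σ y k = 0 := by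
  simp [Fin.sum_univ_three, canonXi_eq, canonNu, rhoSq]; ring

theorem sum_nu_eta (σ : ℝ) (y : Coord) : ∑ k, canonNu σ y k * canonEta y k = 0 := by
  simp [Fin.sum_univ_three, canonNu, canonEta]; ring

/-- The orthogonal frame `ξ, η, ν` is complete. -/
theorem frame_complete (σ : ℝ) (y : Coord) (i j : Fin 3) :
    rhoSq y * (canonXi σ y i * canonXi σ y j) + xiSq σ y * (canonEta y i * canonEta y j) +
      canonNu σ y i * canonNu σ y j = if i = j then xiSq σ y * rhoSq y else 0 := by
  fin_cases i <;> fin_cases j <;> simp [canonXi_eq, canonEta, canonNu, xiSq, rhoSq] <;> ring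

/-! ### The flat solutions -/

/-- The value of the partial derivatives of `s (V ⊗ W + W ⊗ V)`. -/
def gradSym (s : ℝ) (s' V W : Coord) (V' W' : Fin 3 → Fin 3 → ℝ) : Fin 3 → Ten2 := fun k i j =>
  s' k * (V i * W j + W i * V j) +
    s * (V' k i * W j + V i * W' k j + (W' k i * V j + W i * V' k j))

/-- Leibniz rule for eigenvectors of the Lie derivative: the eigenvalues add. The KID equation for
`ξ` becomes `α + β + γ = -5 y⁰`, and `γ = 2 (r + t) y⁰` for the weight `P^r Q^t`, so it fixes `r +
t`. -/
theorem lie_gradSym {s α β γ : ℝ} {s' V W Z : Coord} {V' W' Z' : Fin 3 → Fin 3 → ℝ}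
    (hV : ∀ i, ∑ k, (Z k * V' k i - V k * Z' k i) = α * V i)
    (hW : ∀ i, ∑ k, (Z k * W' k i - W k * Z' k i) = β * W i)
    (hs : ∑ k, Z k * s' k = γ * s) (i j : Fin 3) :
    ∑ k, (Z k * gradSym s s' V W V' W' k i j - s * (V k * W j + W k * V j) * Z' k i
      - s * (V i * W k + W i * V k) * Z' k j) = (α + β + γ) * (s * (V i * W j + W i * V j)) := by
  have h1 := hV i
  have h2 := hV j
  have h3 := hW i
  have h4 := hW j
  simp only [Fin.sum_univ_three, gradSym] at *
  linear_combination s * W j * h1 + s * W i * h2 + s * V j * h3 + s * V i * h4 +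
    (V i * W j + W i * V j) * hs

theorem div_gradSym {s : ℝ} {s' V W : Coord} {V' W' : Fin 3 → Fin 3 → ℝ} (j : Fin 3) :
    ∑ k, gradSym s s' V W V' W' k k j = (∑ k, V k * s' k + s * ∑ k, V' k k) * W j +
      (∑ k, W k * s' k + s * ∑ k, W' k k) * V j +
      s * ∑ k, (V k * W' k j + W k * V' k j) := by
  simp only [Fin.sum_univ_three, gradSym]
  ring

theorem sum_mul_grad {P Q A B : ℝ} {P' Q' s' V : Coord}
    (hs : ∀ k, s' k = A * (P' k / P) + B * (Q' k / Q)) :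
    ∑ k, V k * s' k = A * ((∑ k, V k * P' k) / P) + B * ((∑ k, V k * Q' k) / Q) := by
  simp only [Fin.sum_univ_three, hs]
  ring

section
variable {σ : ℝ} {y : Coord} {s A B : ℝ} {s' : Coord}

/-- The KID equation for `ξ` requires the exponents to sum to `-3`. The `ξ`-component of the
divergence involves `ν(s)`, which sees `P` and `Q` separately, and forces `-2` and `-1`; no function
of `X` is free here. -/
theorem flatSolAt_nu_xi (hP : xiSq σ y ≠ 0) (hQ : rhoSq y ≠ 0)
    (hs : ∀ k, s' k = -2 * s * (gradXiSq σ y k / xiSq σ y) + -1 * s * (gradRho y k / rhoSq y)) :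
    FlatSolAt σ y (s • symProd (canonNu σ) (canonXi σ) y)
      (gradSym s s' (canonNu σ y) (canonXi σ y) (dNu σ y) (dXi y)) where
  symm i j := by simp only [Pi.smul_apply, symProd, smul_eq_mul]; ring
  trace := by
    simp only [Pi.smul_apply, symProd, smul_eq_mul, ← Finset.mul_sum, Finset.sum_add_distrib,
      sum_nu_xi, mul_comm (canonXi σ y _)]
    simp
  div j := by
    rw [div_gradSym, sum_mul_grad hs, sum_mul_grad hs, xi_xiSq, xi_rhoSq, nu_xiSq, nu_rhoSq,
      div_xi, div_nu, xi_deriv_nu]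
    field_simp
    ring
  kidXi i j := by
    have h := lie_gradSym (s := s) (s' := s') (bracket_xi_nu σ y) (W := canonXi σ y)
      (W' := dXi y) (β := 0) (γ := -6 * y 0) (by simp)
      (by rw [sum_mul_grad hs, xi_xiSq, xi_rhoSq]; field_simp; ring) i j
    simp only [Pi.smul_apply, symProd, smul_eq_mul]
    rw [h]; ring
  kidEta i j := by
    have h := lie_gradSym (s := s) (s' := s') (V := canonNu σ y) (V' := dNu σ y) (α := 0)
      (by simpa using bracket_eta_nu σ y) (W := canonXi σ y)
      (W' := dXi y) (β := 0) (γ := 0) (Z := canonEta y) (Z' := dEta)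
      (by simpa using bracket_eta_xi σ y)
      (by rw [sum_mul_grad hs, eta_xiSq, eta_rhoSq]; simp) i j
    simp only [Pi.smul_apply, symProd, smul_eq_mul]
    rw [h]; ring

theorem flatSolAt_nu_eta (hP : xiSq σ y ≠ 0) (hQ : rhoSq y ≠ 0)
    (hs : ∀ k, s' k = -1 * s * (gradXiSq σ y k / xiSq σ y) + -2 * s * (gradRho y k / rhoSq y)) :
    FlatSolAt σ y (s • symProd (canonNu σ) canonEta y)
      (gradSym s s' (canonNu σ y) (canonEta y) (dNu σ y) dEta) where
  symm i j := by simp only [Pi.smul_apply, symProd, smul_eq_mul]; ring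
  trace := by
    simp only [Pi.smul_apply, symProd, smul_eq_mul, ← Finset.mul_sum, Finset.sum_add_distrib,
      sum_nu_eta, mul_comm (canonEta y _)]
    simp
  div j := by
    rw [div_gradSym, sum_mul_grad hs, sum_mul_grad hs, eta_xiSq, eta_rhoSq, nu_xiSq, nu_rhoSq,
      div_eta, div_nu, eta_deriv_nu]
    field_simp
    ring
  kidXi i j := by
    have h := lie_gradSym (s := s) (s' := s') (bracket_xi_nu σ y) (W := canonEta y)
      (W' := dEta) (β := 0) (γ := -6 * y 0) (by simpa using bracket_xi_eta σ y)
      (by rw [sum_mul_grad hs, xi_xiSq, xi_rhoSq]; field_simp; ring) i j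
    simp only [Pi.smul_apply, symProd, smul_eq_mul]
    rw [h]; ring
  kidEta i j := by
    have h := lie_gradSym (s := s) (s' := s') (V := canonNu σ y) (V' := dNu σ y) (α := 0)
      (by simpa using bracket_eta_nu σ y) (W := canonEta y)
      (W' := dEta) (β := 0) (γ := 0) (Z := canonEta y) (Z' := dEta) (by simp)
      (by rw [sum_mul_grad hs, eta_xiSq, eta_rhoSq]; simp) i j
    simp only [Pi.smul_apply, symProd, smul_eq_mul]
    rw [h]; ring

/-- The divergence differentiates `s` only along `ξ` and `η`, which annihilate `X`; hence the
derivative `w` of the profile is arbitrary. Only the sum `-5/2` of the exponents matters, and the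
equal split is a normalisation because `P/Q = X²`. -/
theorem flatSolAt_xi_eta (hP : xiSq σ y ≠ 0) (hQ : rhoSq y ≠ 0) (w : ℝ)
    (hs : ∀ k, s' k = (w / 2 + -(5 / 4) * s) * (gradXiSq σ y k / xiSq σ y) +
      (-w / 2 + -(5 / 4) * s) * (gradRho y k / rhoSq y)) :
    FlatSolAt σ y (s • symProd (canonXi σ) canonEta y)
      (gradSym s s' (canonXi σ y) (canonEta y) (dXi y) dEta) where
  symm i j := by simp only [Pi.smul_apply, symProd, smul_eq_mul]; ring
  trace := by
    simp only [Pi.smul_apply, symProd, smul_eq_mul, ← Finset.mul_sum, Finset.sum_add_distrib,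
      sum_xi_eta, mul_comm (canonEta y _)]
    simp
  div j := by
    rw [div_gradSym, sum_mul_grad hs, sum_mul_grad hs, eta_xiSq, eta_rhoSq, xi_xiSq, xi_rhoSq,
      div_eta, div_xi, xi_deriv_eta]
    field_simp
    ring
  kidXi i j := by
    have h := lie_gradSym (s := s) (s' := s') (V := canonXi σ y) (V' := dXi y) (α := 0)
      (W := canonEta y) (Z := canonXi σ y) (Z' := dXi y)
      (W' := dEta) (β := 0) (γ := -5 * y 0) (by simp) (by simpa using bracket_xi_eta σ y)
      (by rw [sum_mul_grad hs, xi_xiSq, xi_rhoSq]; field_simp; ring) i j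
    simp only [Pi.smul_apply, symProd, smul_eq_mul]
    rw [h]; ring
  kidEta i j := by
    have h := lie_gradSym (s := s) (s' := s') (V := canonXi σ y) (V' := dXi y) (α := 0)
      (by simpa using bracket_eta_xi σ y) (W := canonEta y)
      (W' := dEta) (β := 0) (γ := 0) (Z := canonEta y) (Z' := dEta) (by simp)
      (by rw [sum_mul_grad hs, eta_xiSq, eta_rhoSq]; simp) i j
    simp only [Pi.smul_apply, symProd, smul_eq_mul]
    rw [h]; ring

/-- The identity tensor. -/
def idTen : Ten2 := fun i j => if i = j then 1 else 0

/-- Two relations couple the three diagonal coefficients: their difference is the vanishing trace,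
and together they say `ds₃ = s₁ dP + s₂ dQ`, which is what the divergence requires. The first two
derivatives `w₁, w₂` drop out. -/
theorem flatSolAt_diagonal (hP : xiSq σ y ≠ 0) (hQ : rhoSq y ≠ 0) {s₁ s₂ s₃ w₁ w₂ w₃ : ℝ}
    {s₁' s₂' s₃' : Coord}
    (h₁ : ∀ k, s₁' k = (w₁ / 2 + -(7 / 4) * s₁) * (gradXiSq σ y k / xiSq σ y) +
      (-w₁ / 2 + -(3 / 4) * s₁) * (gradRho y k / rhoSq y))
    (h₂ : ∀ k, s₂' k = (w₂ / 2 + -(3 / 4) * s₂) * (gradXiSq σ y k / xiSq σ y) +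
      (-w₂ / 2 + -(7 / 4) * s₂) * (gradRho y k / rhoSq y))
    (h₃ : ∀ k, s₃' k = (w₃ / 2 + -(3 / 4) * s₃) * (gradXiSq σ y k / xiSq σ y) +
      (-w₃ / 2 + -(3 / 4) * s₃) * (gradRho y k / rhoSq y))
    (r₁ : 2 * s₁ * xiSq σ y = w₃ - 3 / 2 * s₃) (r₂ : -2 * s₂ * rhoSq y = w₃ + 3 / 2 * s₃) :
    FlatSolAt σ y (s₁ • symProd (canonXi σ) (canonXi σ) y + s₂ • symProd canonEta canonEta y +
        s₃ • idTen)
      (gradSym s₁ s₁' (canonXi σ y) (canonXi σ y) (dXi y) (dXi y) +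
        gradSym s₂ s₂' (canonEta y) (canonEta y) dEta dEta + fun k => s₃' k • idTen) where
  symm i j := by
    simp only [Pi.smul_apply, Pi.add_apply, symProd, smul_eq_mul, idTen, eq_comm (a := i)]; ring
  trace := by
    simp only [Pi.smul_apply, Pi.add_apply, symProd, smul_eq_mul, Finset.sum_add_distrib, idTen,
      ← Finset.mul_sum, sum_xi_xi, sum_eta_eta]
    simp
    linarith
  div j := by
    -- This gradient cancels the acceleration terms: `2 ∇_ξ ξ = 2 y⁰ ξ + 2 ν` against `dP = 2 y⁰ ξ -
    -- 2 ν`, and `2 ∇_η η = -dQ` against `dQ`. What is left is proportional to `ξ` and vanishes by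
    -- the choice of weights.
    have e₃ : s₃' j = s₁ * gradXiSq σ y j + s₂ * gradRho y j := by
      rw [h₃, show w₃ / 2 + -(3 / 4) * s₃ = s₁ * xiSq σ y by linarith,
        show -w₃ / 2 + -(3 / 4) * s₃ = s₂ * rhoSq y by linarith]
      field_simp
    simp only [Pi.add_apply, Finset.sum_add_distrib]
    rw [div_gradSym, div_gradSym, sum_mul_grad h₁, sum_mul_grad h₂, eta_xiSq, eta_rhoSq, xi_xiSq,
      xi_rhoSq, div_eta, div_xi]
    simp only [Finset.sum_add_distrib, xi_deriv_xi, eta_deriv_eta]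
    simp [idTen, e₃, gradXiSq_eq]
    field_simp
    ring
  kidXi i j := by
    have k₁ := lie_gradSym (s := s₁) (s' := s₁') (V := canonXi σ y) (V' := dXi y) (α := 0)
      (W := canonXi σ y) (Z := canonXi σ y) (Z' := dXi y)
      (W' := dXi y) (β := 0) (γ := -5 * y 0) (by simp) (by simp)
      (by rw [sum_mul_grad h₁, xi_xiSq, xi_rhoSq]; field_simp; ring) i j
    have k₂ := lie_gradSym (s := s₂) (s' := s₂') (V := canonEta y) (V' := dEta) (α := 0)
      (W := canonEta y) (Z := canonXi σ y) (Z' := dXi y)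
      (W' := dEta) (β := 0) (γ := -5 * y 0) (by simpa using bracket_xi_eta σ y)
      (by simpa using bracket_xi_eta σ y)
      (by rw [sum_mul_grad h₂, xi_xiSq, xi_rhoSq]; field_simp; ring) i j
    have k₃ : ∑ k, canonXi σ y k * s₃' k = -3 * y 0 * s₃ := by
      rw [sum_mul_grad h₃, xi_xiSq, xi_rhoSq]; field_simp; ring
    have k₄ : ∑ k, (idTen k j * dXi y k i + idTen i k * dXi y k j) = 2 * y 0 * idTen i j := by
      fin_cases i <;> fin_cases j <;> simp [idTen, dXi, Fin.sum_univ_three] <;> ring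
    simp only [Pi.smul_apply, Pi.add_apply, symProd, smul_eq_mul, Fin.sum_univ_three] at *
    linear_combination k₁ + k₂ + idTen i j * k₃ - s₃ * k₄
  kidEta i j := by
    have k₁ := lie_gradSym (s := s₁) (s' := s₁') (V := canonXi σ y) (V' := dXi y) (α := 0)
      (W := canonXi σ y) (Z := canonEta y) (Z' := dEta)
      (W' := dXi y) (β := 0) (γ := 0) (by simpa using bracket_eta_xi σ y)
      (by simpa using bracket_eta_xi σ y)
      (by rw [sum_mul_grad h₁, eta_xiSq, eta_rhoSq]; simp) i j
    have k₂ := lie_gradSym (s := s₂) (s' := s₂') (V := canonEta y) (V' := dEta) (α := 0)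
      (W := canonEta y) (Z := canonEta y) (Z' := dEta)
      (W' := dEta) (β := 0) (γ := 0) (by simp) (by simp)
      (by rw [sum_mul_grad h₂, eta_xiSq, eta_rhoSq]; simp) i j
    have k₃ : ∑ k, canonEta y k * s₃' k = 0 := by
      rw [sum_mul_grad h₃, eta_xiSq, eta_rhoSq]; simp
    have k₄ : ∑ k, (idTen k j * dEta k i + idTen i k * dEta k j) = 0 := by
      fin_cases i <;> fin_cases j <;> simp [idTen, dEta, Fin.sum_univ_three]
    simp only [Pi.smul_apply, Pi.add_apply, symProd, smul_eq_mul, Fin.sum_univ_three] at *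
    linear_combination k₁ + k₂ + idTen i j * k₃ - s₃ * k₄

end

/-! ### Contractions of solutions with the frame -/

/-- The contraction `e_ij V_i W_j`. -/
def contract (e : Ten2) (V W : Coord) : ℝ := ∑ i, ∑ j, e i j * V i * W j

/-- The partial derivatives of a contraction `e_ij V_i W_j`. -/
def gradContract (e : Ten2) (d : Fin 3 → Ten2) (V W : Coord) (V' W' : Fin 3 → Fin 3 → ℝ) : Coord :=
  fun k => ∑ i, ∑ j, (d k i j * V i * W j + e i j * V' k i * W j + e i j * V i * W' k j)

theorem hasGrad_contract {E : Coord → Ten2} {d : Fin 3 → Ten2} {V W : Coord → Coord}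
    {V' W' : Fin 3 → Fin 3 → ℝ} {y : Coord} (hE : HasGradTen E d y)
    (hV : ∀ A, HasGrad (fun q => V q A) (fun C => V' C A) y)
    (hW : ∀ A, HasGrad (fun q => W q A) (fun C => W' C A) y) :
    HasGrad (fun q => contract (E q) (V q) (W q)) (gradContract (E y) d (V y) (W y) V' W') y := by
  unfold contract
  refine (HasGrad.sum _ fun i _ => HasGrad.sum _ fun j _ =>
    ((hE i j).mul (hV i)).mul (hW j)).congr fun k => ?_
  unfold gradContract
  refine Finset.sum_congr rfl fun i _ => Finset.sum_congr rfl fun j _ => ?_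
  ring

/-- Here `V` and `W` are used as covectors, so the hypotheses on them are about Lie derivatives of
1-forms; the second-index derivative `Z' i k` reflects this. -/
theorem lie_contract {e : Ten2} {d : Fin 3 → Ten2} {α β γ : ℝ} {V W Z : Coord}
    {V' W' Z' : Fin 3 → Fin 3 → ℝ}
    (he : ∀ i j, ∑ k, (Z k * d k i j - e k j * Z' k i - e i k * Z' k j) = γ * e i j)
    (hV : ∀ i, ∑ k, (Z k * V' k i + V k * Z' i k) = α * V i)
    (hW : ∀ i, ∑ k, (Z k * W' k i + W k * Z' i k) = β * W i) :
    ∑ k, Z k * gradContract e d V W V' W' k = (α + β + γ) * contract e V W := by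
  have h : ∑ k, Z k * gradContract e d V W V' W' k =
      ∑ i, ∑ j, ((∑ k, (Z k * d k i j - e k j * Z' k i - e i k * Z' k j)) * V i * W j +
        e i j * (∑ k, (Z k * V' k i + V k * Z' i k)) * W j +
        e i j * V i * ∑ k, (Z k * W' k j + W k * Z' j k)) := by
    simp only [Fin.sum_univ_three, gradContract]
    ring
  rw [h]
  simp only [he, hV, hW, contract, Finset.mul_sum]
  refine Finset.sum_congr rfl fun i _ => Finset.sum_congr rfl fun j _ => ?_
  ring

/-- Lowering an index costs `2 y⁰`, because the Lie derivative of the Euclidean metric along `ξ` is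
`2 y⁰` times the metric. -/
theorem cobracket_xi {σ : ℝ} {y V : Coord} {V' : Fin 3 → Fin 3 → ℝ} {α : ℝ}
    (h : ∀ i, ∑ k, (canonXi σ y k * V' k i - V k * dXi y k i) = α * V i) (i : Fin 3) :
    ∑ k, (canonXi σ y k * V' k i + V k * dXi y i k) = (α + 2 * y 0) * V i := by
  have h1 := h i
  have h2 : ∑ k, V k * (dXi y k i + dXi y i k) = 2 * y 0 * V i := by
    fin_cases i <;> simp [Fin.sum_univ_three, dXi] <;> ring
  simp only [Fin.sum_univ_three] at *
  linear_combination h1 + h2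

theorem cobracket_eta {y V : Coord} {V' : Fin 3 → Fin 3 → ℝ}
    (h : ∀ i, ∑ k, (canonEta y k * V' k i - V k * dEta k i) = 0) (i : Fin 3) :
    ∑ k, (canonEta y k * V' k i + V k * dEta i k) = 0 * V i := by
  have h1 := h i
  have h2 : ∑ k, V k * (dEta k i + dEta i k) = 0 := by
    fin_cases i <;> simp [Fin.sum_univ_three, dEta]
  simp only [Fin.sum_univ_three] at *
  linear_combination h1 + h2

section
variable {σ : ℝ} {y : Coord} {e : Ten2} {d : Fin 3 → Ten2} (h : FlatSolAt σ y e d)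
include h

theorem FlatSolAt.xi_contract {V W : Coord} {V' W' : Fin 3 → Fin 3 → ℝ} {α β : ℝ}
    (hV : ∀ i, ∑ k, (canonXi σ y k * V' k i - V k * dXi y k i) = α * V i)
    (hW : ∀ i, ∑ k, (canonXi σ y k * W' k i - W k * dXi y k i) = β * W i) :
    ∑ k, canonXi σ y k * gradContract e d V W V' W' k = (α + β - y 0) * contract e V W := by
  rw [lie_contract (γ := -5 * y 0) (fun i j => by linear_combination h.kidXi i j)
    (cobracket_xi hV) (cobracket_xi hW)]
  ring

theorem FlatSolAt.eta_contract {V W : Coord} {V' W' : Fin 3 → Fin 3 → ℝ}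
    (hV : ∀ i, ∑ k, (canonEta y k * V' k i - V k * dEta k i) = 0)
    (hW : ∀ i, ∑ k, (canonEta y k * W' k i - W k * dEta k i) = 0) :
    ∑ k, canonEta y k * gradContract e d V W V' W' k = 0 := by
  rw [lie_contract (γ := 0) (fun i j => by linear_combination h.kidEta i j)
    (cobracket_eta hV) (cobracket_eta hW)]
  ring

/-- Completeness of the frame turns `PQ` times the divergence, paired with `ξ`, into `Q (∇_ξ E)(ξ,
ξ) + P (∇_η E)(η, ξ) + (∇_ν E)(ν, ξ)`. The KID equations remove the first two derivatives and the
lower-order terms collect into a multiple of the trace. -/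
theorem FlatSolAt.nu_contract_nu_xi : ∑ k, canonNu σ y k *
    gradContract e d (canonNu σ y) (canonXi σ y) (dNu σ y) (dXi y) k = 0 := by
  have hd := h.div
  have hx := h.kidXi
  have he := h.kidEta
  have ht := h.trace
  have s10 := h.symm 1 0
  have s20 := h.symm 2 0
  have s21 := h.symm 2 1
  have key : ∑ k, canonNu σ y k *
      gradContract e d (canonNu σ y) (canonXi σ y) (dNu σ y) (dXi y) k =
      xiSq σ y * rhoSq y * (∑ j, canonXi σ y j * ∑ i, d i i j + y 0 * ∑ i, e i i) -
      rhoSq y * ∑ i, ∑ j, canonXi σ y i * canonXi σ y j * (∑ k, (canonXi σ y k * d k i j -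
        e k j * dXi y k i - e i k * dXi y k j) + 5 * y 0 * e i j) -
      xiSq σ y * ∑ i, ∑ j, canonEta y i * canonXi σ y j * ∑ k, (canonEta y k * d k i j -
        e k j * dEta k i - e i k * dEta k j) := by
    simp only [Fin.sum_univ_three, gradContract, s10, s20, s21]
    simp [canonXi_eq, canonNu, canonEta, dXi, dNu, dEta, xiSq, rhoSq]
    ring
  rw [key]
  simp only [hd, hx, he, ht, mul_zero, Finset.sum_const_zero, add_zero, sub_zero]

theorem FlatSolAt.nu_contract_nu_eta : ∑ k, canonNu σ y k *
    gradContract e d (canonNu σ y) (canonEta y) (dNu σ y) dEta k = 0 := by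
  have hd := h.div
  have hx := h.kidXi
  have he := h.kidEta
  have s10 := h.symm 1 0
  have s20 := h.symm 2 0
  have s21 := h.symm 2 1
  have key : ∑ k, canonNu σ y k *
      gradContract e d (canonNu σ y) (canonEta y) (dNu σ y) dEta k =
      xiSq σ y * rhoSq y * (∑ j, canonEta y j * ∑ i, d i i j) -
      rhoSq y * ∑ i, ∑ j, canonXi σ y i * canonEta y j * (∑ k, (canonXi σ y k * d k i j -
        e k j * dXi y k i - e i k * dXi y k j) + 5 * y 0 * e i j) -
      xiSq σ y * ∑ i, ∑ j, canonEta y i * canonEta y j * ∑ k, (canonEta y k * d k i j -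
        e k j * dEta k i - e i k * dEta k j) := by
    simp only [Fin.sum_univ_three, gradContract, s10, s20, s21]
    simp [canonXi_eq, canonNu, canonEta, dXi, dNu, dEta, xiSq, rhoSq]
    ring
  rw [key]
  simp only [hd, hx, he, mul_zero, Finset.sum_const_zero, sub_zero]

/-- The same expansion of the divergence, now paired with `ν`. The remainder does not vanish: after
elimination of `E(ξ, ξ)` by the trace it contains `E(η, η)`, and this is how `E(η, η)` is recovered
from `E(ν, ν)`. -/
theorem FlatSolAt.nu_contract_nu_nu : ∑ k, canonNu σ y k *
    gradContract e d (canonNu σ y) (canonNu σ y) (dNu σ y) (dNu σ y) k =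
      axial σ y * contract e (canonNu σ y) (canonNu σ y) +
        (rhoSq y + axial σ y) * xiSq σ y * contract e (canonEta y) (canonEta y) := by
  have hd := h.div
  have hx := h.kidXi
  have he := h.kidEta
  have ht := h.trace
  have s10 := h.symm 1 0
  have s20 := h.symm 2 0
  have s21 := h.symm 2 1
  have key : ∑ k, canonNu σ y k *
      gradContract e d (canonNu σ y) (canonNu σ y) (dNu σ y) (dNu σ y) k =
      xiSq σ y * rhoSq y * (∑ j, canonNu σ y j * ∑ i, d i i j - rhoSq y * ∑ i, e i i) -
      rhoSq y * ∑ i, ∑ j, canonXi σ y i * canonNu σ y j * (∑ k, (canonXi σ y k * d k i j -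
        e k j * dXi y k i - e i k * dXi y k j) + 5 * y 0 * e i j) -
      xiSq σ y * ∑ i, ∑ j, canonEta y i * canonNu σ y j * ∑ k, (canonEta y k * d k i j -
        e k j * dEta k i - e i k * dEta k j) +
      (axial σ y * contract e (canonNu σ y) (canonNu σ y) +
        (rhoSq y + axial σ y) * xiSq σ y * contract e (canonEta y) (canonEta y)) := by
    simp only [Fin.sum_univ_three, gradContract, contract, s10, s20, s21]
    simp [canonXi_eq, canonNu, canonEta, dXi, dNu, dEta, xiSq, rhoSq]
    ring
  rw [key]
  simp only [hd, hx, he, ht, mul_zero, Finset.sum_const_zero, sub_zero, zero_add]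

end

/-- A symmetric trace-free tensor is determined by five contractions with the frame. -/
theorem expand_frame {σ : ℝ} {y : Coord} {e : Ten2} (hs : ∀ i j, e i j = e j i)
    (ht : ∑ i, e i i = 0) (hP : xiSq σ y ≠ 0) (hQ : rhoSq y ≠ 0) :
    e = (-(contract e (canonEta y) (canonEta y) / (xiSq σ y * rhoSq y) +
          2 * contract e (canonNu σ y) (canonNu σ y) / (xiSq σ y ^ 2 * rhoSq y)) / 2) •
        symProd (canonXi σ) (canonXi σ) y +
      ((contract e (canonEta y) (canonEta y) / rhoSq y ^ 2 -
          contract e (canonNu σ y) (canonNu σ y) / (xiSq σ y * rhoSq y ^ 2)) / 2) •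
        symProd canonEta canonEta y +
      (contract e (canonNu σ y) (canonNu σ y) / (xiSq σ y * rhoSq y)) • idTen +
      (contract e (canonXi σ y) (canonEta y) / (xiSq σ y * rhoSq y)) •
        symProd (canonXi σ) canonEta y +
      (contract e (canonNu σ y) (canonXi σ y) / (xiSq σ y ^ 2 * rhoSq y)) •
        symProd (canonNu σ) (canonXi σ) y +
      (contract e (canonNu σ y) (canonEta y) / (xiSq σ y * rhoSq y ^ 2)) •
        symProd (canonNu σ) canonEta y := by
  have hc := frame_complete σ y
  -- The vanishing trace written in the frame; it serves to eliminate `E(ξ, ξ)`.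
  have hS : rhoSq y * contract e (canonXi σ y) (canonXi σ y) +
      xiSq σ y * contract e (canonEta y) (canonEta y) +
      contract e (canonNu σ y) (canonNu σ y) = 0 := by
    have : rhoSq y * contract e (canonXi σ y) (canonXi σ y) +
        xiSq σ y * contract e (canonEta y) (canonEta y) +
        contract e (canonNu σ y) (canonNu σ y) = ∑ i, ∑ j, e i j *
        (rhoSq y * (canonXi σ y i * canonXi σ y j) +
          xiSq σ y * (canonEta y i * canonEta y j) + canonNu σ y i * canonNu σ y j) := by
      simp only [contract, Fin.sum_univ_three]; ring
    rw [this]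
    simp only [hc, mul_ite, mul_zero, Finset.sum_ite_eq, Finset.mem_univ, if_true,
      ← Finset.sum_mul, ht, zero_mul]
  have sym : ∀ V W : Coord, contract e V W = contract e W V := fun V W => by
    unfold contract
    rw [Finset.sum_comm]
    refine Finset.sum_congr rfl fun i _ => Finset.sum_congr rfl fun j _ => ?_
    rw [hs]; ring
  have hE : ∀ i j, (xiSq σ y * rhoSq y) ^ 2 * e i j =
      rhoSq y ^ 2 * contract e (canonXi σ y) (canonXi σ y) * (canonXi σ y i * canonXi σ y j) +
      xiSq σ y ^ 2 * contract e (canonEta y) (canonEta y) * (canonEta y i * canonEta y j) +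
      contract e (canonNu σ y) (canonNu σ y) * (canonNu σ y i * canonNu σ y j) +
      xiSq σ y * rhoSq y * contract e (canonXi σ y) (canonEta y) *
        (canonXi σ y i * canonEta y j + canonEta y i * canonXi σ y j) +
      rhoSq y * contract e (canonNu σ y) (canonXi σ y) *
        (canonNu σ y i * canonXi σ y j + canonXi σ y i * canonNu σ y j) +
      xiSq σ y * contract e (canonNu σ y) (canonEta y) *
        (canonNu σ y i * canonEta y j + canonEta y i * canonNu σ y j) := by
    intro i j
    have : ∑ k, ∑ l, (rhoSq y * (canonXi σ y i * canonXi σ y k) +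
          xiSq σ y * (canonEta y i * canonEta y k) + canonNu σ y i * canonNu σ y k) *
        (rhoSq y * (canonXi σ y j * canonXi σ y l) +
          xiSq σ y * (canonEta y j * canonEta y l) + canonNu σ y j * canonNu σ y l) * e k l =
        (xiSq σ y * rhoSq y) ^ 2 * e i j := by
      simp only [hc, ite_mul, zero_mul, mul_ite, mul_zero, Finset.sum_ite_eq, Finset.mem_univ,
        if_true]
      ring
    rw [← this]
    have s1 := sym (canonEta y) (canonXi σ y)
    have s2 := sym (canonXi σ y) (canonNu σ y)
    have s3 := sym (canonEta y) (canonNu σ y)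
    simp only [contract, Fin.sum_univ_three] at s1 s2 s3 ⊢
    linear_combination xiSq σ y * rhoSq y * canonEta y i * canonXi σ y j * s1 +
      rhoSq y * canonXi σ y i * canonNu σ y j * s2 + xiSq σ y * canonEta y i * canonNu σ y j * s3
  funext i j
  have h1 := hE i j
  -- Trading `ν ⊗ ν` for the identity brings the diagonal part into the form used in `flatComb`.
  have h2 : canonNu σ y i * canonNu σ y j = xiSq σ y * rhoSq y * idTen i j -
      rhoSq y * (canonXi σ y i * canonXi σ y j) - xiSq σ y * (canonEta y i * canonEta y j) := by
    have := hc i j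
    simp only [idTen, mul_ite, mul_one, mul_zero]
    linarith
  have h3 : rhoSq y * contract e (canonXi σ y) (canonXi σ y) =
      -(xiSq σ y * contract e (canonEta y) (canonEta y) +
        contract e (canonNu σ y) (canonNu σ y)) := by linarith
  rw [h2] at h1
  have h4 : rhoSq y ^ 2 * contract e (canonXi σ y) (canonXi σ y) =
      -(xiSq σ y * contract e (canonEta y) (canonEta y) +
        contract e (canonNu σ y) (canonNu σ y)) * rhoSq y := by rw [← h3]; ring
  rw [h4] at h1
  have hPQ : (xiSq σ y * rhoSq y) ^ 2 ≠ 0 := by positivity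
  refine mul_left_cancel₀ hPQ (h1.trans ?_)
  simp only [Pi.add_apply, Pi.smul_apply, smul_eq_mul, symProd]
  field_simp
  ring

/-- The general solution in the flat model. -/
def flatComb (σ : ℝ) (f h : ℝ → ℝ) (c₁ c₂ : ℝ) (y : Coord) : Ten2 :=
  weighted σ (fun x => (x * deriv f x - 3 / 2 * f x) / 2) (-(7 / 4)) (-(3 / 4)) y •
      symProd (canonXi σ) (canonXi σ) y +
    weighted σ (fun x => -(x * deriv f x + 3 / 2 * f x) / 2) (-(3 / 4)) (-(7 / 4)) y •
      symProd canonEta canonEta y +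
    weighted σ f (-(3 / 4)) (-(3 / 4)) y • idTen +
    weighted σ h (-(5 / 4)) (-(5 / 4)) y • symProd (canonXi σ) canonEta y +
    weighted σ (fun _ => c₁) (-2) (-1) y • symProd (canonNu σ) (canonXi σ) y +
    weighted σ (fun _ => c₂) (-1) (-2) y • symProd (canonNu σ) canonEta y

theorem hasGradTen_idTen {s : Coord → ℝ} {s' y : Coord} (hs : HasGrad s s' y) :
    HasGradTen (fun q => s q • idTen) (fun k => s' k • idTen) y := fun i j =>
  (hs.mul (hasGrad_const (idTen i j) y)).congr fun k => by simp

theorem flatComb_hasGrad {σ : ℝ} {y : Coord} (hP : 0 < xiSq σ y) (hQ : 0 < rhoSq y)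
    {f h : ℝ → ℝ} (hf : DifferentiableAt ℝ f (flatX σ y))
    (hf' : DifferentiableAt ℝ (deriv f) (flatX σ y)) (hh : DifferentiableAt ℝ h (flatX σ y))
    (c₁ c₂ : ℝ) : ∃ d, HasGradTen (flatComb σ f h c₁ c₂) d y ∧
      FlatSolAt σ y (flatComb σ f h c₁ c₂ y) d := by
  obtain ⟨u₁, hu₁⟩ : ∃ u, HasDerivAt (fun x => (x * deriv f x - 3 / 2 * f x) / 2) u
      (flatX σ y) :=
    ⟨_, (DifferentiableAt.hasDerivAt (by fun_prop))⟩
  obtain ⟨u₂, hu₂⟩ : ∃ u, HasDerivAt (fun x => -(x * deriv f x + 3 / 2 * f x) / 2) u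
      (flatX σ y) :=
    ⟨_, (DifferentiableAt.hasDerivAt (by fun_prop))⟩
  have g₁ := hasGrad_weighted hP hQ hu₁ (-(7 / 4)) (-(3 / 4))
  have g₂ := hasGrad_weighted hP hQ hu₂ (-(3 / 4)) (-(7 / 4))
  have g₃ := hasGrad_weighted hP hQ hf.hasDerivAt (-(3 / 4)) (-(3 / 4))
  have g₄ := hasGrad_weighted hP hQ hh.hasDerivAt (-(5 / 4)) (-(5 / 4))
  have g₅ := hasGrad_weighted hP hQ (hasDerivAt_const (flatX σ y) c₁) (-2) (-1)
  have g₆ := hasGrad_weighted hP hQ (hasDerivAt_const (flatX σ y) c₂) (-1) (-2)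
  have hp : xiSq σ y ^ (-(7 / 4) : ℝ) * xiSq σ y = xiSq σ y ^ (-(3 / 4) : ℝ) := by
    rw [← Real.rpow_add_one hP.ne']; norm_num
  have hq : rhoSq y ^ (-(7 / 4) : ℝ) * rhoSq y = rhoSq y ^ (-(3 / 4) : ℝ) := by
    rw [← Real.rpow_add_one hQ.ne']; norm_num
  refine ⟨_, (((((hasGradTen_scaledSym g₁ (hasGrad_xi σ y) (hasGrad_xi σ y)).add
    (hasGradTen_scaledSym g₂ (hasGrad_eta y) (hasGrad_eta y))).add
    (hasGradTen_idTen g₃)).add (hasGradTen_scaledSym g₄ (hasGrad_xi σ y) (hasGrad_eta y))).add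
    (hasGradTen_scaledSym g₅ (hasGrad_nu σ y) (hasGrad_xi σ y))).add
    (hasGradTen_scaledSym g₆ (hasGrad_nu σ y) (hasGrad_eta y)), ?_⟩
  refine (((flatSolAt_diagonal hP.ne' hQ.ne' (fun k => rfl) (fun k => rfl)
    (fun k => rfl) ?_ ?_).add (flatSolAt_xi_eta hP.ne' hQ.ne' _ (fun k => rfl))).add
    (flatSolAt_nu_xi hP.ne' hQ.ne' (fun k => ?_))).add
    (flatSolAt_nu_eta hP.ne' hQ.ne' (fun k => ?_))
  · simp only [weighted]; rw [← hp]; ring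
  · simp only [weighted]; rw [← hq]; ring
  · simp
  · simp

/-! ### Regularity of the flat solutions -/

theorem contDiff_rhoSq : ContDiff ℝ ω rhoSq := by unfold rhoSq; fun_prop

theorem contDiff_xiSq (σ : ℝ) : ContDiff ℝ ω (xiSq σ) := by
  unfold xiSq axial rhoSq; fun_prop

theorem contDiff_canonXi (σ : ℝ) : ContDiff ℝ ω (canonXi σ) := by
  rw [contDiff_pi]
  intro i
  fin_cases i <;> simp [canonXi] <;> fun_prop

theorem contDiff_canonEta : ContDiff ℝ ω canonEta := by
  rw [contDiff_pi]
  intro i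
  fin_cases i <;> simp [canonEta] <;> fun_prop

theorem contDiff_canonNu (σ : ℝ) : ContDiff ℝ ω (canonNu σ) := by
  rw [contDiff_pi]
  intro i
  fin_cases i <;> simp [canonNu, rhoSq, axial] <;> fun_prop

theorem contDiffAt_flatX {n : WithTop ℕ∞} {σ : ℝ} {y : Coord} (hP : 0 < xiSq σ y)
    (hQ : 0 < rhoSq y) : ContDiffAt ℝ n (flatX σ) y := by
  have h1 := ((contDiff_xiSq σ).of_le (le_top (a := n))).contDiffAt (x := y)
  have h2 := (contDiff_rhoSq.of_le (le_top (a := n))).contDiffAt (x := y)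
  exact (h1.sqrt hP.ne').div (h2.sqrt hQ.ne') (Real.sqrt_pos.2 hQ).ne'

theorem contDiffAt_weighted {n : WithTop ℕ∞} {σ : ℝ} {y : Coord} (hP : 0 < xiSq σ y)
    (hQ : 0 < rhoSq y) {u : ℝ → ℝ} (hu : ContDiffAt ℝ n u (flatX σ y)) (r t : ℝ) :
    ContDiffAt ℝ n (weighted σ u r t) y := by
  have h1 := ((contDiff_xiSq σ).of_le (le_top (a := n))).contDiffAt (x := y)
  have h2 := (contDiff_rhoSq.of_le (le_top (a := n))).contDiffAt (x := y)
  exact ((hu.comp y (contDiffAt_flatX hP hQ)).mul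
    (h1.rpow_const_of_ne hP.ne')).mul (h2.rpow_const_of_ne hQ.ne')

theorem contDiff_symProd {n : WithTop ℕ∞} {V W : Coord → Coord} (hV : ContDiff ℝ n V)
    (hW : ContDiff ℝ n W) : ContDiff ℝ n (symProd V W) := by
  unfold symProd
  rw [contDiff_pi] at *
  exact fun i => contDiff_pi.2 fun j => ((hV i).mul (hW j)).add ((hW i).mul (hV j))

theorem contDiffAt_flatComb {n : WithTop ℕ∞} {σ : ℝ} {y : Coord} (hP : 0 < xiSq σ y)
    (hQ : 0 < rhoSq y) {f h : ℝ → ℝ} (hf : ContDiffAt ℝ (n + 1) f (flatX σ y))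
    (hh : ContDiffAt ℝ n h (flatX σ y)) (c₁ c₂ : ℝ) :
    ContDiffAt ℝ n (flatComb σ f h c₁ c₂) y := by
  have hf' : ContDiffAt ℝ n (deriv f) (flatX σ y) :=
    (hf.fderiv_right le_rfl).clm_apply contDiffAt_const
  have hf0 : ContDiffAt ℝ n f (flatX σ y) := hf.of_le le_self_add
  have hξ := (contDiff_canonXi σ).of_le (le_top (a := n))
  have hη := contDiff_canonEta.of_le (le_top (a := n))
  have hν := (contDiff_canonNu σ).of_le (le_top (a := n))
  have w : ∀ {u : ℝ → ℝ} (r t : ℝ) {V W : Coord → Coord}, ContDiffAt ℝ n u (flatX σ y) →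
      ContDiff ℝ n V → ContDiff ℝ n W →
      ContDiffAt ℝ n (fun q => weighted σ u r t q • symProd V W q) y := fun r t V W hu hV hW =>
    (contDiffAt_weighted hP hQ hu r t).smul (contDiff_symProd hV hW).contDiffAt
  have h1 : ContDiffAt ℝ n (fun x => (x * deriv f x - 3 / 2 * f x) / 2) (flatX σ y) := by fun_prop
  have h2 : ContDiffAt ℝ n (fun x => -(x * deriv f x + 3 / 2 * f x) / 2) (flatX σ y) := by fun_prop
  exact (((((w _ _ h1 hξ hξ).add (w _ _ h2 hη hη)).add
    ((contDiffAt_weighted hP hQ hf0 _ _).smul contDiffAt_const)).add (w _ _ hh hξ hη)).add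
    (w _ _ contDiffAt_const hν hξ)).add (w _ _ contDiffAt_const hν hη)

/-! ### Functions that factor locally through a submersion -/

/-- A function with a nonzero derivative is a linear function in suitable coordinates: it has
local sections, and functions whose differentials are proportional to its differential factor
through it. -/
theorem exists_local_section {n : WithTop ℕ∞} (hn : 1 ≤ n) {X : Coord → ℝ} {y v : Coord}
    (hX : ContDiffAt ℝ n X y) (hv : fderiv ℝ X y v ≠ 0) :
    ∃ s : ℝ → Coord, ContDiffAt ℝ n s (X y) ∧ s (X y) = y ∧
      (∀ᶠ c in nhds (X y), X (s c) = c) ∧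
      ∀ F : Coord → ℝ, (∀ᶠ z in nhds y, DifferentiableAt ℝ F z ∧
        ∀ u, fderiv ℝ X z u = 0 → fderiv ℝ F z u = 0) → ∀ᶠ z in nhds y, F z = F (s (X z)) := by
  have hn0 : n ≠ 0 := fun h => by simp [h] at hn
  set L : Coord →L[ℝ] ℝ := fderiv ℝ X y with hL
  set w : Coord := (L v)⁻¹ • v with hw
  have hLw : L w = 1 := by simp [hw, hv]
  -- The correction along `w` makes `L ∘ Φ = X` while the derivative of `Φ` at `y` is the identity,
  -- so `Φ` straightens `X` to the linear function `L`.
  let Φ : Coord → Coord := fun z => z + (X z - L z) • w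
  have hXd : HasFDerivAt X L y := (hX.differentiableAt hn0).hasFDerivAt
  have hΦ : ContDiffAt ℝ n Φ y := by
    have : ContDiffAt ℝ n (fun z => L z) y := L.contDiff.contDiffAt
    exact contDiffAt_id.add ((hX.sub this).smul contDiffAt_const)
  have hΦ' : HasFDerivAt Φ ((ContinuousLinearEquiv.refl ℝ Coord : Coord ≃L[ℝ] Coord) :
      Coord →L[ℝ] Coord) y := by
    have h := (hasFDerivAt_id (𝕜 := ℝ) y).add ((hXd.sub L.hasFDerivAt).smul_const w)
    refine h.congr_fderiv ?_
    ext u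
    simp
  let e := hΦ.toOpenPartialHomeomorph Φ hΦ' hn0
  have he : ∀ z, e z = Φ z := fun z => rfl
  have hye : y ∈ e.source := hΦ.mem_toOpenPartialHomeomorph_source hΦ' hn0
  have hLΦ : ∀ z, L (Φ z) = X z := fun z => by
    simp only [Φ, map_add, map_smul, hLw, smul_eq_mul]; ring
  have hsymm : ∀ z ∈ e.target, X (e.symm z) = L z := fun z hz => by
    rw [← hLΦ, ← he, e.right_inv hz]
  have hcs : ContDiffAt ℝ n e.symm (Φ y) := by
    have := hΦ.to_localInverse hΦ' hn0
    exact this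
  have hΦy : e.symm (Φ y) = y := e.left_inv hye
  have hty : Φ y ∈ e.target := e.map_source hye
  let ℓ : ℝ → Coord := fun c => Φ y + (c - X y) • w
  have hℓ0 : ℓ (X y) = Φ y := by simp [ℓ]
  have hℓc : Continuous ℓ := by fun_prop
  have hLℓ : ∀ c, L (ℓ c) = c := fun c => by simp [ℓ, hLΦ, hLw]
  have hXc : ContinuousAt X y := hXd.continuousAt
  refine ⟨fun c => e.symm (ℓ c), ?_, ?_, ?_, ?_⟩
  · refine ContDiffAt.comp (X y) (by rw [hℓ0]; exact hcs) ?_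
    have : ContDiff ℝ n ℓ := by fun_prop
    exact this.contDiffAt
  · simp only [hℓ0, hΦy]
  · have : ∀ᶠ c in nhds (X y), ℓ c ∈ e.target :=
      hℓc.continuousAt.eventually_mem (by rw [hℓ0]; exact e.open_target.mem_nhds hty)
    filter_upwards [this] with c hc
    rw [hsymm _ hc, hLℓ]
  · intro F hF
    have hev : ∀ᶠ z in nhds (Φ y), z ∈ e.target ∧ DifferentiableAt ℝ e.symm z ∧
        DifferentiableAt ℝ X (e.symm z) ∧ DifferentiableAt ℝ F (e.symm z) ∧
          ∀ u, fderiv ℝ X (e.symm z) u = 0 → fderiv ℝ F (e.symm z) u = 0 := by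
      have h1 : ∀ᶠ z in nhds (Φ y), DifferentiableAt ℝ e.symm z := by
        have := (hcs.of_le hn).eventually (by simp)
        filter_upwards [this] with z hz
        exact hz.differentiableAt (by simp)
      have h2 : Filter.Tendsto e.symm (nhds (Φ y)) (nhds y) := by
        have := hcs.continuousAt.tendsto
        rwa [hΦy] at this
      have h3 : ∀ᶠ z in nhds y, DifferentiableAt ℝ X z := by
        have := (hX.of_le hn).eventually (by simp)
        filter_upwards [this] with z hz
        exact hz.differentiableAt (by simp)
      filter_upwards [e.open_target.mem_nhds hty, h1, h2.eventually h3, h2.eventually hF]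
        with z a b c d
      exact ⟨a, b, c, d⟩
    -- In a ball the fibres of `L` are convex: two points with equal `L` are joined by a segment on
    -- which `X ∘ Φ⁻¹ = L` is constant, hence so is `F ∘ Φ⁻¹`.
    obtain ⟨ε, hε, hball⟩ := Metric.eventually_nhds_iff_ball.1 hev
    have hconst : ∀ z ∈ Metric.ball (Φ y) ε, ∀ z' ∈ Metric.ball (Φ y) ε, L z = L z' →
        F (e.symm z) = F (e.symm z') := by
      intro z hz z' hz' hzz
      let γ : ℝ → Coord := fun t => z + t • (z' - z)
      have hγ : ∀ t ∈ Set.Icc (0 : ℝ) 1, γ t ∈ Metric.ball (Φ y) ε := fun t ht =>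
        (convex_ball (Φ y) ε).add_smul_sub_mem hz hz' ht
      have hderiv : ∀ t ∈ Set.Icc (0 : ℝ) 1, HasDerivAt (fun t => F (e.symm (γ t))) 0 t := by
        intro t ht
        obtain ⟨a, b, hXz, c, k⟩ := hball _ (hγ t ht)
        have hγ' : HasDerivAt γ (z' - z) t := by
          have h := ((hasDerivAt_id t).smul_const (z' - z)).const_add z
          rw [one_smul] at h
          exact h
        have h1 := b.hasFDerivAt.comp_hasDerivAt t hγ'
        have h2 := c.hasFDerivAt.comp_hasDerivAt t h1
        have h3 := hXz.hasFDerivAt.comp_hasDerivAt t h1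
        have h4 : HasDerivAt (fun t => X (e.symm (γ t))) 0 t := by
          have h5 : HasDerivAt (fun t => L (γ t)) 0 t := by
            have := L.hasFDerivAt.comp_hasDerivAt t hγ'
            rwa [map_sub, hzz, sub_self] at this
          refine h5.congr_of_eventuallyEq ?_
          have : ∀ᶠ r in nhds t, γ r ∈ e.target :=
            hγ'.continuousAt.eventually_mem (e.open_target.mem_nhds a)
          filter_upwards [this] with r hr
          exact hsymm _ hr
        have h6 := k _ (h3.unique h4)
        rw [h6] at h2
        exact h2
      have := constant_of_has_deriv_right_zero (f := fun t => F (e.symm (γ t))) (a := 0) (b := 1)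
        (fun t ht => (hderiv t ht).continuousAt.continuousWithinAt)
        (fun t ht => (hderiv t (Set.Ico_subset_Icc_self ht)).hasDerivWithinAt) 1 (by simp)
      simpa [γ] using this.symm
    have hb : Metric.ball (Φ y) ε ∈ nhds (Φ y) := Metric.ball_mem_nhds _ hε
    have k1 : ∀ᶠ z in nhds y, Φ z ∈ Metric.ball (Φ y) ε := hΦ'.continuousAt.eventually_mem hb
    have k2 : ∀ᶠ z in nhds y, ℓ (X z) ∈ Metric.ball (Φ y) ε := by
      have : ContinuousAt (fun z => ℓ (X z)) y := hℓc.continuousAt.comp hXc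
      exact this.eventually_mem (by rw [hℓ0]; exact hb)
    filter_upwards [k1, k2, e.open_source.mem_nhds hye] with z h1 h2 h3
    rw [← hconst _ h1 _ h2 (by rw [hLℓ, hLΦ]), ← he, e.left_inv h3]

/-! ### The differential of `X` and its critical points -/

theorem apply_eq_frame {σ : ℝ} {y : Coord} (L : Coord →L[ℝ] ℝ) (u : Coord) :
    xiSq σ y * rhoSq y * L u = rhoSq y * (∑ i, canonXi σ y i * u i) * L (canonXi σ y) +
      xiSq σ y * (∑ i, canonEta y i * u i) * L (canonEta y) +
      (∑ i, canonNu σ y i * u i) * L (canonNu σ y) := by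
  have h : (xiSq σ y * rhoSq y) • u = (rhoSq y * ∑ i, canonXi σ y i * u i) • canonXi σ y +
      (xiSq σ y * ∑ i, canonEta y i * u i) • canonEta y +
      (∑ i, canonNu σ y i * u i) • canonNu σ y := by
    funext j
    have : xiSq σ y * rhoSq y * u j = ∑ i, (rhoSq y * (canonXi σ y i * canonXi σ y j) +
        xiSq σ y * (canonEta y i * canonEta y j) + canonNu σ y i * canonNu σ y j) * u i := by
      simp only [frame_complete, ite_mul, zero_mul, Finset.sum_ite_eq', Finset.mem_univ, if_true]
    simp only [Pi.smul_apply, Pi.add_apply, smul_eq_mul]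
    rw [this]
    simp only [Fin.sum_univ_three]
    ring
  have := congrArg L h
  simpa using this

theorem eq_zero_of_frame {σ : ℝ} {y : Coord} (hP : xiSq σ y ≠ 0) (hQ : rhoSq y ≠ 0)
    {L : Coord →L[ℝ] ℝ} (h₁ : L (canonXi σ y) = 0) (h₂ : L (canonEta y) = 0)
    (h₃ : L (canonNu σ y) = 0) : L = 0 := by
  ext u
  have := apply_eq_frame (σ := σ) (y := y) L u
  rw [h₁, h₂, h₃] at this
  simpa [hP, hQ] using this

theorem fderiv_flatX_apply {σ : ℝ} {y : Coord} (hP : 0 < xiSq σ y) (hQ : 0 < rhoSq y)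
    (u : Coord) : fderiv ℝ (flatX σ) y u = flatX σ y / 2 *
      ((∑ k, u k * gradXiSq σ y k) / xiSq σ y - (∑ k, u k * gradRho y k) / rhoSq y) := by
  rw [(hasGrad_flatX hP hQ).fderiv_apply]
  simp only [Fin.sum_univ_three]
  ring

section
variable {σ : ℝ} {y : Coord} (hP : 0 < xiSq σ y) (hQ : 0 < rhoSq y)
include hP hQ

theorem fderiv_flatX_xi : fderiv ℝ (flatX σ) y (canonXi σ y) = 0 := by
  rw [fderiv_flatX_apply hP hQ, xi_xiSq, xi_rhoSq]; field_simp; ring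

theorem fderiv_flatX_eta : fderiv ℝ (flatX σ) y (canonEta y) = 0 := by
  rw [fderiv_flatX_apply hP hQ, eta_xiSq, eta_rhoSq]; simp

theorem fderiv_flatX_nu :
    fderiv ℝ (flatX σ) y (canonNu σ y) = -flatX σ y * (rhoSq y + axial σ y) := by
  rw [fderiv_flatX_apply hP hQ, nu_xiSq, nu_rhoSq]; field_simp; ring

/-- Away from critical points the kernel of `dX` is spanned by `ξ` and `η`, since `dX` annihilates
both and not `ν`. -/
theorem fderiv_eq_zero_of_flatX (hne : rhoSq y + axial σ y ≠ 0) {L : Coord →L[ℝ] ℝ}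
    (h₁ : L (canonXi σ y) = 0) (h₂ : L (canonEta y) = 0) (u : Coord)
    (hu : fderiv ℝ (flatX σ) y u = 0) : L u = 0 := by
  have hX := apply_eq_frame (σ := σ) (y := y) (fderiv ℝ (flatX σ) y) u
  have hL := apply_eq_frame (σ := σ) (y := y) L u
  rw [fderiv_flatX_xi hP hQ, fderiv_flatX_eta hP hQ, fderiv_flatX_nu hP hQ, hu] at hX
  have : ∑ i, canonNu σ y i * u i = 0 := by
    have := (flatX_pos hP hQ).ne'
    simpa [this, hne, eq_comm] using hX
  rw [h₁, h₂, this] at hL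
  simpa [hP.ne', hQ.ne'] using hL

/-- The derivative of `P^r Q^t c` along a direction. -/
theorem fderiv_weighted_mul {c : Coord → ℝ} {c' : Coord} (hc : HasGrad c c' y) (r t : ℝ)
    (u : Coord) : fderiv ℝ (fun q => weighted σ (fun _ => 1) r t q * c q) y u =
      weighted σ (fun _ => 1) r t y * (r * ((∑ k, u k * gradXiSq σ y k) / xiSq σ y) * c y +
        t * ((∑ k, u k * gradRho y k) / rhoSq y) * c y + ∑ k, u k * c' k) := by
  rw [((hasGrad_weighted hP hQ (hasDerivAt_const (flatX σ y) 1) r t).mul hc).fderiv_apply]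
  simp only [Fin.sum_univ_three]
  ring

end

/-- As `ν(X) = -X (Q + a)`, with `a` the axial component, this shows that `X² + σ` is nonnegative
and vanishes exactly at the critical points; moreover `Q + a = (|y|² + σ)/2`. -/
theorem flatX_sq {σ : ℝ} {y : Coord} (hP : 0 < xiSq σ y) (hQ : 0 < rhoSq y) :
    flatX σ y ^ 2 = (rhoSq y + axial σ y) ^ 2 / rhoSq y - σ := by
  rw [flatX, div_pow, Real.sq_sqrt hP.le, Real.sq_sqrt hQ.le, eq_sub_iff_add_eq,
    div_add' _ _ _ hQ.ne']
  congr 1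
  simp only [xiSq, rhoSq, axial]
  ring

/-- An open set on which the level sets of `flatX` are connected avoids the critical points. -/
theorem not_critical {σ : ℝ} {W : Set Coord} (hW : IsOpen W) (hP : ∀ y ∈ W, 0 < xiSq σ y)
    (hQ : ∀ y ∈ W, 0 < rhoSq y) (hc : ∀ c, IsPreconnected {y | y ∈ W ∧ flatX σ y = c})
    {y : Coord} (hy : y ∈ W) : rhoSq y + axial σ y ≠ 0 := by
  intro h0
  have hQy := hQ y hy
  set R := y 0 ^ 2 + rhoSq y with hR
  have hRpos : 0 < R := by positivity
  have hσ : σ = -R := by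
    simp only [axial, rhoSq] at *
    linarith
  have hm : ∀ l : ℝ, rhoSq (l • y) + axial σ (l • y) = R * (l ^ 2 - 1) / 2 := fun l => by
    simp only [rhoSq, axial, hσ, hR, Pi.smul_apply, smul_eq_mul]; ring
  have hrho : ∀ l : ℝ, rhoSq (l • y) = l ^ 2 * rhoSq y := fun l => by
    simp only [rhoSq, Pi.smul_apply, smul_eq_mul]; ring
  -- The points `l y` and `l⁻¹ y` are inverse to each other in the sphere of radius `√R` through
  -- `y`. They have the same `X`, and `Q + a` has opposite signs there.
  have ev : ∀ᶠ l : ℝ in nhds 1, l • y ∈ W ∧ l⁻¹ • y ∈ W ∧ 0 < l := by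
    have c1 : ContinuousAt (fun l : ℝ => l • y) 1 := by fun_prop
    have c2 : ContinuousAt (fun l : ℝ => l⁻¹ • y) 1 :=
      (continuousAt_inv₀ one_ne_zero).smul continuousAt_const
    filter_upwards [c1.eventually_mem (hW.mem_nhds (by simpa using hy)),
      c2.eventually_mem (hW.mem_nhds (by simpa using hy)), lt_mem_nhds one_pos] with l a b c
    exact ⟨a, b, c⟩
  obtain ⟨l, ⟨h1, h2, hl0⟩, hl⟩ :=
    ((ev.filter_mono (nhdsWithin_le_nhds (s := Set.Ioi 1))).and self_mem_nhdsWithin).exists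
  change 1 < l at hl
  have q1 := flatX_sq (hP _ h1) (hQ _ h1)
  have q2 := flatX_sq (hP _ h2) (hQ _ h2)
  rw [hm, hrho] at q1 q2
  have heq : flatX σ (l⁻¹ • y) = flatX σ (l • y) := by
    have := (flatX_pos (hP _ h1) (hQ _ h1)).le
    have := (flatX_pos (hP _ h2) (hQ _ h2)).le
    rw [← sq_eq_sq₀ (by assumption) (by assumption), q1, q2]
    field_simp
    ring
  have hcont : ContinuousOn (fun z => rhoSq z + axial σ z)
      {z | z ∈ W ∧ flatX σ z = flatX σ (l • y)} := by
    unfold rhoSq axial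
    fun_prop
  have hl2 : 1 < l ^ 2 := by nlinarith
  have hl3 : (l⁻¹) ^ 2 < 1 := by
    rw [inv_pow]; exact inv_lt_one_of_one_lt₀ hl2
  -- A connected level set would cross the critical sphere at some `z`, where `X² = -σ`; but `X² >
  -- -σ` at `l y` on the same level set.
  obtain ⟨z, ⟨hz, hzX⟩, hz0⟩ := (hc (flatX σ (l • y))).intermediate_value
    (a := l⁻¹ • y) (b := l • y) ⟨h2, heq⟩ ⟨h1, rfl⟩ hcont
    (show (0 : ℝ) ∈ _ by
      refine ⟨?_, ?_⟩
      · rw [hm]; nlinarith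
      · rw [hm]; nlinarith)
  have q3 := flatX_sq (hP _ hz) (hQ _ hz)
  change rhoSq z + axial σ z = 0 at hz0
  rw [hz0, hzX, q1] at q3
  have : 0 < (R * (l ^ 2 - 1) / 2) ^ 2 / (l ^ 2 * rhoSq y) := by
    have : 0 < l ^ 2 - 1 := by linarith
    positivity
  simp at q3
  rcases q3 with h | h
  · rcases h with h | h <;> linarith
  · rcases h with h | h <;> linarith

/-- A function whose differential is proportional to that of `X` is a function of `X` on a set
where the level sets of `X` are connected. -/
theorem exists_factor {X F : Coord → ℝ} {W : Set Coord}
    (hc : ∀ c, IsPreconnected {y | y ∈ W ∧ X y = c})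
    (hs : ∀ y ∈ W, ∃ s : ℝ → Coord, s (X y) = y ∧ ∀ᶠ z in nhds y, F z = F (s (X z))) :
    ∃ f : ℝ → ℝ, ∀ y ∈ W, F y = f (X y) := by
  classical
  have key : ∀ y ∈ W, ∀ z ∈ W, X y = X z → F y = F z := by
    intro y hy z hz hyz
    -- Having equal `F`-values is an equivalence relation that holds locally within a level set, so
    -- connectedness makes it global there.
    refine (hc (X z)).induction₂ (fun a b => F a = F b) ?_ ?_ ?_ ⟨hy, hyz⟩ ⟨hz, rfl⟩
    · rintro a ⟨ha, haX⟩
      obtain ⟨s, hsa, hev⟩ := hs a ha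
      filter_upwards [hev.filter_mono nhdsWithin_le_nhds, self_mem_nhdsWithin] with b hb hbm
      rw [hb, hbm.2, ← haX, hsa]
    · intro a b c _ _ _ h1 h2; exact h1.trans h2
    · intro a b _ _ h; exact h.symm
  refine ⟨fun c => if h : ∃ y ∈ W, X y = c then F h.choose else 0, fun y hy => ?_⟩
  have h : ∃ z ∈ W, X z = X y := ⟨y, hy, rfl⟩
  simp only [h, dif_pos]
  exact key y hy _ h.choose_spec.1 h.choose_spec.2.symm

/-- Near `X y` the profile is `f = F ∘ s`, so it inherits the regularity of `F` and of the section.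
-/
theorem contDiffAt_of_section {n : WithTop ℕ∞} {X F : Coord → ℝ} {W : Set Coord} (hW : IsOpen W)
    {f : ℝ → ℝ} (hf : ∀ y ∈ W, F y = f (X y)) {y : Coord} (hy : y ∈ W) {s : ℝ → Coord}
    (hs : ContDiffAt ℝ n s (X y)) (hsy : s (X y) = y) (hX : ∀ᶠ c in nhds (X y), X (s c) = c)
    (hF : ContDiffAt ℝ n F y) : ContDiffAt ℝ n f (X y) := by
  have h : ContDiffAt ℝ n (fun c => F (s c)) (X y) :=
    ContDiffAt.comp (X y) (by rwa [hsy]) hs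
  refine h.congr_of_eventuallyEq ?_
  filter_upwards [hX, hs.continuousAt.eventually_mem (hW.mem_nhds (by rwa [hsy]))] with c h1 h2
  rw [hf _ h2, h1]

theorem contDiffAt_contract {n : WithTop ℕ∞} {E : Coord → Ten2} {V W : Coord → Coord} {y : Coord}
    (hE : ContDiffAt ℝ n E y) (hV : ContDiffAt ℝ n V y) (hW : ContDiffAt ℝ n W y) :
    ContDiffAt ℝ n (fun q => contract (E q) (V q) (W q)) y := by
  unfold contract
  rw [contDiffAt_pi] at hV hW
  refine ContDiffAt.sum fun i _ => ContDiffAt.sum fun j _ => ?_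
  exact (((contDiffAt_pi.1 ((contDiffAt_pi.1 hE) i)) j).mul (hV i)).mul (hW j)

/-- The partial derivatives of the components of a tensor field. -/
def pdTen (E : Coord → Ten2) (y : Coord) : Fin 3 → Ten2 := fun k i j => pd k (fun q => E q i j) y

theorem hasGradTen_pdTen {E : Coord → Ten2} {y : Coord} (h : DifferentiableAt ℝ E y) :
    HasGradTen E (pdTen E y) y := fun i j =>
  hasGrad_pd (differentiableAt_pi.1 (differentiableAt_pi.1 h i) j)

/-- All exponents that occur are multiples of `1/4`; in terms of fourth roots of `P` and `Q` the
final identities are rational. -/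
theorem exists_quartic_root {x : ℝ} (hx : 0 < x) : ∃ a : ℝ, 0 < a ∧ x = a ^ 4 ∧
    √x = a ^ 2 ∧ x ^ (1 / 4 : ℝ) = a ∧
    x ^ (3 / 4 : ℝ) = a ^ 3 ∧ x ^ (-(1 / 4) : ℝ) = a⁻¹ ∧ x ^ (-(3 / 4) : ℝ) = (a ^ 3)⁻¹ ∧
    x ^ (-(5 / 4) : ℝ) = (a ^ 5)⁻¹ ∧ x ^ (-(7 / 4) : ℝ) = (a ^ 7)⁻¹ ∧
    x ^ (-1 : ℝ) = (a ^ 4)⁻¹ ∧ x ^ (-2 : ℝ) = (a ^ 8)⁻¹ := by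
  refine ⟨x ^ (1 / 4 : ℝ), by positivity, ?_⟩
  simp only [← Real.rpow_natCast, ← Real.rpow_mul hx.le, ← Real.rpow_neg hx.le, Real.sqrt_eq_rpow]
  norm_num

/-- Solutions in the flat model are of the form `flatComb` wherever the level sets of `X` are
connected. -/
theorem flat_classification {σ : ℝ} {V : Set Coord} (hV : IsOpen V) (hVc : IsPreconnected V)
    (hP : ∀ y ∈ V, 0 < xiSq σ y) (hQ : ∀ y ∈ V, 0 < rhoSq y) {k : ℕ∞} (hk : 1 ≤ k)
    {E : Coord → Ten2} (hE : ∀ y ∈ V, ContDiffAt ℝ (k : WithTop ℕ∞) E y)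
    (hsol : ∀ y ∈ V, FlatSolAt σ y (E y) (pdTen E y)) :
    ∃ c₁ c₂ : ℝ, ∀ W ⊆ V, IsOpen W → (∀ c, IsPreconnected {y | y ∈ W ∧ flatX σ y = c}) →
      ∃ f h : ℝ → ℝ, (∀ y ∈ W, ContDiffAt ℝ (k + 1 : WithTop ℕ∞) f (flatX σ y)) ∧
        (∀ y ∈ W, ContDiffAt ℝ (k : WithTop ℕ∞) h (flatX σ y)) ∧
        ∀ y ∈ W, E y = flatComb σ f h c₁ c₂ y := by
  have hk1 : (1 : WithTop ℕ∞) ≤ (k : WithTop ℕ∞) := by exact_mod_cast hk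
  have hk0 : (k : WithTop ℕ∞) ≠ 0 := fun h => by simp [h] at hk1
  have hEd : ∀ y ∈ V, HasGradTen E (pdTen E y) y := fun y hy =>
    hasGradTen_pdTen ((hE y hy).differentiableAt hk0)
  have hξc := fun y => ((contDiff_canonXi σ).of_le (le_top (a := (k : WithTop ℕ∞)))).contDiffAt
    (x := y)
  have hηc := fun y => (contDiff_canonEta.of_le (le_top (a := (k : WithTop ℕ∞)))).contDiffAt
    (x := y)
  have hνc := fun y => ((contDiff_canonNu σ).of_le (le_top (a := (k : WithTop ℕ∞)))).contDiffAt
    (x := y)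
  -- contractions with `ν` and a Killing direction are constant
  have hconst₁ : ∃ c, ∀ y ∈ V, contract (E y) (canonNu σ y) (canonXi σ y) = c := by
    have hg := fun y hy => hasGrad_contract (hEd y hy) (hasGrad_nu σ y) (hasGrad_xi σ y)
    refine hV.exists_is_const_of_fderiv_eq_zero (𝕜 := ℝ) hVc
      (fun y hy => (hg y hy).differentiableAt.differentiableWithinAt) fun y hy => ?_
    refine eq_zero_of_frame (σ := σ) (y := y) (hP y hy).ne' (hQ y hy).ne' ?_ ?_ ?_
    · rw [(hg y hy).fderiv_apply, (hsol y hy).xi_contract (bracket_xi_nu σ y) (β := 0) (by simp)]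
      ring
    · rw [(hg y hy).fderiv_apply, (hsol y hy).eta_contract (bracket_eta_nu σ y)
        (bracket_eta_xi σ y)]
    · rw [(hg y hy).fderiv_apply, (hsol y hy).nu_contract_nu_xi]
  have hconst₂ : ∃ c, ∀ y ∈ V, contract (E y) (canonNu σ y) (canonEta y) = c := by
    have hg := fun y hy => hasGrad_contract (hEd y hy) (hasGrad_nu σ y) (hasGrad_eta y)
    refine hV.exists_is_const_of_fderiv_eq_zero (𝕜 := ℝ) hVc
      (fun y hy => (hg y hy).differentiableAt.differentiableWithinAt) fun y hy => ?_
    refine eq_zero_of_frame (σ := σ) (y := y) (hP y hy).ne' (hQ y hy).ne' ?_ ?_ ?_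
    · rw [(hg y hy).fderiv_apply, (hsol y hy).xi_contract (bracket_xi_nu σ y) (β := 0)
        (fun i => by rw [bracket_xi_eta]; ring)]
      ring
    · rw [(hg y hy).fderiv_apply, (hsol y hy).eta_contract (bracket_eta_nu σ y) (by simp)]
    · rw [(hg y hy).fderiv_apply, (hsol y hy).nu_contract_nu_eta]
  obtain ⟨c₁, hc₁⟩ := hconst₁
  obtain ⟨c₂, hc₂⟩ := hconst₂
  -- The constants come from connectedness of all of `V`, so they are chosen before `W`; only `f`
  -- and `h` depend on `W`.
  refine ⟨c₁, c₂, fun W hWV hW hlev => ?_⟩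
  have hP' : ∀ y ∈ W, 0 < xiSq σ y := fun y hy => hP y (hWV hy)
  have hQ' : ∀ y ∈ W, 0 < rhoSq y := fun y hy => hQ y (hWV hy)
  have hcrit : ∀ y ∈ W, rhoSq y + axial σ y ≠ 0 := fun y hy => not_critical hW hP' hQ' hlev hy
  have hsec : ∀ y ∈ W, _ := fun y hy => exists_local_section hk1
    (contDiffAt_flatX (n := k) (hP' y hy) (hQ' y hy)) (v := canonNu σ y) (by
      rw [fderiv_flatX_nu (hP' y hy) (hQ' y hy)]
      exact mul_ne_zero (neg_ne_zero.2 (flatX_pos (hP' y hy) (hQ' y hy)).ne') (hcrit y hy))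
  set Nν : Coord → ℝ := fun y => contract (E y) (canonNu σ y) (canonNu σ y) with hNν
  set Nx : Coord → ℝ := fun y => contract (E y) (canonXi σ y) (canonEta y) with hNx
  -- Along `ξ` the contraction `E(ν, ν)` grows at rate `y⁰` and `E(ξ, η)` at rate `-y⁰`, while `PQ`
  -- grows at rate `4 y⁰`. The powers `∓1/4` compensate for this.
  set F : Coord → ℝ := fun y => weighted σ (fun _ => 1) (-(1 / 4)) (-(1 / 4)) y * Nν y with hF
  set H : Coord → ℝ := fun y => weighted σ (fun _ => 1) (1 / 4) (1 / 4) y * Nx y with hH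
  have gν := fun y (hy : y ∈ W) =>
    hasGrad_contract (hEd y (hWV hy)) (hasGrad_nu σ y) (hasGrad_nu σ y)
  have gx := fun y (hy : y ∈ W) =>
    hasGrad_contract (hEd y (hWV hy)) (hasGrad_xi σ y) (hasGrad_eta y)
  have hwc : ∀ r t : ℝ, ∀ y ∈ W, ContDiffAt ℝ (k : WithTop ℕ∞) (weighted σ (fun _ => 1) r t) y :=
    fun r t y hy => contDiffAt_weighted (hP' y hy) (hQ' y hy) contDiffAt_const r t
  have hFc : ∀ y ∈ W, ContDiffAt ℝ (k : WithTop ℕ∞) F y := fun y hy =>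
    (hwc _ _ y hy).mul (contDiffAt_contract (hE y (hWV hy)) (hνc y) (hνc y))
  have hHc : ∀ y ∈ W, ContDiffAt ℝ (k : WithTop ℕ∞) H y := fun y hy =>
    (hwc _ _ y hy).mul (contDiffAt_contract (hE y (hWV hy)) (hξc y) (hηc y))
  have hFν : ∀ y ∈ W, fderiv ℝ F y (canonNu σ y) = -(rhoSq y + axial σ y) *
      (-(weighted σ (fun _ => 1) (3 / 4) (-(1 / 4)) y * contract (E y) (canonEta y) (canonEta y))
        - F y / 2) := by
    intro y hy
    have := (hP' y hy).ne'
    have := (hQ' y hy).ne'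
    have hw : weighted σ (fun _ => 1) (3 / 4) (-(1 / 4)) y =
        weighted σ (fun _ => 1) (-(1 / 4)) (-(1 / 4)) y * xiSq σ y := by
      simp only [weighted]
      rw [show (3 / 4 : ℝ) = -(1 / 4) + 1 by norm_num, Real.rpow_add_one (hP' y hy).ne']
      ring
    rw [fderiv_weighted_mul (hP' y hy) (hQ' y hy) (gν y hy), (hsol y (hWV hy)).nu_contract_nu_nu,
      nu_xiSq, nu_rhoSq, hw]
    simp only [hF, hNν]
    field_simp
    ring
  have hFX : ∀ y ∈ W, ∀ u, fderiv ℝ (flatX σ) y u = 0 → fderiv ℝ F y u = 0 := by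
    intro y hy
    have := (hP' y hy).ne'
    have := (hQ' y hy).ne'
    refine fderiv_eq_zero_of_flatX (hP' y hy) (hQ' y hy) (hcrit y hy) ?_ ?_
    · rw [fderiv_weighted_mul (hP' y hy) (hQ' y hy) (gν y hy),
        (hsol y (hWV hy)).xi_contract (bracket_xi_nu σ y) (bracket_xi_nu σ y), xi_xiSq, xi_rhoSq]
      field_simp
      ring
    · rw [fderiv_weighted_mul (hP' y hy) (hQ' y hy) (gν y hy),
        (hsol y (hWV hy)).eta_contract (bracket_eta_nu σ y) (bracket_eta_nu σ y), eta_xiSq,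
        eta_rhoSq]
      simp
  have hHX : ∀ y ∈ W, ∀ u, fderiv ℝ (flatX σ) y u = 0 → fderiv ℝ H y u = 0 := by
    intro y hy
    have := (hP' y hy).ne'
    have := (hQ' y hy).ne'
    refine fderiv_eq_zero_of_flatX (hP' y hy) (hQ' y hy) (hcrit y hy) ?_ ?_
    · rw [fderiv_weighted_mul (hP' y hy) (hQ' y hy) (gx y hy),
        (hsol y (hWV hy)).xi_contract (α := 0) (β := 0) (by simp)
        (by simpa using bracket_xi_eta σ y), xi_xiSq, xi_rhoSq]
      field_simp
      ring
    · rw [fderiv_weighted_mul (hP' y hy) (hQ' y hy) (gx y hy),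
        (hsol y (hWV hy)).eta_contract (bracket_eta_xi σ y) (by simp), eta_xiSq, eta_rhoSq]
      simp
  have hfac : ∀ {G : Coord → ℝ}, (∀ y ∈ W, ContDiffAt ℝ (k : WithTop ℕ∞) G y) →
      (∀ y ∈ W, ∀ u, fderiv ℝ (flatX σ) y u = 0 → fderiv ℝ G y u = 0) →
      ∃ f : ℝ → ℝ, ∀ y ∈ W, G y = f (flatX σ y) := by
    intro G hGc hGX
    refine exists_factor hlev fun y hy => ?_
    obtain ⟨s, -, hsy, -, hs⟩ := hsec y hy
    refine ⟨s, hsy, hs G ?_⟩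
    filter_upwards [hW.mem_nhds hy] with z hz
    exact ⟨(hGc z hz).differentiableAt hk0, hGX z hz⟩
  have hreg : ∀ {G : Coord → ℝ} {f : ℝ → ℝ}, (∀ y ∈ W, ContDiffAt ℝ (k : WithTop ℕ∞) G y) →
      (∀ y ∈ W, G y = f (flatX σ y)) → ∀ y ∈ W, ContDiffAt ℝ (k : WithTop ℕ∞) f (flatX σ y) := by
    intro G f hGc hGf y hy
    obtain ⟨s, hsc, hsy, hsX, -⟩ := hsec y hy
    exact contDiffAt_of_section hW hGf hy hsc hsy hsX (hGc y hy)
  obtain ⟨f, hf⟩ := hfac hFc hFX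
  obtain ⟨h, hh⟩ := hfac hHc hHX
  have hfk := hreg hFc hf
  have hhk := hreg hHc hh
  -- Comparing `hFν` with `ν(f(X)) = -(Q + a) X f'(X)` and cancelling `Q + a ≠ 0` identifies `G`
  -- with `X f'(X)`.
  set G : Coord → ℝ := fun y => -(weighted σ (fun _ => 1) (3 / 4) (-(1 / 4)) y *
    contract (E y) (canonEta y) (canonEta y)) - F y / 2 with hG
  have hGc : ∀ y ∈ W, ContDiffAt ℝ (k : WithTop ℕ∞) G y := fun y hy =>
    (((hwc _ _ y hy).mul (contDiffAt_contract (hE y (hWV hy)) (hηc y) (hηc y))).neg).sub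
      ((hFc y hy).div_const 2)
  have hGf : ∀ y ∈ W, G y = flatX σ y * deriv f (flatX σ y) := by
    intro y hy
    have h1 : HasFDerivAt (fun z => f (flatX σ z)) (deriv f (flatX σ y) • fderiv ℝ (flatX σ) y) y :=
      ((hfk y hy).differentiableAt hk0).hasDerivAt.comp_hasFDerivAt y
        (((contDiffAt_flatX (hP' y hy) (hQ' y hy)).differentiableAt
          (one_ne_zero)).hasFDerivAt)
    have h2 : HasFDerivAt F (deriv f (flatX σ y) • fderiv ℝ (flatX σ) y) y := by
      refine h1.congr_of_eventuallyEq ?_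
      filter_upwards [hW.mem_nhds hy] with z hz
      exact hf z hz
    have h3 := hFν y hy
    rw [h2.fderiv, smul_apply, fderiv_flatX_nu (hP' y hy) (hQ' y hy)] at h3
    refine mul_left_cancel₀ (neg_ne_zero.2 (hcrit y hy)) ?_
    simp only [hG]
    rw [← h3, smul_eq_mul]
    ring
  have hGk := hreg (f := fun x => x * deriv f x) hGc hGf
  have hopen : IsOpen (flatX σ '' W) := by
    rw [isOpen_iff_mem_nhds]
    rintro _ ⟨y, hy, rfl⟩
    obtain ⟨s, hsc, hsy, hsX, -⟩ := hsec y hy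
    filter_upwards [hsX, hsc.continuousAt.eventually_mem (hW.mem_nhds (by rwa [hsy]))]
      with c h1 h2
    exact ⟨s c, h2, h1⟩
  -- The gain of a derivative: `x f'(x)` is of class `C^k` because `G` is algebraic in `E`, and `x =
  -- X` is positive.
  have hf1 : ContDiffOn ℝ (k + 1 : WithTop ℕ∞) f (flatX σ '' W) := by
    rw [contDiffOn_succ_iff_deriv_of_isOpen hopen]
    refine ⟨?_, by simp, ?_⟩
    · rintro _ ⟨y, hy, rfl⟩
      exact ((hfk y hy).differentiableAt hk0).differentiableWithinAt
    · rintro _ ⟨y, hy, rfl⟩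
      have hX0 := (flatX_pos (hP' y hy) (hQ' y hy)).ne'
      refine ContDiffAt.contDiffWithinAt ?_
      refine ((hGk y hy).div contDiffAt_id hX0).congr_of_eventuallyEq ?_
      filter_upwards [isOpen_ne.mem_nhds hX0] with c hc
      exact (mul_div_cancel_left₀ _ hc).symm
  refine ⟨f, h, fun y hy => hf1.contDiffAt (hopen.mem_nhds ⟨y, hy, rfl⟩), hhk, fun y hy => ?_⟩
  have hPy := hP' y hy
  have hQy := hQ' y hy
  have hsy := hsol y (hWV hy)
  rw [expand_frame (σ := σ) (y := y) hsy.symm hsy.trace hPy.ne' hQy.ne', hc₁ y (hWV hy),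
    hc₂ y (hWV hy)]
  have e1 := hf y hy
  have e2 := hh y hy
  have e3 := hGf y hy
  simp only [hF, hH, hG, hNν, hNx] at e1 e2 e3
  unfold flatComb
  simp only [weighted] at e1 e2 e3 ⊢
  rw [← e1, ← e2, ← e3]
  generalize contract (E y) (canonNu σ y) (canonNu σ y) = n at *
  generalize contract (E y) (canonXi σ y) (canonEta y) = m at *
  generalize contract (E y) (canonEta y) (canonEta y) = l at *
  obtain ⟨a, ha, hPa, -, p1, p2, p3, p4, p5, p6, p7, p8⟩ := exists_quartic_root hPy
  obtain ⟨b, hb, hQb, -, q1, -, q3, q4, q5, q6, q7, q8⟩ := exists_quartic_root hQy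
  simp only [p1, p2, p3, p4, p5, p6, p7, p8, q1, q3, q4, q5, q6, q7, q8]
  rw [hPa, hQb]
  congr 1
  · congr 1
    · congr 1
      · congr 1
        · congr 1
          · congr 1
            field_simp
            ring
          · congr 1
            field_simp
            ring
        · congr 1
          field_simp
      · congr 1
        field_simp
    · congr 1
      field_simp
  · congr 1
    field_simp

/-! ### Conformally flat charts -/

/-- The Jacobian matrix of a map. -/
def jac (ψ : Coord → Coord) (p : Coord) (A i : Fin 3) : ℝ := pd i (fun q => ψ q A) p

/-- `ψ` is a chart of `U` with inverse `φ`, in which `g` is `Ω²` times the Euclidean metric. -/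
structure ConfChart (U : Set Coord) (g : Coord → Ten2) (ψ φ : Coord → Coord) (Ω : Coord → ℝ) :
    Prop where
  isOpen : IsOpen U
  smooth : ContDiffOn ℝ ∞ ψ U
  smoothFactor : ContDiffOn ℝ ∞ Ω U
  pos : ∀ p ∈ U, 0 < Ω p
  metric : ∀ p ∈ U, ∀ i j, g p i j = Ω p ^ 2 * ∑ A, jac ψ p A i * jac ψ p A j
  image_open : IsOpen (ψ '' U)
  left_inv : ∀ p ∈ U, φ (ψ p) = p
  smoothInv : ∀ p ∈ U, ContDiffAt ℝ ∞ φ (ψ p)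

theorem fderiv_eq_jac {ψ : Coord → Coord} {p : Coord} (h : DifferentiableAt ℝ ψ p) (u : Coord)
    (A : Fin 3) : fderiv ℝ ψ p u A = ∑ i, jac ψ p A i * u i := by
  have h1 : fderiv ℝ (fun q => ψ q A) p u = fderiv ℝ ψ p u A := by
    rw [fderiv_pi (fun A => differentiableAt_pi.1 h A)]
    rfl
  rw [← h1, fderiv_apply_eq_sum_pd]
  exact Finset.sum_congr rfl fun i _ => mul_comm _ _

theorem HasGrad.congr_of_eventuallyEq {F F' : Coord → ℝ} {G y : Coord} (h : HasGrad F G y)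
    (e : F' =ᶠ[nhds y] F) : HasGrad F' G y := HasFDerivAt.congr_of_eventuallyEq h e

theorem HasGrad.comp {F : Coord → ℝ} {G p : Coord} {ψ : Coord → Coord}
    (hF : HasGrad F G (ψ p)) (hψ : DifferentiableAt ℝ ψ p) :
    HasGrad (fun q => F (ψ q)) (fun i => ∑ A, jac ψ p A i * G A) p := by
  have h1 : DifferentiableAt ℝ (fun q => F (ψ q)) p := hF.differentiableAt.comp p hψ
  refine (hasGrad_pd h1).congr fun i => ?_
  have h2 := (HasFDerivAt.comp p hF.differentiableAt.hasFDerivAt hψ.hasFDerivAt).fderiv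
  change fderiv ℝ (fun q => F (ψ q)) p = _ at h2
  change ConfFlat3.pd i (fun q => F (ψ q)) p = _
  rw [ConfFlat3.pd, h2, ContinuousLinearMap.comp_apply, hF.fderiv_apply]
  refine Finset.sum_congr rfl fun A _ => ?_
  rw [fderiv_eq_jac hψ]
  simp [Pi.single_apply]

/-- Positive definiteness of `g` makes the differential of `ψ` injective, hence invertible. The
inverse function theorem then gives smooth local inverses, and injectivity on `U` identifies them
with one global inverse. -/
theorem exists_confChart {U : Set Coord} (hU : IsOpen U) {g : Coord → Ten2}
    (hg : IsMetricOn U g) {ψ : Coord → Coord} (hψ : ContDiffOn ℝ ∞ ψ U) (hinj : Set.InjOn ψ U)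
    {Ω : Coord → ℝ} (hΩ : ContDiffOn ℝ ∞ Ω U) (hpos : ∀ p ∈ U, 0 < Ω p)
    (hconf : ∀ p ∈ U, ∀ u v : Coord,
      ip g p u v = Ω p ^ 2 * ∑ i, fderiv ℝ ψ p u i * fderiv ℝ ψ p v i) :
    ∃ φ, ConfChart U g ψ φ Ω := by
  have hψa : ∀ p ∈ U, ContDiffAt ℝ ∞ ψ p := fun p hp => hψ.contDiffAt (hU.mem_nhds hp)
  have hψd : ∀ p ∈ U, DifferentiableAt ℝ ψ p := fun p hp => (hψa p hp).differentiableAt (by simp)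
  have hloc : ∀ p ∈ U, (∀ᶠ y in nhds (ψ p), y ∈ ψ '' U) ∧
      ContDiffAt ℝ ∞ (Function.invFunOn ψ U) (ψ p) := by
    intro p hp
    have hker : LinearMap.ker (fderiv ℝ ψ p : Coord →ₗ[ℝ] Coord) = ⊥ := by
      rw [LinearMap.ker_eq_bot']
      intro u hu
      by_contra hne
      have h1 := hg.posDef p hp u hne
      rw [hconf p hp] at h1
      simp only [ContinuousLinearMap.coe_coe] at hu
      simp [hu] at h1
    let L : Coord ≃L[ℝ] Coord := (LinearEquiv.ofInjectiveEndo (fderiv ℝ ψ p : Coord →ₗ[ℝ] Coord)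
      (LinearMap.ker_eq_bot.1 hker)).toContinuousLinearEquiv
    have hL : HasFDerivAt ψ (L : Coord →L[ℝ] Coord) p := by
      refine (hψd p hp).hasFDerivAt.congr_fderiv ?_
      ext u
      rfl
    let e := (hψa p hp).toOpenPartialHomeomorph ψ hL (by simp)
    have hpe : p ∈ e.source := (hψa p hp).mem_toOpenPartialHomeomorph_source hL (by simp)
    have hcs : ContDiffAt ℝ ∞ e.symm (ψ p) := (hψa p hp).to_localInverse hL (by simp)
    have hsp : e.symm (ψ p) = p := e.left_inv hpe
    have hty : ψ p ∈ e.target := e.map_source hpe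
    have hev : ∀ᶠ y in nhds (ψ p), e.symm y ∈ U ∧ ψ (e.symm y) = y := by
      filter_upwards [hcs.continuousAt.eventually_mem (hU.mem_nhds (by rwa [hsp])),
        e.open_target.mem_nhds hty] with y h1 h2
      exact ⟨h1, e.right_inv h2⟩
    refine ⟨?_, hcs.congr_of_eventuallyEq ?_⟩
    · filter_upwards [hev] with y hy
      exact ⟨_, hy.1, hy.2⟩
    · filter_upwards [hev] with y hy
      have := hinj.leftInvOn_invFunOn hy.1
      rwa [hy.2] at this
  refine ⟨Function.invFunOn ψ U, hU, hψ, hΩ, hpos, fun p hp i j => ?_, ?_,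
    fun p hp => hinj.leftInvOn_invFunOn hp, fun p hp => (hloc p hp).2⟩
  · have h := hconf p hp (Pi.single i 1) (Pi.single j 1)
    simp only [fderiv_eq_jac (hψd p hp)] at h
    simpa [ip, Pi.single_apply] using h
  · rw [isOpen_iff_mem_nhds]
    rintro _ ⟨p, hp, rfl⟩
    exact (hloc p hp).1

namespace ConfChart

variable {U : Set Coord} {g : Coord → Ten2} {ψ φ : Coord → Coord} {Ω : Coord → ℝ}
  (C : ConfChart U g ψ φ Ω) {p : Coord} (hp : p ∈ U)

include C hp

theorem contDiffAt : ContDiffAt ℝ ∞ ψ p := C.smooth.contDiffAt (C.isOpen.mem_nhds hp)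

theorem differentiableAt : DifferentiableAt ℝ ψ p := (C.contDiffAt hp).differentiableAt (by simp)

theorem jac_inv_mul (i j : Fin 3) :
    ∑ A, jac φ (ψ p) i A * jac ψ p A j = if i = j then 1 else 0 := by
  have h1 := (hasGrad_pd (differentiableAt_pi.1
    ((C.smoothInv p hp).differentiableAt (by simp)) i)).comp (C.differentiableAt hp)
  have h2 : HasGrad (fun q => φ (ψ q) i) (fun k => if k = i then 1 else 0) p := by
    refine (hasGrad_coord i p).congr_of_eventuallyEq ?_
    filter_upwards [C.isOpen.mem_nhds hp] with q hq
    rw [C.left_inv q hq]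
  have h3 := (h1.pd j).symm.trans (h2.pd j)
  simp only [eq_comm (a := i)]
  rw [← h3]
  exact Finset.sum_congr rfl fun A _ => mul_comm _ _

theorem jac_mul_inv (A B : Fin 3) :
    ∑ i, jac ψ p A i * jac φ (ψ p) i B = if A = B then 1 else 0 := by
  have h : Matrix.of (jac φ (ψ p)) * Matrix.of (jac ψ p) = 1 := by
    ext i j
    simpa [Matrix.mul_apply, Matrix.one_apply] using C.jac_inv_mul hp i j
  have h2 : (Matrix.of (jac ψ p) * Matrix.of (jac φ (ψ p))) A B =
      (1 : Matrix (Fin 3) (Fin 3) ℝ) A B := by rw [mul_eq_one_comm.1 h]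
  simpa [Matrix.mul_apply, Matrix.one_apply] using h2

theorem contDiffAt_jac (A i : Fin 3) : ContDiffAt ℝ ∞ (fun q => jac ψ q A i) p := by
  have h := contDiffAt_pi.1 (C.contDiffAt hp) A
  exact (h.fderiv_right (m := ∞) (by simp)).clm_apply contDiffAt_const

theorem contDiffAt_jac_inv (i A : Fin 3) : ContDiffAt ℝ ∞ (fun q => jac φ (ψ q) i A) p := by
  have h := contDiffAt_pi.1 (C.smoothInv p hp) i
  have h2 : ContDiffAt ℝ ∞ (fun y => jac φ y i A) (ψ p) :=
    (h.fderiv_right (m := ∞) (by simp)).clm_apply contDiffAt_const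
  exact h2.comp p (C.contDiffAt hp)

theorem contDiffAt_factor : ContDiffAt ℝ ∞ Ω p := C.smoothFactor.contDiffAt (C.isOpen.mem_nhds hp)

theorem ginv_eq (i j : Fin 3) :
    ginv g p i j = (Ω p ^ 2)⁻¹ * ∑ A, jac φ (ψ p) i A * jac φ (ψ p) j A := by
  have hΩ := (C.pos p hp).ne'
  have hm : Matrix.of (g p) = Ω p ^ 2 • ((Matrix.of (jac ψ p)).transpose * Matrix.of (jac ψ p)) := by
    ext i j
    simp [Matrix.mul_apply, C.metric p hp]
  have h : Matrix.of (jac φ (ψ p)) * Matrix.of (jac ψ p) = 1 := by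
    ext i j
    simpa [Matrix.mul_apply, Matrix.one_apply] using C.jac_inv_mul hp i j
  have hinv : (Matrix.of (g p))⁻¹ =
      (Ω p ^ 2)⁻¹ • (Matrix.of (jac φ (ψ p)) * (Matrix.of (jac φ (ψ p))).transpose) := by
    refine Matrix.inv_eq_left_inv ?_
    rw [hm, smul_mul_smul_comm, inv_mul_cancel₀ (by positivity), one_smul]
    rw [Matrix.mul_assoc, ← Matrix.mul_assoc (Matrix.of (jac φ (ψ p))).transpose,
      ← Matrix.transpose_mul, mul_eq_one_comm.1 h, Matrix.transpose_one, Matrix.one_mul, h]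
  rw [ginv, hinv]
  simp [Matrix.mul_apply]

/-- The symmetry of second derivatives. -/
theorem pd_jac_comm (A i k : Fin 3) :
    pd k (fun q => jac ψ q A i) p = pd i (fun q => jac ψ q A k) p := by
  have h := contDiffAt_pi.1 (C.contDiffAt hp) A
  have hs : IsSymmSndFDerivAt ℝ (fun q => ψ q A) p := h.isSymmSndFDerivAt (by
    simp only [minSmoothness_of_isRCLikeNormedField]; exact WithTop.coe_le_coe.2 le_top)
  have hd : DifferentiableAt ℝ (fderiv ℝ (fun q => ψ q A)) p :=
    (h.fderiv_right (m := ∞) (by simp)).differentiableAt (by simp)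
  have e : ∀ i k : Fin 3, pd k (fun q => jac ψ q A i) p =
      fderiv ℝ (fderiv ℝ (fun q => ψ q A)) p (Pi.single k 1) (Pi.single i 1) := by
    intro i k
    have h1 := hd.hasFDerivAt.clm_apply (hasFDerivAt_const (Pi.single i (1 : ℝ) : Coord) p)
    unfold pd
    change fderiv ℝ (fun q => fderiv ℝ (fun q => ψ q A) q (Pi.single i 1)) p _ = _
    rw [h1.fderiv]
    simp
  rw [e, e]
  exact hs _ _

theorem hasGrad_metric (i j : Fin 3) : HasGrad (fun q => g q i j) (fun k =>
    2 * (pd k Ω p / Ω p) * g p i j + Ω p ^ 2 * ∑ A, (pd k (fun q => jac ψ q A i) p * jac ψ p A j +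
      jac ψ p A i * pd k (fun q => jac ψ q A j) p)) p := by
  have hΩ := (C.pos p hp).ne'
  have h1 := hasGrad_pd ((C.contDiffAt_factor hp).differentiableAt (by simp))
  have h2 := fun A i => hasGrad_pd ((C.contDiffAt_jac hp A i).differentiableAt (by simp))
  have h3 := (h1.mul h1).mul (HasGrad.sum Finset.univ fun A _ => (h2 A i).mul (h2 A j))
  refine (h3.congr_of_eventuallyEq (F' := fun q => g q i j) ?_).congr fun k => ?_
  · filter_upwards [C.isOpen.mem_nhds hp] with q hq
    rw [C.metric q hq]
    ring
  rw [C.metric p hp]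
  field_simp
  ring

theorem ginv_mul_metric (i k : Fin 3) :
    ∑ l, ginv g p i l * g p l k = if i = k then 1 else 0 := by
  have hΩ := (C.pos p hp).ne'
  have h : ∑ l, ginv g p i l * g p l k = ∑ A, jac φ (ψ p) i A *
      ∑ B, (∑ l, jac ψ p B l * jac φ (ψ p) l A) * jac ψ p B k := by
    simp only [C.ginv_eq hp, C.metric p hp, Fin.sum_univ_three]
    field_simp
    ring
  rw [h]
  simp only [C.jac_mul_inv hp, ite_mul, one_mul, zero_mul, Finset.sum_ite_eq',
    Finset.mem_univ, if_true]
  exact C.jac_inv_mul hp i k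

theorem ginv_mul_jac (i A : Fin 3) :
    Ω p ^ 2 * ∑ l, ginv g p i l * jac ψ p A l = jac φ (ψ p) i A := by
  have hΩ := (C.pos p hp).ne'
  have h : Ω p ^ 2 * ∑ l, ginv g p i l * jac ψ p A l = ∑ B, jac φ (ψ p) i B *
      ∑ l, jac ψ p A l * jac φ (ψ p) l B := by
    simp only [C.ginv_eq hp, Fin.sum_univ_three]
    field_simp
    ring
  rw [h]
  simp [C.jac_mul_inv hp]

/-- The first sum is the flat connection pulled back by `ψ`; the remaining terms are the usual
change of the connection under a conformal factor, with `∂Ω/Ω = ∂ log Ω`. -/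
theorem christoffel_eq (i j k : Fin 3) : christoffel g p i j k =
    ∑ A, jac φ (ψ p) i A * pd j (fun q => jac ψ q A k) p +
      (if i = k then 1 else 0) * (pd j Ω p / Ω p) + (if i = j then 1 else 0) * (pd k Ω p / Ω p) -
      g p j k * ∑ l, ginv g p i l * (pd l Ω p / Ω p) := by
  have h : ∀ l, pd j (fun q => g q l k) p + pd k (fun q => g q l j) p -
      pd l (fun q => g q j k) p = 2 * (pd j Ω p / Ω p) * g p l k +
        2 * (pd k Ω p / Ω p) * g p l j - 2 * (pd l Ω p / Ω p) * g p j k +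
        2 * Ω p ^ 2 * ∑ A, jac ψ p A l * pd j (fun q => jac ψ q A k) p := by
    intro l
    rw [(C.hasGrad_metric hp l k).pd, (C.hasGrad_metric hp l j).pd, (C.hasGrad_metric hp j k).pd]
    simp only [C.pd_jac_comm hp _ l j, C.pd_jac_comm hp _ l k, C.pd_jac_comm hp _ j k,
      Fin.sum_univ_three]
    ring
  unfold christoffel
  simp only [h]
  rw [← C.ginv_mul_metric hp, ← C.ginv_mul_metric hp]
  simp only [← C.ginv_mul_jac hp i]
  simp only [Fin.sum_univ_three]
  ring

end ConfChart

/-! ### Push-forward of tensors and covariance of the equations -/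

/-- The push-forward of a contravariant two-tensor under the matrix `J`. -/
def push (J : Fin 3 → Fin 3 → ℝ) (T : Ten2) : Ten2 := fun A B =>
  ∑ i, ∑ j, J A i * J B j * T i j

theorem push_symProd (J : Fin 3 → Fin 3 → ℝ) (V W : Coord → Coord) (p : Coord) (A B : Fin 3) :
    push J (symProd V W p) A B = (∑ i, J A i * V p i) * (∑ i, J B i * W p i) +
      (∑ i, J A i * W p i) * (∑ i, J B i * V p i) := by
  simp only [push, symProd, Fin.sum_univ_three]
  ring

/-- The trace of a product with the Jacobian. -/
theorem sum_inv_jac {J K : Fin 3 → Fin 3 → ℝ}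
    (h : ∀ i j, ∑ A, K i A * J A j = if i = j then 1 else 0) (X : Fin 3 → Fin 3 → ℝ) :
    ∑ A, ∑ k, K k A * ∑ i, J A i * X k i = ∑ k, X k k := by
  have : ∑ A, ∑ k, K k A * ∑ i, J A i * X k i = ∑ k, ∑ i, (∑ A, K k A * J A i) * X k i := by
    simp only [Fin.sum_univ_three]
    ring
  rw [this]
  simp [h]

theorem sum_jac_inv {J K : Fin 3 → Fin 3 → ℝ}
    (h : ∀ A B, ∑ i, J A i * K i B = if A = B then 1 else 0) (X : Fin 3 → ℝ) (A : Fin 3) :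
    ∑ k, K k A * ∑ C, J C k * X C = X A := by
  have : ∑ k, K k A * ∑ C, J C k * X C = ∑ C, (∑ k, J C k * K k A) * X C := by
    simp only [Fin.sum_univ_three]
    ring
  rw [this]
  simp [h]

/-- Naturality of the Lie derivative as an algebraic identity: `HA` and `HB` stand for second
derivatives of two chart components, and their contributions cancel by symmetry. -/
theorem lie_push_algebra (J HA HB V' : Fin 3 → Fin 3 → ℝ) (V : Coord) (D : Ten2)
    (d : Fin 3 → Ten2) (A B : Fin 3) (hA : ∀ i k, HA i k = HA k i) (hB : ∀ i k, HB i k = HB k i) :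
    ∑ k, V k * ∑ i, ∑ j, (HA k i * J B j * D i j + J A i * HB k j * D i j +
        J A i * J B j * d k i j) -
      ∑ k, (∑ j, J B j * D k j) * ∑ i, (HA k i * V i + J A i * V' k i) -
      ∑ k, (∑ j, J A j * D j k) * ∑ i, (HB k i * V i + J B i * V' k i) =
    ∑ i, ∑ j, J A i * J B j * ∑ k, (V k * d k i j - D k j * V' k i - D i k * V' k j) := by
  simp only [Fin.sum_univ_three, hA 1 0, hA 2 0, hA 2 1, hB 1 0, hB 2 0, hB 2 1]
  ring

namespace ConfChart

variable {U : Set Coord} {g : Coord → Ten2} {ψ φ : Coord → Coord} {Ω : Coord → ℝ}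
  (C : ConfChart U g ψ φ Ω) {p : Coord} (hp : p ∈ U)

include C hp

theorem christoffel_trace (k : Fin 3) : ∑ i, christoffel g p i i k =
    ∑ i, ∑ A, jac φ (ψ p) i A * pd i (fun q => jac ψ q A k) p + 3 * (pd k Ω p / Ω p) := by
  have h : ∑ i, g p i k * ∑ l, ginv g p i l * (pd l Ω p / Ω p) = pd k Ω p / Ω p := by
    have hs : ∀ i l, ginv g p i l = ginv g p l i := fun i l => by
      simp only [C.ginv_eq hp, mul_comm (jac φ (ψ p) i _)]
    have : ∑ i, g p i k * ∑ l, ginv g p i l * (pd l Ω p / Ω p) =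
        ∑ l, (∑ i, ginv g p l i * g p i k) * (pd l Ω p / Ω p) := by
      simp only [hs _ 0, hs 2 1, Fin.sum_univ_three]
      ring
    rw [this]
    simp [C.ginv_mul_metric hp]
  simp only [C.christoffel_eq hp, Finset.sum_sub_distrib, Finset.sum_add_distrib, h]
  simp
  ring

theorem jac_christoffel (B i k : Fin 3) : ∑ j, jac ψ p B j * christoffel g p j i k =
    pd i (fun q => jac ψ q B k) p + jac ψ p B k * (pd i Ω p / Ω p) +
      jac ψ p B i * (pd k Ω p / Ω p) -
      g p i k * ∑ j, jac ψ p B j * ∑ l, ginv g p j l * (pd l Ω p / Ω p) := by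
  have h : ∑ j, jac ψ p B j * ∑ A, jac φ (ψ p) j A * pd i (fun q => jac ψ q A k) p =
      pd i (fun q => jac ψ q B k) p := by
    have : ∑ j, jac ψ p B j * ∑ A, jac φ (ψ p) j A * pd i (fun q => jac ψ q A k) p =
        ∑ A, (∑ j, jac ψ p B j * jac φ (ψ p) j A) * pd i (fun q => jac ψ q A k) p := by
      simp only [Fin.sum_univ_three]
      ring
    rw [this]
    simp [C.jac_mul_inv hp]
  simp only [C.christoffel_eq hp, mul_sub, mul_add, Finset.sum_sub_distrib,
    Finset.sum_add_distrib, h]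
  congr 1
  · simp
  · simp only [Fin.sum_univ_three]
    ring

/-- The divergence of a vector field in the chart. -/
theorem divVec_eq {V v : Coord → Coord} {v' : Fin 3 → Fin 3 → ℝ}
    (hV : ∀ i, DifferentiableAt ℝ (fun q => V q i) p)
    (hv : ∀ A, HasGrad (fun y => v y A) (fun k => v' k A) (ψ p))
    (hVv : ∀ q ∈ U, ∀ A, v (ψ q) A = ∑ i, jac ψ q A i * V q i) :
    divVec g V p = ∑ A, v' A A + 3 * ∑ k, pd k Ω p / Ω p * V p k ∧
      ∀ k A, ∑ B, jac ψ p B k * v' B A = ∑ i, (pd k (fun q => jac ψ q A i) p * V p i +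
        jac ψ p A i * pd k (fun q => V q i) p) := by
  have h2 : ∀ k A, ∑ B, jac ψ p B k * v' B A = ∑ i, (pd k (fun q => jac ψ q A i) p * V p i +
      jac ψ p A i * pd k (fun q => V q i) p) := by
    intro k A
    have h3 := HasGrad.sum Finset.univ fun i _ =>
      (hasGrad_pd ((C.contDiffAt_jac hp A i).differentiableAt (by simp))).mul (hasGrad_pd (hV i))
    have h4 := ((hv A).comp (C.differentiableAt hp)).congr_of_eventuallyEq
      (F' := fun q => ∑ i, jac ψ q A i * V q i) (by
        filter_upwards [C.isOpen.mem_nhds hp] with q hq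
        rw [hVv q hq])
    exact (h4.pd k).symm.trans (h3.pd k)
  refine ⟨?_, h2⟩
  have h5 : ∑ A, v' A A = ∑ i, ∑ A, jac φ (ψ p) i A * ∑ k, pd i (fun q => jac ψ q A k) p * V p k +
      ∑ k, pd k (fun q => V q k) p := by
    rw [← sum_inv_jac (C.jac_inv_mul hp) (fun k i => pd k (fun q => V q i) p)]
    have : ∀ A, v' A A = ∑ k, jac φ (ψ p) k A * ∑ B, jac ψ p B k * v' B A := fun A =>
      (sum_jac_inv (C.jac_mul_inv hp) (fun B => v' B A) A).symm
    simp only [this, h2, Finset.sum_add_distrib, mul_add]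
    rw [Finset.sum_comm]
  have h6 : divVec g V p = ∑ k, pd k (fun q => V q k) p +
      ∑ k, (∑ i, christoffel g p i i k) * V p k := by
    simp only [divVec, Fin.sum_univ_three]
    ring
  rw [h6, h5]
  simp only [C.christoffel_trace hp, Fin.sum_univ_three]
  ring

variable {D E : Coord → Ten2} (hE : DifferentiableAt ℝ E (ψ p)) (hD : DifferentiableAt ℝ D p)
  (hDE : ∀ q ∈ U, E (ψ q) = Ω q ^ 5 • push (jac ψ q) (D q))
include hE hD hDE

theorem pd_push (k A B : Fin 3) : ∑ c, jac ψ p c k * pdTen E (ψ p) c A B =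
    5 * Ω p ^ 4 * pd k Ω p * push (jac ψ p) (D p) A B + Ω p ^ 5 * ∑ i, ∑ j,
      (pd k (fun q => jac ψ q A i) p * jac ψ p B j * D p i j +
        jac ψ p A i * pd k (fun q => jac ψ q B j) p * D p i j +
        jac ψ p A i * jac ψ p B j * pdTen D p k i j) := by
  have hJ := fun A i => hasGrad_pd ((C.contDiffAt_jac hp A i).differentiableAt (by simp))
  have hΩ := (hasGrad_pd ((C.contDiffAt_factor hp).differentiableAt (by simp))).scomp
    (hasDerivAt_pow 5 (Ω p))
  have h1 := hΩ.mul (HasGrad.sum Finset.univ fun i _ => HasGrad.sum Finset.univ fun j _ =>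
    ((hJ A i).mul (hJ B j)).mul (hasGradTen_pdTen hD i j))
  have h2 := ((hasGradTen_pdTen hE A B).comp (C.differentiableAt hp)).congr_of_eventuallyEq
    (F' := fun q => Ω q ^ 5 * ∑ i, ∑ j, jac ψ q A i * jac ψ q B j * D q i j) (by
      filter_upwards [C.isOpen.mem_nhds hp] with q hq
      rw [hDE q hq]
      rfl)
  rw [(h2.pd k).symm.trans (h1.pd k)]
  simp only [push, Fin.sum_univ_three]
  push_cast
  ring

/-- Conformal covariance of the divergence of symmetric trace-free tensors. -/
theorem divTen_push (hs : ∀ i j, D p i j = D p j i) (ht : ∑ i, ∑ j, g p i j * D p i j = 0)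
    (B : Fin 3) : ∑ A, pdTen E (ψ p) A A B = Ω p ^ 5 * ∑ j, jac ψ p B j * divTen g D p j := by
  have hΩ := (C.pos p hp).ne'
  set M : Fin 3 → ℝ := fun i => ∑ j, jac ψ p B j * D p i j with hM
  set N : Fin 3 → Fin 3 → ℝ := fun k i => ∑ j, (pd k (fun q => jac ψ q B j) p * D p i j +
    jac ψ p B j * pdTen D p k i j) with hN
  have h1 : ∑ A, pdTen E (ψ p) A A B = ∑ k, (5 * Ω p ^ 4 * pd k Ω p * M k + Ω p ^ 5 * N k k) +
      Ω p ^ 5 * ∑ A, ∑ k, jac φ (ψ p) k A * ∑ i, pd k (fun q => jac ψ q A i) p * M i := by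
    rw [← sum_inv_jac (C.jac_inv_mul hp)
      (fun k i => 5 * Ω p ^ 4 * pd k Ω p * M i + Ω p ^ 5 * N k i)]
    have e : ∀ A, pdTen E (ψ p) A A B =
        ∑ k, jac φ (ψ p) k A * ∑ c, jac ψ p c k * pdTen E (ψ p) c A B := fun A =>
      (sum_jac_inv (C.jac_mul_inv hp) (fun c => pdTen E (ψ p) c A B) A).symm
    have r : ∀ k A, ∑ c, jac ψ p c k * pdTen E (ψ p) c A B =
        ∑ i, jac ψ p A i * (5 * Ω p ^ 4 * pd k Ω p * M i + Ω p ^ 5 * N k i) +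
          Ω p ^ 5 * ∑ i, pd k (fun q => jac ψ q A i) p * M i := by
      intro k A
      rw [C.pd_push hp hE hD hDE]
      simp only [hM, hN, push, Fin.sum_univ_three]
      ring
    simp only [e, r, mul_add, Finset.sum_add_distrib, Finset.mul_sum]
    congr 1
    refine Finset.sum_congr rfl fun A _ => Finset.sum_congr rfl fun k _ =>
      Finset.sum_congr rfl fun i _ => ?_
    ring
  have h2 : ∑ j, jac ψ p B j * divTen g D p j =
      ∑ i, ∑ j, jac ψ p B j * pdTen D p i i j + ∑ k, (∑ i, christoffel g p i i k) * M k +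
        ∑ i, ∑ k, (∑ j, jac ψ p B j * christoffel g p j i k) * D p i k := by
    simp only [divTen, pdTen, hM]
    simp only [Fin.sum_univ_three]
    ring
  -- The term with `g_ik` meets the trace of `D` and disappears; the two others agree by symmetry of
  -- `D`. Their factor `2` and the `3` from `christoffel_trace` add up to the exponent of `Ω⁵`.
  have h3 : ∑ i, ∑ k, (∑ j, jac ψ p B j * christoffel g p j i k) * D p i k =
      ∑ i, ∑ k, pd i (fun q => jac ψ q B k) p * D p i k + 2 * ∑ k, pd k Ω p / Ω p * M k := by
    have : ∑ i, ∑ k, (∑ j, jac ψ p B j * christoffel g p j i k) * D p i k =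
      ∑ i, ∑ k, (pd i (fun q => jac ψ q B k) p * D p i k) + 2 * ∑ k, pd k Ω p / Ω p * M k -
        (∑ i, ∑ j, g p i j * D p i j) *
          ∑ j, jac ψ p B j * ∑ l, ginv g p j l * (pd l Ω p / Ω p) := by
      simp only [C.jac_christoffel hp]
      generalize ∑ j, jac ψ p B j * ∑ l, ginv g p j l * (pd l Ω p / Ω p) = Z
      simp only [hM, Fin.sum_univ_three, hs 1 0, hs 2 0, hs 2 1]
      ring
    rw [this, ht]
    ring
  rw [h2, h3, h1]
  simp only [C.christoffel_trace hp]
  have h4 : ∀ k, pd k Ω p = Ω p * (pd k Ω p / Ω p) := fun k => by field_simp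
  simp only [hN, Fin.sum_univ_three]
  rw [h4 0, h4 1, h4 2]
  field_simp
  ring

/-- Conformal covariance of the KID operator. -/
theorem lieTen_push {V v : Coord → Coord} {v' : Fin 3 → Fin 3 → ℝ}
    (hV : ∀ i, DifferentiableAt ℝ (fun q => V q i) p)
    (hv : ∀ A, HasGrad (fun y => v y A) (fun k => v' k A) (ψ p))
    (hVv : ∀ q ∈ U, ∀ A, v (ψ q) A = ∑ i, jac ψ q A i * V q i) (A B : Fin 3) :
    ∑ k, (v (ψ p) k * pdTen E (ψ p) k A B - E (ψ p) k B * v' k A - E (ψ p) A k * v' k B) +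
        5 / 3 * (∑ c, v' c c) * E (ψ p) A B =
      Ω p ^ 5 * push (jac ψ p) (fun i j => lieTen V D p i j + 5 / 3 * divVec g V p * D p i j)
        A B := by
  have hΩ := (C.pos p hp).ne'
  -- The divergence changes by `3 V(log Ω)`; multiplied by `5/3` this is the logarithmic derivative
  -- of `Ω⁵` along `V`.
  obtain ⟨hdiv, hv'⟩ := C.divVec_eq hp hV hv hVv
  have h1 : ∑ k, v (ψ p) k * pdTen E (ψ p) k A B =
      ∑ k, V p k * ∑ c, jac ψ p c k * pdTen E (ψ p) c A B := by
    simp only [hVv p hp, Fin.sum_univ_three]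
    ring
  have hEp : ∀ A B, E (ψ p) A B = Ω p ^ 5 * push (jac ψ p) (D p) A B := fun A B => by
    rw [hDE p hp]; rfl
  have h2 : ∑ k, E (ψ p) k B * v' k A = Ω p ^ 5 * ∑ k, (∑ j, jac ψ p B j * D p k j) *
      ∑ c, jac ψ p c k * v' c A := by
    simp only [hEp, push, Fin.sum_univ_three]
    ring
  have h3 : ∑ k, E (ψ p) A k * v' k B = Ω p ^ 5 * ∑ k, (∑ j, jac ψ p A j * D p j k) *
      ∑ c, jac ψ p c k * v' c B := by
    simp only [hEp, push, Fin.sum_univ_three]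
    ring
  simp only [Finset.sum_sub_distrib]
  rw [h1, h2, h3, hdiv, hEp A B]
  simp only [C.pd_push hp hE hD hDE, hv']
  have h5 : push (jac ψ p) (fun i j => lieTen V D p i j +
      5 / 3 * (∑ A, v' A A + 3 * ∑ k, pd k Ω p / Ω p * V p k) * D p i j) A B =
      push (jac ψ p) (lieTen V D p) A B + 5 / 3 * (∑ A, v' A A +
        3 * ∑ k, pd k Ω p / Ω p * V p k) * push (jac ψ p) (D p) A B := by
    simp only [push, mul_add, Finset.sum_add_distrib, Finset.mul_sum]
    congr 1
    refine Finset.sum_congr rfl fun i _ => Finset.sum_congr rfl fun j _ => ?_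
    ring
  rw [h5]
  have h6 : ∑ k, V p k * (5 * Ω p ^ 4 * pd k Ω p * push (jac ψ p) (D p) A B) =
      5 * Ω p ^ 5 * (∑ k, pd k Ω p / Ω p * V p k) * push (jac ψ p) (D p) A B := by
    simp only [Fin.sum_univ_three]
    field_simp
  have key := lie_push_algebra (jac ψ p) (fun k i => pd k (fun q => jac ψ q A i) p)
    (fun k i => pd k (fun q => jac ψ q B i) p) (fun k i => pd k (fun q => V q i) p) (V p) (D p)
    (pdTen D p) A B (fun i k => C.pd_jac_comm hp A k i) (fun i k => C.pd_jac_comm hp B k i)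
  have h7 : ∀ X S : Fin 3 → ℝ, ∑ k, V p k * (X k + Ω p ^ 5 * S k) =
      ∑ k, V p k * X k + Ω p ^ 5 * ∑ k, V p k * S k := fun X S => by
    simp only [Fin.sum_univ_three]
    ring
  rw [h7, h6]
  change _ = push (jac ψ p) (lieTen V D p) A B at key
  linear_combination Ω p ^ 5 * key

end ConfChart

/-! ### Transfer of solutions between the metric `g` and the flat model -/

theorem push_inv {J K : Fin 3 → Fin 3 → ℝ}
    (h : ∀ i j, ∑ A, K i A * J A j = if i = j then 1 else 0) (T : Ten2) (i j : Fin 3) :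
    T i j = ∑ A, ∑ B, K i A * K j B * push J T A B := by
  have : ∑ A, ∑ B, K i A * K j B * push J T A B =
      ∑ k, ∑ l, (∑ A, K i A * J A k) * (∑ B, K j B * J B l) * T k l := by
    simp only [push, Fin.sum_univ_three]
    ring
  rw [this]
  simp [h]

theorem push_add (J : Fin 3 → Fin 3 → ℝ) (T T' : Ten2) : push J (T + T') = push J T + push J T' := by
  funext A B
  simp only [push, Pi.add_apply, mul_add, Finset.sum_add_distrib]

theorem push_smul (J : Fin 3 → Fin 3 → ℝ) (c : ℝ) (T : Ten2) : push J (c • T) = c • push J T := by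
  funext A B
  simp only [push, Pi.smul_apply, smul_eq_mul, Finset.mul_sum]
  exact Finset.sum_congr rfl fun i _ => Finset.sum_congr rfl fun j _ => by ring

theorem HasGradTen.pdTen {E : Coord → Ten2} {d : Fin 3 → Ten2} {y : Coord}
    (h : HasGradTen E d y) : pdTen E y = d := by
  funext k i j
  exact (h i j).pd k

/-- Two vector fields represented in a chart by `canonXi σ` and `canonEta`. -/
structure Represents (U : Set Coord) (ψ : Coord → Coord) (σ : ℝ) (ξ η : Coord → Coord) : Prop where
  xi : ∀ q ∈ U, ∀ A, canonXi σ (ψ q) A = ∑ i, jac ψ q A i * ξ q i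
  eta : ∀ q ∈ U, ∀ A, canonEta (ψ q) A = ∑ i, jac ψ q A i * η q i

namespace ConfChart

variable {U : Set Coord} {g : Coord → Ten2} {ψ φ : Coord → Coord} {Ω : Coord → ℝ}
  (C : ConfChart U g ψ φ Ω) {p : Coord} (hp : p ∈ U)

include C

/-- A vector field with smooth components in the chart is smooth. -/
theorem contDiffAt_of_jac {V v : Coord → Coord} (hp : p ∈ U) (hv : ContDiffAt ℝ ∞ v (ψ p))
    (hVv : ∀ q ∈ U, ∀ A, v (ψ q) A = ∑ i, jac ψ q A i * V q i) : ContDiffAt ℝ ∞ V p := by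
  have h : ContDiffAt ℝ ∞ (fun q i => ∑ A, jac φ (ψ q) i A * v (ψ q) A) p :=
    contDiffAt_pi.2 fun i => ContDiffAt.sum fun A _ => (C.contDiffAt_jac_inv hp i A).mul
      ((contDiffAt_pi.1 hv A).comp p (C.contDiffAt hp))
  refine h.congr_of_eventuallyEq ?_
  filter_upwards [C.isOpen.mem_nhds hp] with q hq
  funext i
  have : ∑ A, jac φ (ψ q) i A * v (ψ q) A = ∑ j, (∑ A, jac φ (ψ q) i A * jac ψ q A j) * V q j := by
    simp only [hVv q hq, Fin.sum_univ_three]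
    ring
  rw [this]
  simp [C.jac_inv_mul hq]

theorem ip_eq (hp : p ∈ U) (u v : Coord) :
    ip g p u v = Ω p ^ 2 * ∑ A, (∑ i, jac ψ p A i * u i) * ∑ i, jac ψ p A i * v i := by
  simp only [ip, C.metric p hp, Fin.sum_univ_three]
  ring

section
variable {σ : ℝ} {ξ η : Coord → Coord} (R : Represents U ψ σ ξ η)
include R hp

theorem contDiffAt_xi : ContDiffAt ℝ ∞ ξ p :=
  C.contDiffAt_of_jac hp ((contDiff_canonXi σ).of_le le_top).contDiffAt R.xi

theorem contDiffAt_eta : ContDiffAt ℝ ∞ η p :=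
  C.contDiffAt_of_jac hp (contDiff_canonEta.of_le le_top).contDiffAt R.eta

variable {D E : Coord → Ten2} (hE : DifferentiableAt ℝ E (ψ p)) (hD : DifferentiableAt ℝ D p)
  (hDE : ∀ q ∈ U, E (ψ q) = Ω q ^ 5 • push (jac ψ q) (D q))
include hE hD hDE

theorem kid_xi_push (A B : Fin 3) :
    ∑ k, (canonXi σ (ψ p) k * pdTen E (ψ p) k A B - E (ψ p) k B * dXi (ψ p) k A -
        E (ψ p) A k * dXi (ψ p) k B) + 5 * ψ p 0 * E (ψ p) A B =
      Ω p ^ 5 * push (jac ψ p) (fun i j => lieTen ξ D p i j + 5 / 3 * divVec g ξ p * D p i j)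
        A B := by
  rw [← C.lieTen_push hp hE hD hDE (v := canonXi σ) (fun i => (contDiffAt_pi.1
    (C.contDiffAt_xi hp R) i).differentiableAt (by simp)) (hasGrad_xi σ (ψ p)) R.xi, div_xi]
  ring

theorem kid_eta_push (A B : Fin 3) :
    ∑ k, (canonEta (ψ p) k * pdTen E (ψ p) k A B - E (ψ p) k B * dEta k A -
        E (ψ p) A k * dEta k B) =
      Ω p ^ 5 * push (jac ψ p) (fun i j => lieTen η D p i j + 5 / 3 * divVec g η p * D p i j)
        A B := by
  rw [← C.lieTen_push hp hE hD hDE (v := canonEta) (fun i => (contDiffAt_pi.1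
    (C.contDiffAt_eta hp R) i).differentiableAt (by simp)) (hasGrad_eta (ψ p)) R.eta, div_eta]
  ring

omit R hE hD in
theorem trace_push : ∑ A, E (ψ p) A A = Ω p ^ 3 * ∑ i, ∑ j, g p i j * D p i j := by
  simp only [hDE p hp, Pi.smul_apply, smul_eq_mul, push, C.metric p hp, Fin.sum_univ_three]
  ring

theorem flatSolAt_of_solution (hs : ∀ i j, D p i j = D p j i)
    (ht : ∑ i, ∑ j, g p i j * D p i j = 0) (hdiv : ∀ j, divTen g D p j = 0)
    (hkξ : ∀ i j, lieTen ξ D p i j + 5 / 3 * divVec g ξ p * D p i j = 0)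
    (hkη : ∀ i j, lieTen η D p i j + 5 / 3 * divVec g η p * D p i j = 0) :
    FlatSolAt σ (ψ p) (E (ψ p)) (pdTen E (ψ p)) where
  symm A B := by
    simp only [hDE p hp, Pi.smul_apply, push]
    congr 1
    rw [Finset.sum_comm]
    exact Finset.sum_congr rfl fun i _ => Finset.sum_congr rfl fun j _ => by rw [hs]; ring
  trace := by rw [C.trace_push hp hDE, ht, mul_zero]
  div B := by
    rw [C.divTen_push hp hE hD hDE hs ht]
    simp [hdiv]
  kidXi A B := by
    rw [C.kid_xi_push hp R hE hD hDE]
    simp [push, hkξ]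
  kidEta A B := by
    rw [C.kid_eta_push hp R hE hD hDE]
    simp [push, hkη]

theorem solution_of_flatSolAt (h : FlatSolAt σ (ψ p) (E (ψ p)) (pdTen E (ψ p))) :
    (∀ i j, D p i j = D p j i) ∧ (∑ i, ∑ j, g p i j * D p i j = 0) ∧
    (∀ j, divTen g D p j = 0) ∧
    (∀ i j, lieTen ξ D p i j + 5 / 3 * divVec g ξ p * D p i j = 0) ∧
    (∀ i j, lieTen η D p i j + 5 / 3 * divVec g η p * D p i j = 0) := by
  have hΩ := (C.pos p hp).ne'
  have zero : ∀ T : Ten2, (∀ A B, Ω p ^ 5 * push (jac ψ p) T A B = 0) → ∀ i j, T i j = 0 := by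
    intro T hT i j
    rw [push_inv (C.jac_inv_mul hp) T i j]
    have : ∀ A B, push (jac ψ p) T A B = 0 := fun A B => by simpa [hΩ] using hT A B
    simp [this]
  -- Symmetry and trace come first, because the covariance of the divergence depends on them.
  have hs : ∀ i j, D p i j = D p j i := by
    intro i j
    refine sub_eq_zero.1 (zero (fun i j => D p i j - D p j i) (fun A B => ?_) i j)
    have := h.symm A B
    simp only [hDE p hp, Pi.smul_apply, smul_eq_mul, push, Fin.sum_univ_three] at this ⊢
    linear_combination this
  have ht : ∑ i, ∑ j, g p i j * D p i j = 0 := by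
    have := h.trace
    rw [C.trace_push hp hDE] at this
    simpa [hΩ] using this
  refine ⟨hs, ht, ?_, ?_, ?_⟩
  · intro j
    have h1 : ∀ B, ∑ j, jac ψ p B j * divTen g D p j = 0 := fun B => by
      have := h.div B
      rw [C.divTen_push hp hE hD hDE hs ht] at this
      simpa [hΩ] using this
    have h2 : ∑ B, jac φ (ψ p) j B * ∑ k, jac ψ p B k * divTen g D p k =
        ∑ k, (∑ B, jac φ (ψ p) j B * jac ψ p B k) * divTen g D p k := by
      simp only [Fin.sum_univ_three]
      ring
    simpa [h1, C.jac_inv_mul hp] using h2.symm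
  · exact zero _ fun A B => by rw [← C.kid_xi_push hp R hE hD hDE, h.kidXi]
  · exact zero _ fun A B => by rw [← C.kid_eta_push hp R hE hD hDE, h.kidEta]

end

/-! ### The four tensors in the chart -/

section
variable {σ : ℝ} {ξ η : Coord → Coord} (R : Represents U ψ σ ξ η)
include R hp

theorem ip_xi_xi : ip g p (ξ p) (ξ p) = Ω p ^ 2 * xiSq σ (ψ p) := by
  rw [C.ip_eq hp, ← sum_xi_xi]
  simp only [← R.xi p hp]

theorem ip_eta_eta : ip g p (η p) (η p) = Ω p ^ 2 * rhoSq (ψ p) := by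
  rw [C.ip_eq hp, ← sum_eta_eta]
  simp only [← R.eta p hp]

theorem vnorm_xi : vnorm g ξ p = Ω p * √(xiSq σ (ψ p)) := by
  rw [vnorm, C.ip_xi_xi hp R, Real.sqrt_mul (by positivity), Real.sqrt_sq (C.pos p hp).le]

theorem vnorm_eta : vnorm g η p = Ω p * √(rhoSq (ψ p)) := by
  rw [vnorm, C.ip_eta_eta hp R, Real.sqrt_mul (by positivity), Real.sqrt_sq (C.pos p hp).le]

theorem quotX_eq : quotX g ξ η p = flatX σ (ψ p) := by
  have := (C.pos p hp).ne'
  rw [quotX, C.vnorm_xi hp R, C.vnorm_eta hp R, flatX, mul_div_mul_left _ _ this]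

theorem xiSq_pos (hg : IsMetricOn U g) (hξ : ξ p ≠ 0) : 0 < xiSq σ (ψ p) := by
  have h := hg.posDef p hp _ hξ
  rw [C.ip_xi_xi hp R] at h
  exact pos_of_mul_pos_right h (by positivity)

theorem rhoSq_pos (hg : IsMetricOn U g) (hη : η p ≠ 0) : 0 < rhoSq (ψ p) := by
  have h := hg.posDef p hp _ hη
  rw [C.ip_eta_eta hp R] at h
  exact pos_of_mul_pos_right h (by positivity)

end

theorem push_ginv (hp : p ∈ U) : push (jac ψ p) (ginv g p) = (Ω p ^ 2)⁻¹ • idTen := by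
  funext A B
  have : push (jac ψ p) (ginv g p) A B = (Ω p ^ 2)⁻¹ * ∑ c,
      (∑ i, jac ψ p A i * jac φ (ψ p) i c) * ∑ j, jac ψ p B j * jac φ (ψ p) j c := by
    simp only [push, C.ginv_eq hp, Fin.sum_univ_three]
    ring
  rw [this]
  simp [C.jac_mul_inv hp, idTen]

theorem push_calD (hp : p ∈ U) {V v : Coord → Coord}
    (hVv : ∀ A, v (ψ p) A = ∑ i, jac ψ p A i * V p i) :
    push (jac ψ p) (calD g V p) = (1 / (2 * vnorm g V p ^ 5)) • symProd v v (ψ p) -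
      (vnorm g V p ^ 2 / (3 * vnorm g V p ^ 5 * Ω p ^ 2)) • idTen := by
  have h : calD g V p = (1 / (2 * vnorm g V p ^ 5)) • symProd V V p +
      (-(vnorm g V p ^ 2 / (3 * vnorm g V p ^ 5))) • ginv g p := by
    funext i j
    simp only [calD, Pi.add_apply, Pi.smul_apply, smul_eq_mul, symProd]
    ring
  rw [h, push_add, push_smul, push_smul, C.push_ginv hp]
  funext A B
  simp only [Pi.add_apply, Pi.sub_apply, Pi.smul_apply, smul_eq_mul, push_symProd, ← hVv, symProd]
  ring

end ConfChart

/-- Evaluation at a square turns the half-integer powers of `X` into integer powers; it is applied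
with `X = (a/b)²`, where `P = a⁴` and `Q = b⁴`. -/
theorem deriv_div_rpow {f : ℝ → ℝ} {b : ℝ} (hb : 0 < b) (hf : DifferentiableAt ℝ f (b ^ 2)) :
    deriv (fun x : ℝ => f x / x ^ (3 / 2 : ℝ)) (b ^ 2) =
      deriv f (b ^ 2) / b ^ 3 - 3 / 2 * f (b ^ 2) / b ^ 5 := by
  have hb2 : (b ^ 2) ≠ 0 := by positivity
  have e1 : (b ^ 2) ^ (3 / 2 : ℝ) = b ^ 3 := by
    simp only [← Real.rpow_natCast, ← Real.rpow_mul hb.le]; norm_num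
  have e2 : (b ^ 2) ^ (3 / 2 - 1 : ℝ) = b := by
    simp only [← Real.rpow_natCast, ← Real.rpow_mul hb.le]; norm_num
  have h := hf.hasDerivAt.div (Real.hasDerivAt_rpow_const (p := 3 / 2) (Or.inl hb2))
    (by rw [e1]; positivity)
  have h2 := h.deriv
  change deriv (fun x : ℝ => f x / x ^ (3 / 2 : ℝ)) (b ^ 2) = _ at h2
  rw [h2, e1, e2]
  field_simp

theorem deriv_rpow_mul {f : ℝ → ℝ} {b : ℝ} (hb : 0 < b) (hf : DifferentiableAt ℝ f (b ^ 2)) :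
    deriv (fun x : ℝ => x ^ (3 / 2 : ℝ) * f x) (b ^ 2) =
      b ^ 3 * deriv f (b ^ 2) + 3 / 2 * b * f (b ^ 2) := by
  have hb2 : (b ^ 2) ≠ 0 := by positivity
  have e1 : (b ^ 2) ^ (3 / 2 : ℝ) = b ^ 3 := by
    simp only [← Real.rpow_natCast, ← Real.rpow_mul hb.le]; norm_num
  have e2 : (b ^ 2) ^ (3 / 2 - 1 : ℝ) = b := by
    simp only [← Real.rpow_natCast, ← Real.rpow_mul hb.le]; norm_num
  have h := (Real.hasDerivAt_rpow_const (p := 3 / 2) (Or.inl hb2)).mul hf.hasDerivAt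
  have h2 := h.deriv
  change deriv (fun x : ℝ => x ^ (3 / 2 : ℝ) * f x) (b ^ 2) = _ at h2
  rw [h2, e1, e2]
  ring

/-- The dictionary between the invariant tensors of `g` and the explicit flat solution. The number
`s` is the sign of `χ` relative to `ν` and enters only through the two terms linear in `χ`. -/
theorem ConfChart.push_combination {U : Set Coord} {g : Coord → Ten2} {ψ φ : Coord → Coord}
    {Ω : Coord → ℝ} (C : ConfChart U g ψ φ Ω) {p : Coord} (hp : p ∈ U) {σ : ℝ}
    {ξ η χ : Coord → Coord} (R : Represents U ψ σ ξ η) (hP : 0 < xiSq σ (ψ p))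
    (hQ : 0 < rhoSq (ψ p)) {s : ℝ}
    (hχ : ∀ A, ∑ i, jac ψ p A i * χ p i =
      s / (Ω p ^ 3 * xiSq σ (ψ p) * rhoSq (ψ p)) * canonNu σ (ψ p) A)
    {f : ℝ → ℝ} (hf : DifferentiableAt ℝ f (flatX σ (ψ p))) (h : ℝ → ℝ) (c₁ c₂ : ℝ) :
    flatComb σ f h (s * c₁) (s * c₂) (ψ p) =
      Ω p ^ 5 • push (jac ψ p) (combination g ξ η χ f h c₁ c₂ p) := by
  have hΩ := C.pos p hp
  have hX := C.quotX_eq hp R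
  have nξ := C.vnorm_xi hp R
  have nη := C.vnorm_eta hp R
  have kξ := C.push_calD hp (V := ξ) (v := canonXi σ) (R.xi p hp)
  have kη := C.push_calD hp (V := η) (v := canonEta) (R.eta p hp)
  have sξ := fun A => (R.xi p hp A).symm
  have sη := fun A => (R.eta p hp A).symm
  have hXdef : flatX σ (ψ p) = √(xiSq σ (ψ p)) / √(rhoSq (ψ p)) := rfl
  unfold combination flatComb tensorF tensorH tensorV
  simp only [sub_eq_add_neg, ← neg_smul]
  simp only [push_add, push_smul, kξ, kη, nξ, nη, hX, weighted]
  rw [hXdef] at hf ⊢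
  obtain ⟨a, ha, hPa, ra, -, -, -, p4, p5, p6, p7, p8⟩ := exists_quartic_root hP
  obtain ⟨b, hb, hQb, rb, -, -, -, q4, q5, q6, q7, q8⟩ := exists_quartic_root hQ
  have eX : √(xiSq σ (ψ p)) / √(rhoSq (ψ p)) = (a / b) ^ 2 := by rw [ra, rb, div_pow]
  rw [eX] at hf ⊢
  rw [deriv_div_rpow (by positivity) hf, deriv_rpow_mul (by positivity) hf]
  have hpow : ∀ c : ℝ, 0 < c → (Ω p * c ^ 2) ^ (5 / 2 : ℝ) = Ω p ^ (5 / 2 : ℝ) * c ^ 5 := by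
    intro c hc
    rw [Real.mul_rpow hΩ.le (by positivity)]
    congr 1
    simp only [← Real.rpow_natCast, ← Real.rpow_mul hc.le]; norm_num
  have hΩ5 : Ω p ^ (5 / 2 : ℝ) * Ω p ^ (5 / 2 : ℝ) = Ω p ^ 5 := by
    rw [← Real.rpow_add hΩ, ← Real.rpow_natCast]; norm_num
  simp only [ra, rb, p4, p5, p6, p7, p8, q4, q5, q6, q7, q8, hpow a ha, hpow b hb]
  rw [show Ω p ^ (5 / 2 : ℝ) * b ^ 5 * (Ω p ^ (5 / 2 : ℝ) * a ^ 5) = Ω p ^ 5 * b ^ 5 * a ^ 5 by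
    rw [← hΩ5]; ring]
  funext A B
  simp only [Pi.add_apply, Pi.sub_apply, Pi.smul_apply, smul_eq_mul, push_symProd, sξ, sη, hχ]
  simp only [symProd, hPa, hQb]
  generalize deriv f ((a / b) ^ 2) = f'
  generalize f ((a / b) ^ 2) = f0
  generalize h ((a / b) ^ 2) = h0
  field_simp
  ring

namespace ConfChart

variable {U : Set Coord} {g : Coord → Ten2} {ψ φ : Coord → Coord} {Ω : Coord → ℝ}
  (C : ConfChart U g ψ φ Ω) {σ : ℝ} {ξ η : Coord → Coord} (R : Represents U ψ σ ξ η)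
  (hP : ∀ p ∈ U, 0 < xiSq σ (ψ p)) (hQ : ∀ p ∈ U, 0 < rhoSq (ψ p))
include C R hP hQ

theorem sq_inv_norms {p : Coord} (hp : p ∈ U) : ((vnorm g ξ p)⁻¹ * (vnorm g η p)⁻¹) ^ 2 =
    (Ω p ^ 4 * xiSq σ (ψ p) * rhoSq (ψ p))⁻¹ := by
  rw [C.vnorm_xi hp R, C.vnorm_eta hp R, ← mul_inv, inv_pow, mul_pow, mul_pow, mul_pow,
    Real.sq_sqrt (hP p hp).le, Real.sq_sqrt (hQ p hp).le]
  ring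

/-- The auxiliary vector field. -/
theorem exists_auxiliary : ∃ χ, IsAuxiliary U g ξ η χ := by
  -- Since `|ν|² = PQ` in the flat metric, this factor gives the `g`-norm `Ω s √(PQ) = 1/(Ω² √(PQ))
  -- = 1/(|ξ| |η|)`.
  let s : Coord → ℝ := fun p => (Ω p ^ 3 * (xiSq σ (ψ p) * rhoSq (ψ p)))⁻¹
  let χ : Coord → Coord := fun p i => s p * ∑ A, jac φ (ψ p) i A * canonNu σ (ψ p) A
  have hJ : ∀ p ∈ U, ∀ A, ∑ i, jac ψ p A i * χ p i = s p * canonNu σ (ψ p) A := by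
    intro p hp A
    have : ∑ i, jac ψ p A i * χ p i =
        s p * ∑ B, (∑ i, jac ψ p A i * jac φ (ψ p) i B) * canonNu σ (ψ p) B := by
      simp only [χ, Fin.sum_univ_three]
      ring
    rw [this]
    simp [C.jac_mul_inv hp]
  refine ⟨χ, ?_, fun p hp => ?_, fun p hp => ?_, fun p hp => ?_⟩
  · intro p hp
    have h1 := C.contDiffAt hp
    have hs : ContDiffAt ℝ ∞ s p := by
      refine ContDiffAt.inv (((C.contDiffAt_factor hp).pow 3).mul
        ((((contDiff_xiSq σ).of_le le_top).contDiffAt.comp p h1).mul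
          ((contDiff_rhoSq.of_le le_top).contDiffAt.comp p h1))) ?_
      have := C.pos p hp
      have := hP p hp
      have := hQ p hp
      positivity
    refine ContDiffAt.contDiffWithinAt (contDiffAt_pi.2 fun i => hs.mul ?_)
    exact ContDiffAt.sum fun A _ => (C.contDiffAt_jac_inv hp i A).mul
      ((contDiffAt_pi.1 ((contDiff_canonNu σ).of_le le_top).contDiffAt A).comp p h1)
  · rw [C.ip_eq hp]
    simp only [hJ p hp, ← R.xi p hp, mul_assoc, ← Finset.mul_sum, sum_nu_xi, mul_zero]
  · rw [C.ip_eq hp]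
    simp only [hJ p hp, ← R.eta p hp, mul_assoc, ← Finset.mul_sum, sum_nu_eta, mul_zero]
  · have h1 := C.pos p hp
    have h2 := hP p hp
    have h3 := hQ p hp
    have hn := C.sq_inv_norms R hP hQ hp
    have h4 : ip g p (χ p) (χ p) = ((vnorm g ξ p)⁻¹ * (vnorm g η p)⁻¹) ^ 2 := by
      rw [C.ip_eq hp]
      have : ∑ A, (∑ i, jac ψ p A i * χ p i) * ∑ i, jac ψ p A i * χ p i =
          s p ^ 2 * ∑ A, canonNu σ (ψ p) A * canonNu σ (ψ p) A := by
        simp only [hJ p hp, Fin.sum_univ_three]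
        ring
      rw [this, sum_nu_nu, hn]
      simp only [s]
      field_simp
    rw [vnorm, h4, Real.sqrt_sq]
    unfold vnorm
    positivity

/-- The auxiliary vector field is unique up to a constant sign. -/
theorem auxiliary_eq (hU : IsPreconnected U) {χ : Coord → Coord} (hχ : IsAuxiliary U g ξ η χ) :
    ∃ s : ℝ, s * s = 1 ∧ ∀ p ∈ U, ∀ A, ∑ i, jac ψ p A i * χ p i =
      s / (Ω p ^ 3 * xiSq σ (ψ p) * rhoSq (ψ p)) * canonNu σ (ψ p) A := by
  -- Orthogonality leaves only the `ν`-component of `χ`, of which `τ` is the normalised size. The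
  -- norm condition forces `τ² = 1`, and a continuous square root of `1` is constant on a connected
  -- set.
  let τ : Coord → ℝ := fun p => Ω p ^ 3 * ∑ A, canonNu σ (ψ p) A * ∑ i, jac ψ p A i * χ p i
  have hJ : ∀ p ∈ U, ∀ A, ∑ i, jac ψ p A i * χ p i =
      τ p / (Ω p ^ 3 * xiSq σ (ψ p) * rhoSq (ψ p)) * canonNu σ (ψ p) A := by
    intro p hp A
    have h1 := C.pos p hp
    have h2 := hP p hp
    have h3 := hQ p hp
    have e1 := hχ.orth_xi p hp
    have e2 := hχ.orth_eta p hp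
    rw [C.ip_eq hp] at e1 e2
    simp only [← R.xi p hp, ← R.eta p hp, mul_eq_zero, pow_eq_zero_iff, ne_eq,
      OfNat.ofNat_ne_zero, not_false_eq_true, h1.ne', false_or] at e1 e2
    have h4 : xiSq σ (ψ p) * rhoSq (ψ p) * ∑ i, jac ψ p A i * χ p i =
        ∑ B, (rhoSq (ψ p) * (canonXi σ (ψ p) B * canonXi σ (ψ p) A) +
          xiSq σ (ψ p) * (canonEta (ψ p) B * canonEta (ψ p) A) +
          canonNu σ (ψ p) B * canonNu σ (ψ p) A) * ∑ i, jac ψ p B i * χ p i := by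
      simp only [frame_complete, ite_mul, zero_mul, Finset.sum_ite_eq', Finset.mem_univ, if_true]
    have h5 : xiSq σ (ψ p) * rhoSq (ψ p) * ∑ i, jac ψ p A i * χ p i =
        (∑ B, canonNu σ (ψ p) B * ∑ i, jac ψ p B i * χ p i) * canonNu σ (ψ p) A := by
      rw [h4]
      generalize (fun A => ∑ i, jac ψ p A i * χ p i) = X at *
      rw [Fin.sum_univ_three] at e1 e2
      simp only [Fin.sum_univ_three] at e1 e2 ⊢
      linear_combination rhoSq (ψ p) * canonXi σ (ψ p) A * e1 +
        xiSq σ (ψ p) * canonEta (ψ p) A * e2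
    simp only [τ]
    generalize ∑ B, canonNu σ (ψ p) B * ∑ i, jac ψ p B i * χ p i = T at *
    rw [← mul_right_inj' (mul_pos h2 h3).ne', h5]
    field_simp
  have hsq : ∀ p ∈ U, τ p ^ 2 = 1 := by
    intro p hp
    have h1 := C.pos p hp
    have h2 := hP p hp
    have h3 := hQ p hp
    have e : ip g p (χ p) (χ p) = (Ω p ^ 4 * xiSq σ (ψ p) * rhoSq (ψ p))⁻¹ := by
      rw [← C.sq_inv_norms R hP hQ hp, ← hχ.norm_eq p hp, vnorm, Real.sq_sqrt]
      rw [C.ip_eq hp]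
      exact mul_nonneg (by positivity) (Finset.sum_nonneg fun A _ => mul_self_nonneg _)
    rw [C.ip_eq hp] at e
    have h4 : ∑ A, (∑ i, jac ψ p A i * χ p i) * ∑ i, jac ψ p A i * χ p i =
        (τ p / (Ω p ^ 3 * xiSq σ (ψ p) * rhoSq (ψ p))) ^ 2 *
          ∑ A, canonNu σ (ψ p) A * canonNu σ (ψ p) A := by
      simp only [hJ p hp, Fin.sum_univ_three]
      ring
    rw [h4, sum_nu_nu] at e
    generalize τ p = t at *
    field_simp at e
    exact e
  have hcont : ContinuousOn τ U := by
    intro p hp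
    refine ContinuousAt.continuousWithinAt ?_
    have h1 := (C.contDiffAt hp).continuousAt
    refine ((C.contDiffAt_factor hp).continuousAt.pow 3).mul (tendsto_finsetSum _ fun A _ => ?_)
    refine ContinuousAt.mul ?_ (tendsto_finsetSum _ fun i _ => ?_)
    · exact ((continuous_apply A).comp (contDiff_canonNu σ).continuous).continuousAt.comp h1
    · exact (C.contDiffAt_jac hp A i).continuousAt.mul ((continuous_apply i).continuousAt.comp
        (hχ.smooth.contDiffAt (C.isOpen.mem_nhds hp)).continuousAt)
  rcases hU.eq_or_eq_neg_of_sq_eq (f := τ) (g := fun _ => 1) hcont continuousOn_const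
    (fun p hp => by simpa using hsq p hp) (fun _ => one_ne_zero) with h | h
  · exact ⟨1, by norm_num, fun p hp A => by rw [hJ p hp, h hp]⟩
  · exact ⟨-1, by norm_num, fun p hp A => by rw [hJ p hp, h hp]; rfl⟩

end ConfChart

/-! ### Behaviour under conformal rescaling of the metric -/

section Rescale

variable {g : Coord → Ten2} {Λ : Coord → ℝ} {p : Coord}

theorem ip_rescale (u v : Coord) : ip (rescale Λ g) p u v = Λ p ^ 2 * ip g p u v := by
  simp only [ip, rescale, Finset.mul_sum, mul_assoc]

theorem vnorm_rescale (hΛ : 0 < Λ p) (V : Coord → Coord) :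
    vnorm (rescale Λ g) V p = Λ p * vnorm g V p := by
  rw [vnorm, ip_rescale, Real.sqrt_mul (by positivity), Real.sqrt_sq hΛ.le, vnorm]

theorem ip_smul_left (c : ℝ) (u v : Coord) : ip g p (c • u) v = c * ip g p u v := by
  simp only [ip, Pi.smul_apply, smul_eq_mul, Finset.mul_sum]
  exact Finset.sum_congr rfl fun i _ => Finset.sum_congr rfl fun j _ => by ring

theorem quotX_rescale (hΛ : 0 < Λ p) (V W : Coord → Coord) :
    quotX (rescale Λ g) V W p = quotX g V W p := by
  rw [quotX, vnorm_rescale hΛ, vnorm_rescale hΛ, mul_div_mul_left _ _ hΛ.ne', quotX]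

theorem vnorm_smul (c : Coord → ℝ) (hc : 0 ≤ c p) (V : Coord → Coord) :
    vnorm g (fun q => c q • V q) p = c p * vnorm g V p := by
  have : ip g p (c p • V p) (c p • V p) = c p ^ 2 * ip g p (V p) (V p) := by
    simp only [ip, Pi.smul_apply, smul_eq_mul, Finset.mul_sum]
    exact Finset.sum_congr rfl fun i _ => Finset.sum_congr rfl fun j _ => by ring
  rw [vnorm, this, Real.sqrt_mul (by positivity), Real.sqrt_sq hc, vnorm]

theorem IsAuxiliary.rescale {U : Set Coord} {ξ η χ : Coord → Coord} (h : IsAuxiliary U g ξ η χ)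
    (hΛs : ContDiffOn ℝ ∞ Λ U) (hΛ : ∀ p ∈ U, 0 < Λ p) :
    IsAuxiliary U (rescale Λ g) ξ η (fun p => (Λ p ^ 3)⁻¹ • χ p) where
  smooth := ((hΛs.pow 3).inv fun p hp => pow_ne_zero 3 (hΛ p hp).ne').smul h.smooth
  orth_xi p hp := by rw [ip_rescale, ip_smul_left, h.orth_xi p hp, mul_zero, mul_zero]
  orth_eta p hp := by rw [ip_rescale, ip_smul_left, h.orth_eta p hp, mul_zero, mul_zero]
  norm_eq p hp := by
    have h0 := hΛ p hp
    rw [vnorm_rescale h0, vnorm_rescale h0, vnorm_rescale h0,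
      vnorm_smul (fun q => (Λ q ^ 3)⁻¹) (by positivity), h.norm_eq p hp]
    field_simp

theorem calD_rescale (hΛ : 0 < Λ p) (hinv : ginv (rescale Λ g) p = (Λ p ^ 2)⁻¹ • ginv g p)
    (V : Coord → Coord) : calD (rescale Λ g) V p = (Λ p ^ 5)⁻¹ • calD g V p := by
  funext i j
  simp only [calD, hinv, vnorm_rescale hΛ, Pi.smul_apply, smul_eq_mul]
  field_simp

theorem tensorF_rescale (hΛ : 0 < Λ p) (hinv : ginv (rescale Λ g) p = (Λ p ^ 2)⁻¹ • ginv g p)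
    (ξ η : Coord → Coord) (f : ℝ → ℝ) :
    tensorF (rescale Λ g) ξ η f p = (Λ p ^ 5)⁻¹ • tensorF g ξ η f p := by
  simp only [tensorF, quotX_rescale hΛ, calD_rescale hΛ hinv, smul_sub, smul_smul]
  simp only [mul_comm]

theorem tensorH_rescale (hΛ : 0 < Λ p) (ξ η : Coord → Coord) (h : ℝ → ℝ) :
    tensorH (rescale Λ g) ξ η h p = (Λ p ^ 5)⁻¹ • tensorH g ξ η h p := by
  have e : Λ p ^ (5 / 2 : ℝ) * Λ p ^ (5 / 2 : ℝ) = Λ p ^ 5 := by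
    rw [← Real.rpow_add hΛ, ← Real.rpow_natCast]; norm_num
  simp only [tensorH, quotX_rescale hΛ, vnorm_rescale hΛ, smul_smul]
  congr 1
  have hn : ∀ V : Coord → Coord, 0 ≤ vnorm g V p := fun V => Real.sqrt_nonneg _
  rw [Real.mul_rpow hΛ.le (hn _), Real.mul_rpow hΛ.le (hn _), mul_mul_mul_comm, e,
    div_eq_mul_inv, mul_inv]
  ring

theorem tensorV_rescale (hΛ : 0 < Λ p) (χ V : Coord → Coord) :
    tensorV (rescale Λ g) (fun q => (Λ q ^ 3)⁻¹ • χ q) V p = (Λ p ^ 5)⁻¹ • tensorV g χ V p := by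
  funext i j
  simp only [tensorV, vnorm_rescale hΛ, symProd, Pi.smul_apply, smul_eq_mul, mul_pow, mul_inv]
  field_simp

end Rescale

theorem ConfChart.rescale {U : Set Coord} {g : Coord → Ten2} {ψ φ : Coord → Coord}
    {Ω : Coord → ℝ} (C : ConfChart U g ψ φ Ω) {Λ : Coord → ℝ} (hΛs : ContDiffOn ℝ ∞ Λ U)
    (hΛ : ∀ p ∈ U, 0 < Λ p) : ConfChart U (rescale Λ g) ψ φ (fun p => Λ p * Ω p) where
  isOpen := C.isOpen
  smooth := C.smooth
  smoothFactor := hΛs.mul C.smoothFactor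
  pos p hp := mul_pos (hΛ p hp) (C.pos p hp)
  metric p hp i j := by rw [ConfFlat3.rescale, C.metric p hp]; ring
  image_open := C.image_open
  left_inv := C.left_inv
  smoothInv := C.smoothInv

theorem ConfChart.ginv_rescale {U : Set Coord} {g : Coord → Ten2} {ψ φ : Coord → Coord}
    {Ω : Coord → ℝ} (C : ConfChart U g ψ φ Ω) {Λ : Coord → ℝ} (hΛs : ContDiffOn ℝ ∞ Λ U)
    (hΛ : ∀ p ∈ U, 0 < Λ p) {p : Coord} (hp : p ∈ U) :
    ginv (ConfFlat3.rescale Λ g) p = (Λ p ^ 2)⁻¹ • ginv g p := by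
  funext i j
  simp only [Pi.smul_apply, smul_eq_mul]
  rw [(C.rescale hΛs hΛ).ginv_eq hp, C.ginv_eq hp, mul_pow, mul_inv, mul_assoc]

end

end ConfFlat3

/-! ### Assembly of the theorem -/

open ConfFlat3
theorem theorem8p1
    (U : Set Coord) (hU : IsOpen U) (hUc : IsPreconnected U)
    (g : Coord → Ten2) (hg : IsMetricOn U g)
    (ξ ξt η : Coord → Coord) (μ σ : ℝ)
    (hξ : IsCKVF U g ξ) (hcan : IsCanonicalForm U g ξ ξt η μ σ)
    (hξt : ∀ p ∈ U, ξt p ≠ 0) (hη : ∀ p ∈ U, η p ≠ 0) :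
    -- the auxiliary vector field exists
    (∃ χ : Coord → Coord, IsAuxiliary U g ξt η χ) ∧
    ∀ χ : Coord → Coord, IsAuxiliary U g ξt η χ →
      -- every TT-tensor satisfying both KID equations is a combination of the four tensors
      (∀ k : ℕ∞, 1 ≤ k → ∀ D : Coord → Ten2, ContDiffOn ℝ (k : WithTop ℕ∞) D U →
        IsTT U g D → IsKID U g ξt D → IsKID U g η D →
        ∃ c₁ c₂ : ℝ, ∀ W : Set Coord, W ⊆ U → IsOpen W →
          (∀ c : ℝ, IsPreconnected {p | p ∈ W ∧ quotX g ξt η p = c}) →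
          ∃ f h : ℝ → ℝ,
            ContDiffOn ℝ ((k + 1 : ℕ∞) : WithTop ℕ∞) f (quotX g ξt η '' W) ∧
            ContDiffOn ℝ (k : WithTop ℕ∞) h (quotX g ξt η '' W) ∧
            ∀ p ∈ W, D p = combination g ξt η χ f h c₁ c₂ p) ∧
      -- conversely, for arbitrary functions and constants these are solutions
      (∀ k : ℕ∞, 1 ≤ k → ∀ (f h : ℝ → ℝ) (c₁ c₂ : ℝ),
        (∀ p ∈ U, ContDiffAt ℝ ((k + 1 : ℕ∞) : WithTop ℕ∞) f (quotX g ξt η p)) →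
        (∀ p ∈ U, ContDiffAt ℝ (k : WithTop ℕ∞) h (quotX g ξt η p)) →
        ContDiffOn ℝ (k : WithTop ℕ∞) (combination g ξt η χ f h c₁ c₂) U ∧
        IsTT U g (combination g ξt η χ f h c₁ c₂) ∧
        IsKID U g ξt (combination g ξt η χ f h c₁ c₂) ∧
        IsKID U g η (combination g ξt η χ f h c₁ c₂)) ∧
      -- conformal covariance of the construction, with weight `-5` for the tensors
      (∀ Ω : Coord → ℝ, ContDiffOn ℝ ∞ Ω U → (∀ p ∈ U, 0 < Ω p) →
        IsAuxiliary U (rescale Ω g) ξt η (fun p => (Ω p ^ 3)⁻¹ • χ p) ∧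
        ∀ p ∈ U,
          quotX (rescale Ω g) ξt η p = quotX g ξt η p ∧
          (∀ f : ℝ → ℝ, tensorF (rescale Ω g) ξt η f p = (Ω p ^ 5)⁻¹ • tensorF g ξt η f p) ∧
          (∀ h : ℝ → ℝ, tensorH (rescale Ω g) ξt η h p = (Ω p ^ 5)⁻¹ • tensorH g ξt η h p) ∧
          tensorV (rescale Ω g) (fun q => (Ω q ^ 3)⁻¹ • χ q) ξt p =
            (Ω p ^ 5)⁻¹ • tensorV g χ ξt p ∧
          tensorV (rescale Ω g) (fun q => (Ω q ^ 3)⁻¹ • χ q) η p =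
            (Ω p ^ 5)⁻¹ • tensorV g χ η p) := by
  obtain ⟨ψ, hψ⟩ := hcan
  obtain ⟨Φ, hΦs, hΦ, hconf⟩ := hψ.conformal
  obtain ⟨φ, C⟩ := exists_confChart hU hg hψ.smooth hψ.injOn hΦs hΦ hconf
  have R : Represents U ψ σ ξt η :=
    ⟨fun q hq A => by rw [← hψ.map_xi q hq, fderiv_eq_jac (C.differentiableAt hq)],
      fun q hq A => by rw [← hψ.map_eta q hq, fderiv_eq_jac (C.differentiableAt hq)]⟩
  have hP : ∀ p ∈ U, 0 < xiSq σ (ψ p) := fun p hp => C.xiSq_pos hp R hg (hξt p hp)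
  have hQ : ∀ p ∈ U, 0 < rhoSq (ψ p) := fun p hp => C.rhoSq_pos hp R hg (hη p hp)
  refine ⟨C.exists_auxiliary R hP hQ, fun χ hχ => ?_⟩
  obtain ⟨s, hs, hJχ⟩ := C.auxiliary_eq R hP hQ hUc hχ
  refine ⟨fun k hk D hD hTT hKξ hKη => ?_, fun k hk f h c₁ c₂ hf hh => ?_, fun Λ hΛs hΛ =>
    ⟨hχ.rescale hΛs hΛ, fun p hp => ⟨quotX_rescale (hΛ p hp) _ _,
      tensorF_rescale (hΛ p hp) (C.ginv_rescale hΛs hΛ hp) _ _, tensorH_rescale (hΛ p hp) _ _,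
      tensorV_rescale (hΛ p hp) _ _, tensorV_rescale (hΛ p hp) _ _⟩⟩⟩
  · have hk0 : (k : WithTop ℕ∞) ≠ 0 := by
      intro h0
      rw [WithTop.coe_eq_zero] at h0
      simp [h0] at hk
    have hk' : (k : WithTop ℕ∞) ≤ ∞ := WithTop.coe_le_coe.2 le_top
    -- The tensor `Φ⁵ ψ_* D` as a field on the image of the chart, the unknown of the flat problem.
    let E : Coord → Ten2 := fun y => Φ (φ y) ^ 5 • push (jac ψ (φ y)) (D (φ y))
    have hDE : ∀ q ∈ U, E (ψ q) = Φ q ^ 5 • push (jac ψ q) (D q) := fun q hq => by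
      simp only [E, C.left_inv q hq]
    have hDa : ∀ p ∈ U, ContDiffAt ℝ (k : WithTop ℕ∞) D p := fun p hp =>
      hD.contDiffAt (hU.mem_nhds hp)
    have hEa : ∀ p ∈ U, ContDiffAt ℝ (k : WithTop ℕ∞) E (ψ p) := by
      intro p hp
      have hφ : ContDiffAt ℝ (k : WithTop ℕ∞) φ (ψ p) := (C.smoothInv p hp).of_le hk'
      have comp : ∀ {F : Coord → ℝ}, ContDiffAt ℝ (k : WithTop ℕ∞) F p →
          ContDiffAt ℝ (k : WithTop ℕ∞) (fun y => F (φ y)) (ψ p) := fun hF =>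
        ContDiffAt.comp (ψ p) (by rwa [C.left_inv p hp]) hφ
      refine contDiffAt_pi.2 fun A => contDiffAt_pi.2 fun B => ?_
      refine ((comp ((C.contDiffAt_factor hp).of_le hk')).pow 5).mul
        (ContDiffAt.sum fun i _ => ContDiffAt.sum fun j _ => ?_)
      exact ((comp ((C.contDiffAt_jac hp A i).of_le hk')).mul
        (comp ((C.contDiffAt_jac hp B j).of_le hk'))).mul
        (comp (contDiffAt_pi.1 (contDiffAt_pi.1 (hDa p hp) i) j))
    obtain ⟨c₁, c₂, hW⟩ := flat_classification (σ := σ) (V := ψ '' U) C.image_open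
      (hUc.image ψ C.smooth.continuousOn) (by rintro _ ⟨p, hp, rfl⟩; exact hP p hp)
      (by rintro _ ⟨p, hp, rfl⟩; exact hQ p hp) hk (E := E)
      (by rintro _ ⟨p, hp, rfl⟩; exact hEa p hp) (by
        rintro _ ⟨p, hp, rfl⟩
        exact C.flatSolAt_of_solution hp R ((hEa p hp).differentiableAt hk0)
          ((hDa p hp).differentiableAt hk0) hDE (hTT.symm p hp) (hTT.traceFree p hp)
          (hTT.divFree p hp) (hKξ p hp) (hKη p hp))
    -- The flat constants are `s` times those of the combination formed with `χ`; `s * s = 1`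
    -- inverts this relation.
    refine ⟨s * c₁, s * c₂, fun W hWU hWo hlev => ?_⟩
    have hX : ∀ p ∈ W, quotX g ξt η p = flatX σ (ψ p) := fun p hp => C.quotX_eq (hWU hp) R
    have hopen : IsOpen (ψ '' W) := by
      rw [isOpen_iff_mem_nhds]
      rintro _ ⟨p, hp, rfl⟩
      filter_upwards [C.image_open.mem_nhds ⟨p, hWU hp, rfl⟩,
        (C.smoothInv p (hWU hp)).continuousAt.eventually_mem
          (hWo.mem_nhds (by rwa [C.left_inv p (hWU hp)]))]
      rintro _ ⟨q, hq, rfl⟩ h2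
      rw [C.left_inv q hq] at h2
      exact ⟨q, h2, rfl⟩
    obtain ⟨f, h, hf, hh, hE⟩ := hW (ψ '' W) (Set.image_mono hWU) hopen (fun c => by
      have : {y | y ∈ ψ '' W ∧ flatX σ y = c} = ψ '' {p | p ∈ W ∧ quotX g ξt η p = c} := by
        ext y
        constructor
        · rintro ⟨⟨p, hp, rfl⟩, hc⟩
          exact ⟨p, ⟨hp, (hX p hp).trans hc⟩, rfl⟩
        · rintro ⟨p, ⟨hp, hc⟩, rfl⟩
          exact ⟨⟨p, hp, rfl⟩, (hX p hp).symm.trans hc⟩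
      rw [this]
      exact (hlev c).image ψ (C.smooth.continuousOn.mono fun p hp => hWU hp.1))
    refine ⟨f, h, ?_, ?_, fun p hp => ?_⟩
    · rintro _ ⟨p, hp, rfl⟩
      rw [hX p hp]
      exact (hf _ ⟨p, hp, rfl⟩).contDiffWithinAt
    · rintro _ ⟨p, hp, rfl⟩
      rw [hX p hp]
      exact (hh _ ⟨p, hp, rfl⟩).contDiffWithinAt
    · have hpU := hWU hp
      have h1 := C.push_combination hpU R (hP p hpU) (hQ p hpU) (hJχ p hpU)
        ((hf _ ⟨p, hp, rfl⟩).differentiableAt (by simp)) h (s * c₁) (s * c₂)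
      rw [← mul_assoc, ← mul_assoc, hs, one_mul, one_mul, ← hE _ ⟨p, hp, rfl⟩, hDE p hpU] at h1
      have h2 := smul_right_injective Ten2 (pow_ne_zero 5 (C.pos p hpU).ne') h1
      funext i j
      rw [push_inv (C.jac_inv_mul hpU) (D p), h2, ← push_inv (C.jac_inv_mul hpU)]
  · have hk1 : (1 : WithTop ℕ∞) ≤ (k : WithTop ℕ∞) := by exact_mod_cast hk
    have hk0 : (k : WithTop ℕ∞) ≠ 0 := by
      intro h0
      rw [WithTop.coe_eq_zero] at h0
      simp [h0] at hk
    have hk' : (k : WithTop ℕ∞) ≤ ∞ := WithTop.coe_le_coe.2 le_top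
    set D := combination g ξt η χ f h c₁ c₂ with hDdef
    set E := flatComb σ f h (s * c₁) (s * c₂) with hEdef
    have hf1 : ∀ p ∈ U, ContDiffAt ℝ ((k : WithTop ℕ∞) + 1) f (flatX σ (ψ p)) := fun p hp => by
      rw [← C.quotX_eq hp R]
      exact hf p hp
    have hh1 : ∀ p ∈ U, ContDiffAt ℝ (k : WithTop ℕ∞) h (flatX σ (ψ p)) := fun p hp => by
      rw [← C.quotX_eq hp R]
      exact hh p hp
    have hfd : ∀ p ∈ U, DifferentiableAt ℝ f (flatX σ (ψ p)) := fun p hp =>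
      (hf1 p hp).differentiableAt (by simp)
    have hDE : ∀ q ∈ U, E (ψ q) = Φ q ^ 5 • push (jac ψ q) (D q) := fun q hq =>
      C.push_combination hq R (hP q hq) (hQ q hq) (hJχ q hq) (hfd q hq) h c₁ c₂
    have hEa : ∀ p ∈ U, ContDiffAt ℝ (k : WithTop ℕ∞) E (ψ p) := fun p hp =>
      contDiffAt_flatComb (hP p hp) (hQ p hp) (hf1 p hp) (hh1 p hp) _ _
    -- The regularity is read off from `E` by inverting the push-forward, since `flatComb` involves
    -- only `f`, `f'` and `h` with smooth coefficients.
    have hDa : ∀ p ∈ U, ContDiffAt ℝ (k : WithTop ℕ∞) D p := by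
      intro p hp
      have h1 : ContDiffAt ℝ (k : WithTop ℕ∞) (fun q i j => (Φ q ^ 5)⁻¹ *
          ∑ A, ∑ B, jac φ (ψ q) i A * jac φ (ψ q) j B * E (ψ q) A B) p := by
        refine contDiffAt_pi.2 fun i => contDiffAt_pi.2 fun j => ?_
        refine ((((C.contDiffAt_factor hp).of_le hk').pow 5).inv
          (pow_ne_zero 5 (C.pos p hp).ne')).mul
          (ContDiffAt.sum fun A _ => ContDiffAt.sum fun B _ => ?_)
        exact (((C.contDiffAt_jac_inv hp i A).of_le hk').mul
          ((C.contDiffAt_jac_inv hp j B).of_le hk')).mul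
          ((contDiffAt_pi.1 (contDiffAt_pi.1 (hEa p hp) A) B).comp p ((C.contDiffAt hp).of_le hk'))
      refine h1.congr_of_eventuallyEq ?_
      filter_upwards [hU.mem_nhds hp] with q hq
      funext i j
      have hq0 := (C.pos q hq).ne'
      rw [push_inv (C.jac_inv_mul hq) (D q), hDE q hq]
      simp only [Pi.smul_apply, smul_eq_mul, Finset.mul_sum]
      refine Finset.sum_congr rfl fun A _ => Finset.sum_congr rfl fun B _ => ?_
      field_simp
    have hsol := fun p (hp : p ∈ U) => C.solution_of_flatSolAt hp R
      ((hEa p hp).differentiableAt hk0) ((hDa p hp).differentiableAt hk0) hDE (by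
        have hf' : DifferentiableAt ℝ (deriv f) (flatX σ (ψ p)) :=
          (((hf1 p hp).fderiv_right (m := (k : WithTop ℕ∞)) le_rfl).clm_apply
            contDiffAt_const).differentiableAt hk0
        obtain ⟨d, hd, hsol⟩ := flatComb_hasGrad (hP p hp) (hQ p hp) (hfd p hp) hf'
          ((hh1 p hp).differentiableAt hk0) (s * c₁) (s * c₂)
        rw [hd.pdTen]
        exact hsol)
    exact ⟨fun p hp => (hDa p hp).contDiffWithinAt,
      ⟨fun p hp => (hsol p hp).1, fun p hp => (hsol p hp).2.1, fun p hp => (hsol p hp).2.2.1⟩,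
      fun p hp => (hsol p hp).2.2.2.1, fun p hp => (hsol p hp).2.2.2.2⟩
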